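/- For $u,v\in\mathscr S(\mathbb R)$ let $\mathcal W(u,v)(x,\xi)=\int_{\mathbb R}e^{-2i\pi z\xi}u(x+\tfrac z2)\overline{v(x-\tfrac z2)}\,dz$ be the joint Wigner distribution. For a bounded measurable function $a$ on $\mathbb R^2$, the Weyl quantization $\mathrm{Op}_w(a)$ is defined by $\langle \mathrm{Op}_w(a)u,v\rangle_{L^2(\mathbb R)}=\iint a(x,\xi)\,\mathcal W(u,v)(x,\xi)\,dx\,d\xi$ for all $u,v\in\mathscr S(\mathbb R)$. For $N\ge 1$ let $\mathscr P_N$ be the set of convex polygons with $N$ sides, i.e. of all sets $\{X\in\mathbb R^2: L_j(X)\ge c_j,\ 1\le j\le N\}$ with linear forms $L_1,\dots,L_N$ on $\mathbb R^2$ (possibly zero) and $c_1,\dots,c_N\in\mathbb R$; such a set may be unbounded. For every $N\ge1$ and every $\mathcal P\in\mathscr P_N$, the operator $\mathrm{Op}_w(\mathbf 1_{\mathcal P})$ extends uniquely to a bounded operator on $L^2(\mathbb R)$, and $$\mu_N^+=\sup_{\mathcal P\in\mathscr P_N}\|\mathrm{Op}_w(\mathbf 1_{\mathcal P})\|_{\mathcal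 B(L^2(\mathbb R))}$$ is finite. Moreover: (1) $\mu_2^+>1$, and $\mu_2^+$ is the largest element of the spectrum of the bounded self-adjoint operator $\mathrm{Op}_w(\mathbf 1_{\{x\ge0,\ \xi\ge0\}})$; it is also the supremum, over $\tau\in\mathbb R$, of the eigenvalues of the Hermitian matrix $$\mathcal M_0(\tau)=\begin{pmatrix} \frac12+\frac1{2\pi}\int_0^{\infty}\frac{\sin(2\pi t\tau)}{\sinh(t/2)}\,dt & s(\tau)\\ \overline{s(\tau)} & 0\end{pmatrix},\qquad s(\tau)=\frac{i}{4\pi}\int_0^{\infty}\frac{e^{-2i\pi t\tau}}{\cosh(t/2)}\,dt .$$ (2) For all $N\ge2$, $\ \mu_N^+\le\frac12\Bigl(\mu_{N-1}^++\sqrt{(\mu_{N-1}^+)^2+1}\Bigr)$. (3) For all $N\ge3$, $\ \mu_N^+\le\sqrt{N/2}$. -/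

import Mathlib

open MeasureTheory
open scoped SchwartzMap

/-- The complex Hilbert space `L²(ℝ)`. -/
abbrev L2R : Type := Lp ℂ 2 (volume : Measure ℝ)

/-- The joint Wigner distribution
`W(u,v)(x,ξ) = ∫ e^{-2iπzξ} u(x+z/2) conj(v(x-z/2)) dz`. -/
noncomputable def wigner (u v : ℝ → ℂ) (X : ℝ × ℝ) : ℂ :=
  ∫ z : ℝ, Complex.exp (-(2 * Real.pi * z * X.2 : ℝ) * Complex.I) *
    u (X.1 + z / 2) * starRingEnd ℂ (v (X.1 - z / 2))

/-- The bounded operator `A` on `L²(ℝ)` is the Weyl quantization of the (bounded, measurable)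
symbol `a` on the phase plane: `⟨A u, v⟩ = ∬ a(x,ξ) W(u,v)(x,ξ) dx dξ` for all `u, v` in the
Schwartz class, where the scalar product `⟨f, g⟩ = ∫ f conj(g)` is linear on the left
(so that it is `inner ℂ g f` in Mathlib's convention). -/
def IsWeylQuantization (a : ℝ × ℝ → ℂ) (A : L2R →L[ℂ] L2R) : Prop :=
  ∀ u v : 𝓢(ℝ, ℂ),
    inner ℂ (v.toLp 2 volume : L2R) (A (u.toLp 2 volume)) = ∫ X : ℝ × ℝ, a X * wigner u v X

/-- The indicator function of a subset of the phase plane, as a symbol. -/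
noncomputable def indicatorSymbol (P : Set (ℝ × ℝ)) : ℝ × ℝ → ℂ :=
  P.indicator (fun _ => (1 : ℂ))

/-- The set of convex polygons with `N` sides: all the sets
`{X ∈ ℝ² | L₁(X) ≥ c₁, …, L_N(X) ≥ c_N}` with linear forms `L_j` (possibly zero, possibly
redundant) and real numbers `c_j`. -/
def polygons (N : ℕ) : Set (Set (ℝ × ℝ)) :=
  {P | ∃ (L : Fin N → (ℝ × ℝ →ₗ[ℝ] ℝ)) (c : Fin N → ℝ), P = {X | ∀ j, c j ≤ L j X}}

/-- The norms on `L²(ℝ)` of the Weyl quantizations of the indicator functions of the convex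
polygons with `N` sides. -/
def polygonNorms (N : ℕ) : Set ℝ :=
  {r | ∃ P ∈ polygons N, ∃ A : L2R →L[ℂ] L2R,
    IsWeylQuantization (indicatorSymbol P) A ∧ r = ‖A‖}

/-- `μ_N⁺`, the supremum of these norms. -/
noncomputable def muPlus (N : ℕ) : ℝ := sSup (polygonNorms N)

/-- The closed quarter plane `{x ≥ 0, ξ ≥ 0}`. -/
def quarterPlane : Set (ℝ × ℝ) := {X | 0 ≤ X.1 ∧ 0 ≤ X.2}

/-- The off-diagonal entry `(i/4π) ∫₀^∞ e^{-2iπtτ} / cosh(t/2) dt`. -/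
noncomputable def quarterOffDiag (τ : ℝ) : ℂ :=
  (Complex.I / (4 * Real.pi : ℝ)) *
    ∫ t in Set.Ioi (0 : ℝ), Complex.exp (-(2 * Real.pi * t * τ : ℝ) * Complex.I) /
      (Real.cosh (t / 2) : ℂ)

/-- The Hermitian matrix `M₀(τ)` of the Fourier multiplier attached to the quarter plane. Its
upper left entry is `1/2 + (1/2π) ∫₀^∞ sin(2πtτ) / sinh(t/2) dt`. -/
noncomputable def quarterMatrix (τ : ℝ) : Matrix (Fin 2) (Fin 2) ℂ :=
  !![((1 / 2 + 1 / (2 * Real.pi) *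
        ∫ t in Set.Ioi (0 : ℝ), Real.sin (2 * Real.pi * t * τ) / Real.sinh (t / 2) : ℝ) : ℂ),
      quarterOffDiag τ;
     starRingEnd ℂ (quarterOffDiag τ), 0]

/-- The real numbers which are an eigenvalue of one of the matrices `M₀(τ)`, `τ ∈ ℝ`. -/
def quarterEigenvalues : Set ℝ :=
  {r | ∃ τ : ℝ, Module.End.HasEigenvalue (Matrix.toLin' (quarterMatrix τ)) (r : ℂ)}

/-! ### Square-integrable functions on the line -/

open scoped FourierTransform ContDiff
open Complex (I)

/-! In the variables s = x + z/2, t = x - z/2 the Weyl form of a symbol is an integral operator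
whose kernel at (s, t) is the Fourier transform in ξ of the slice a((s+t)/2, ·), taken at s - t.
Everything rests on reading this kernel in the right coordinates.

Recursion. Area-preserving affine maps (shears, the quarter turn, translations) act on Wigner
distributions through L² isometries of the Schwartz space, so any half plane can be moved to x ≥ 0.
Let P be convex with form bounded by M, and cut it by x ≥ 0. Split L² into functions on [0, ∞) and
on (-∞, 0). On the (+,+) block the cut is invisible, so M still bounds it; the (-,-) block vanishes.
On the mixed blocks the slices of P are intervals, whose Fourier transforms are at most 1/(π|z|),
and the kernel is dominated by the half of Hilbert's kernel 1/(π(s+t)) on 0 < t ≤ s, which has norm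
at most 1/2 by a Schur test (`lintegral_hilbert_kernel_le`). The norm of the matrix ((M, 1/2), (1/2,
0)) is `nextBound M`, and this is (2). Starting from the whole plane, the same step proves
boundedness for every N. The cut functions are no longer Schwartz and the slices may be unbounded,
so P is first replaced by a Gaussian regularisation (`regSymbol`), which is integrable, keeps the
bound M and keeps the slice estimate; the half plane itself is cut sharply, and the regularisation
is removed by dominated convergence (`FormBound.inter_halfPlane`).

The value for two sides. Two non-parallel half planes form a cone which a symplectic affine map
takes to the quarter plane; parallel ones give multiplication operators of norm at most 1. For the
quarter plane the kernel is 1_{s+t ≥ 0}/(2πi(s-t)), homogeneous of degree -1, so in the coordinate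
log|x| on each half line it becomes a 2×2 matrix of convolutions, diagonalised by the Fourier
transform: this is M₀(τ) (`weylForm_quarterPlane_lineLift`). Wave packets concentrated at a
frequency τ show that the supremum of the form is the supremum of the top eigenvalues `quarterTop`
(`quarterTop_le_of_re_inner_le`). Since the form is also at least -1/2, this supremum is both the
norm and the top of the spectrum.

Numbers. The diagonal entry is (1 + tanh(2π²τ))/2, which tends to 1 exponentially fast as τ grows,
while the off-diagonal entry decays only like 1/τ; hence an eigenvalue exceeds 1. In the other
direction all eigenvalues are at most 1.0206, just enough for one step of the recursion to land
below √(3/2). The sequence √(N/2) then dominates the recursion, which is (3). -/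

/-- The `L²` norm of a function on the line. -/
noncomputable def l2norm (f : ℝ → ℂ) : ℝ := √(∫ x, ‖f x‖ ^ 2)

/-- Strongly measurable square-integrable functions on the line. -/
def SqInt (f : ℝ → ℂ) : Prop := StronglyMeasurable f ∧ MemLp f 2 volume

theorem l2norm_nonneg (f : ℝ → ℂ) : 0 ≤ l2norm f := Real.sqrt_nonneg _

theorem l2norm_sq (f : ℝ → ℂ) : l2norm f ^ 2 = ∫ x, ‖f x‖ ^ 2 :=
  Real.sq_sqrt (integral_nonneg fun _ => by positivity)

theorem SqInt.integrable_sq {f : ℝ → ℂ} (hf : SqInt f) : Integrable fun x => ‖f x‖ ^ 2 :=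
  hf.2.integrable_norm_pow (by norm_num)

theorem sqInt_schwartz (u : 𝓢(ℝ, ℂ)) : SqInt u :=
  ⟨u.continuous.stronglyMeasurable, u.memLp 2⟩

theorem SqInt.add {f g : ℝ → ℂ} (hf : SqInt f) (hg : SqInt g) : SqInt (fun x => f x + g x) :=
  ⟨hf.1.add hg.1, hf.2.add hg.2⟩

theorem SqInt.sub {f g : ℝ → ℂ} (hf : SqInt f) (hg : SqInt g) : SqInt (fun x => f x - g x) :=
  ⟨hf.1.sub hg.1, hf.2.sub hg.2⟩

theorem SqInt.indicator {f : ℝ → ℂ} (hf : SqInt f) {s : Set ℝ} (hs : MeasurableSet s) :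
    SqInt (s.indicator f) :=
  ⟨hf.1.indicator hs, hf.2.indicator hs⟩

theorem SqInt.conj {f : ℝ → ℂ} (hf : SqInt f) : SqInt (fun x => starRingEnd ℂ (f x)) :=
  ⟨Complex.continuous_conj.comp_stronglyMeasurable hf.1, hf.2.star⟩

theorem sqInt_coe (f : L2R) : SqInt f := ⟨Lp.stronglyMeasurable f, Lp.memLp f⟩

theorem l2norm_eq_eLpNorm {f : ℝ → ℂ} (hf : MemLp f 2 volume) :
    l2norm f = (eLpNorm f 2 volume).toReal := by
  rw [hf.eLpNorm_eq_integral_rpow_norm (by norm_num) (by norm_num),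
    ENNReal.toReal_ofReal (by positivity), l2norm, Real.sqrt_eq_rpow]
  simp

/-! ### Scalar products, Cauchy–Schwarz and affine changes of variable -/

theorem norm_toLp_eq_l2norm (u : 𝓢(ℝ, ℂ)) : ‖(u.toLp 2 volume : L2R)‖ = l2norm u := by
  rw [l2norm_eq_eLpNorm (u.memLp 2), SchwartzMap.norm_toLp]

theorem inner_L2R (f g : L2R) : inner ℂ g f = ∫ x, f x * starRingEnd ℂ (g x) := by
  rw [L2.inner_def]; rfl

theorem inner_toLp (u v : 𝓢(ℝ, ℂ)) :
    inner ℂ (v.toLp 2 volume : L2R) (u.toLp 2 volume) = ∫ x, u x * starRingEnd ℂ (v x) := by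
  rw [inner_L2R]
  refine integral_congr_ae ?_
  filter_upwards [u.coeFn_toLp 2 volume, v.coeFn_toLp 2 volume] with x h1 h2
  rw [h1, h2]

/-- The Cauchy–Schwarz inequality. -/
theorem integral_norm_mul_le {f g : ℝ → ℂ} (hf : SqInt f) (hg : SqInt g) :
    ∫ x, ‖f x‖ * ‖g x‖ ≤ l2norm f * l2norm g := by
  have h := integral_mul_le_Lp_mul_Lq_of_nonneg (μ := (volume : Measure ℝ)) (p := 2) (q := 2)
    Real.HolderConjugate.two_two (f := fun x => ‖f x‖) (g := fun x => ‖g x‖)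
    (Filter.Eventually.of_forall fun _ => norm_nonneg _)
    (Filter.Eventually.of_forall fun _ => norm_nonneg _)
    (by simpa using hf.2.norm) (by simpa using hg.2.norm)
  simpa [l2norm, Real.sqrt_eq_rpow] using h

theorem integrable_mul_of_sqInt {f g : ℝ → ℂ} (hf : SqInt f) (hg : SqInt g) :
    Integrable fun x => f x * g x :=
  MemLp.integrable_mul hf.2 hg.2

/-- Affine changes of variable preserve square-integrability. -/
theorem sqInt_comp_affine {f : ℝ → ℂ} (hf : SqInt f) (x : ℝ) {c : ℝ} (hc : c ≠ 0) :
    SqInt (fun z => f (x + z * c)) := by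
  refine ⟨hf.1.comp_measurable (by fun_prop), ?_⟩
  have h1 : MemLp (fun z => f (x + z)) 2 volume :=
    hf.2.comp_measurePreserving (measurePreserving_add_left volume x)
  have h2 : AEStronglyMeasurable (fun z => f (x + z * c)) volume :=
    (hf.1.comp_measurable (by fun_prop)).aestronglyMeasurable
  rw [memLp_two_iff_integrable_sq_norm h2]
  exact ((memLp_two_iff_integrable_sq_norm h1.1).1 h1).comp_mul_right' hc

theorem l2norm_comp_affine (f : ℝ → ℂ) (x : ℝ) {c : ℝ} (hc : 0 < |c|⁻¹) :
    l2norm (fun z => f (x + z * c)) = √(|c|⁻¹) * l2norm f := by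
  unfold l2norm
  rw [← Real.sqrt_mul hc.le]
  congr 1
  have := Measure.integral_comp_mul_right (fun z => ‖f (x + z)‖ ^ 2) c
  rw [this, integral_add_left_eq_self (fun z => ‖f z‖ ^ 2) x, abs_inv, smul_eq_mul]

theorem sqInt_wigner_left {f : ℝ → ℂ} (hf : SqInt f) (x : ℝ) :
    SqInt (fun z => f (x + z / 2)) := by
  simpa [div_eq_mul_inv] using sqInt_comp_affine hf x (c := 2⁻¹) (by norm_num)

theorem sqInt_wigner_right {f : ℝ → ℂ} (hf : SqInt f) (x : ℝ) :
    SqInt (fun z => f (x - z / 2)) := by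
  simpa [div_eq_mul_inv, sub_eq_add_neg] using
    sqInt_comp_affine hf x (c := -2⁻¹) (by norm_num)

theorem l2norm_wigner_left (f : ℝ → ℂ) (x : ℝ) :
    l2norm (fun z => f (x + z / 2)) = √2 * l2norm f := by
  simpa [div_eq_mul_inv] using l2norm_comp_affine f x (c := 2⁻¹) (by norm_num)

theorem l2norm_wigner_right (f : ℝ → ℂ) (x : ℝ) :
    l2norm (fun z => f (x - z / 2)) = √2 * l2norm f := by
  simpa [div_eq_mul_inv, sub_eq_add_neg] using
    l2norm_comp_affine f x (c := -2⁻¹) (by norm_num)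

/-! ### Elementary properties of the Wigner distribution -/

theorem norm_exp_neg_mul_I (r : ℝ) : ‖Complex.exp (-(r : ℂ) * I)‖ = 1 := by
  rw [← Complex.ofReal_neg, Complex.norm_exp_ofReal_mul_I]

theorem integrable_wigner_kernel {f g : ℝ → ℂ} (hf : SqInt f) (hg : SqInt g) (x : ℝ) :
    Integrable fun z => f (x + z / 2) * starRingEnd ℂ (g (x - z / 2)) :=
  integrable_mul_of_sqInt (sqInt_wigner_left hf x) (sqInt_wigner_right hg x).conj

theorem wigner_eq_fourier (f g : ℝ → ℂ) (X : ℝ × ℝ) :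
    wigner f g X = 𝓕 (fun z => f (X.1 + z / 2) * starRingEnd ℂ (g (X.1 - z / 2))) X.2 := by
  rw [Real.fourier_real_eq_integral_exp_smul, wigner]
  congr 1
  ext z
  rw [smul_eq_mul, mul_assoc]
  congr 3
  push_cast; ring

theorem norm_wigner_le_integral (f g : ℝ → ℂ) (X : ℝ × ℝ) :
    ‖wigner f g X‖ ≤ ∫ z, ‖f (X.1 + z / 2)‖ * ‖g (X.1 - z / 2)‖ := by
  unfold wigner
  refine (norm_integral_le_integral_norm _).trans (le_of_eq ?_)
  congr 1
  ext z
  simp only [norm_mul, norm_exp_neg_mul_I, RCLike.norm_conj, one_mul]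

theorem norm_wigner_le {f g : ℝ → ℂ} (hf : SqInt f) (hg : SqInt g) (X : ℝ × ℝ) :
    ‖wigner f g X‖ ≤ 2 * (l2norm f * l2norm g) := by
  refine (norm_wigner_le_integral f g X).trans ?_
  refine (integral_norm_mul_le (sqInt_wigner_left hf X.1) (sqInt_wigner_right hg X.1)).trans ?_
  rw [l2norm_wigner_left, l2norm_wigner_right]
  have : √2 * √2 = 2 := Real.mul_self_sqrt (by norm_num)
  exact le_of_eq (by linear_combination l2norm f * l2norm g * this)

theorem stronglyMeasurable_wigner_integrand {f g : ℝ → ℂ} (hf : StronglyMeasurable f)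
    (hg : StronglyMeasurable g) :
    StronglyMeasurable fun p : (ℝ × ℝ) × ℝ =>
      Complex.exp (-(2 * Real.pi * p.2 * p.1.2 : ℝ) * I) *
      f (p.1.1 + p.2 / 2) * starRingEnd ℂ (g (p.1.1 - p.2 / 2)) := by
  refine StronglyMeasurable.mul (StronglyMeasurable.mul ?_ ?_) ?_
  · exact (by fun_prop : Continuous fun p : (ℝ × ℝ) × ℝ =>
      Complex.exp (-(2 * Real.pi * p.2 * p.1.2 : ℝ) * I)).stronglyMeasurable
  · exact hf.comp_measurable (by fun_prop)
  · exact Complex.continuous_conj.comp_stronglyMeasurable (hg.comp_measurable (by fun_prop))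

theorem stronglyMeasurable_wigner {f g : ℝ → ℂ} (hf : StronglyMeasurable f)
    (hg : StronglyMeasurable g) : StronglyMeasurable (wigner f g) :=
  (stronglyMeasurable_wigner_integrand hf hg).integral_prod_right

theorem wigner_conj (f g : ℝ → ℂ) (X : ℝ × ℝ) :
    wigner g f X = starRingEnd ℂ (wigner f g X) := by
  unfold wigner
  rw [← integral_conj, ← integral_neg_eq_self]
  congr 1
  ext z
  simp only [map_mul, Complex.conj_conj, ← Complex.exp_conj, map_neg, Complex.conj_I,
    Complex.conj_ofReal]
  have e1 : X.1 + -z / 2 = X.1 - z / 2 := by ring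
  have e2 : X.1 - -z / 2 = X.1 + z / 2 := by ring
  have e3 : -((2 * Real.pi * -z * X.2 : ℝ) : ℂ) * I = -((2 * Real.pi * z * X.2 : ℝ) : ℂ) * -I := by
    push_cast; ring
  rw [e1, e2, e3, mul_right_comm]

theorem integrable_wigner_integrand {f g : ℝ → ℂ} (hf : SqInt f) (hg : SqInt g) (X : ℝ × ℝ) :
    Integrable fun z : ℝ => Complex.exp (-(2 * Real.pi * z * X.2 : ℝ) * I) *
      f (X.1 + z / 2) * starRingEnd ℂ (g (X.1 - z / 2)) := by
  have h := integrable_wigner_kernel hf hg X.1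
  refine h.mono ((stronglyMeasurable_wigner_integrand hf.1 hg.1).comp_measurable
    (measurable_prodMk_left (x := X))).aestronglyMeasurable ?_
  filter_upwards with z
  simp only [norm_mul, norm_exp_neg_mul_I, one_mul, le_refl]

theorem wigner_add_left {f f' g : ℝ → ℂ} (hf : SqInt f) (hf' : SqInt f') (hg : SqInt g)
    (X : ℝ × ℝ) : wigner (fun x => f x + f' x) g X = wigner f g X + wigner f' g X := by
  unfold wigner
  rw [← integral_add (integrable_wigner_integrand hf hg X) (integrable_wigner_integrand hf' hg X)]
  congr 1; ext z; ring

theorem wigner_add_right {f g g' : ℝ → ℂ} (hf : SqInt f) (hg : SqInt g) (hg' : SqInt g')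
    (X : ℝ × ℝ) : wigner f (fun x => g x + g' x) X = wigner f g X + wigner f g' X := by
  rw [wigner_conj, wigner_add_left hg hg' hf, map_add, ← wigner_conj, ← wigner_conj]

theorem wigner_smul_left (c : ℂ) (f g : ℝ → ℂ) (X : ℝ × ℝ) :
    wigner (fun x => c * f x) g X = c * wigner f g X := by
  unfold wigner
  rw [← integral_const_mul]
  congr 1; ext z; ring

theorem wigner_smul_right (c : ℂ) (f g : ℝ → ℂ) (X : ℝ × ℝ) :
    wigner f (fun x => c * g x) X = starRingEnd ℂ c * wigner f g X := by
  rw [wigner_conj, wigner_smul_left, map_mul, ← wigner_conj]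

/-- The change of variables `(x, z) ↦ (x + z/2, x - z/2)` preserves the area. -/
theorem measurePreserving_shear_fst {h : ℝ → ℝ} (hh : Measurable h) :
    MeasurePreserving (fun p : ℝ × ℝ => (p.1 + h p.2, p.2)) volume volume := by
  have h1 : MeasurePreserving (fun p : ℝ × ℝ => (p.1, p.2 + h p.1))
      (volume.prod volume) (volume.prod volume) :=
    (MeasurePreserving.id volume).skew_product (g := fun x y => y + h x) (by fun_prop)
      (Filter.Eventually.of_forall fun x => (measurePreserving_add_right volume (h x)).map_eq)
  exact (Measure.measurePreserving_swap.comp h1).comp Measure.measurePreserving_swap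

theorem measurePreserving_shear_snd {h : ℝ → ℝ} (hh : Measurable h) :
    MeasurePreserving (fun p : ℝ × ℝ => (p.1, p.2 + h p.1)) volume volume :=
  (MeasurePreserving.id volume).skew_product (g := fun x y => y + h x) (by fun_prop)
      (Filter.Eventually.of_forall fun x => (measurePreserving_add_right volume (h x)).map_eq)

theorem measurePreserving_neg_snd :
    MeasurePreserving (fun p : ℝ × ℝ => (p.1, -p.2)) volume volume :=
  (MeasurePreserving.id volume).prod (Measure.measurePreserving_neg volume)

/-- Two shears followed by a reflection give this map, so it preserves area without a Jacobian
computation. -/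
theorem measurePreserving_wigner :
    MeasurePreserving (fun p : ℝ × ℝ => (p.1 + p.2 / 2, p.1 - p.2 / 2)) volume volume := by
  have h1 := measurePreserving_shear_fst (h := fun z => z / 2) (by fun_prop)
  have h2 := measurePreserving_shear_snd (h := fun z => -z) (by fun_prop)
  have h := measurePreserving_neg_snd.comp (h2.comp h1)
  have e : (fun p : ℝ × ℝ => (p.1 + p.2 / 2, p.1 - p.2 / 2)) =
      (fun p : ℝ × ℝ => (p.1, -p.2)) ∘ (fun p : ℝ × ℝ => (p.1, p.2 + -p.1)) ∘
        fun p : ℝ × ℝ => (p.1 + p.2 / 2, p.2) := by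
    ext p <;> simp; ring
  rw [e]; exact h

theorem MeasureTheory.MeasurePreserving.integral_comp_sm {χ : ℝ × ℝ → ℝ × ℝ}
    (hχ : MeasurePreserving χ volume volume) {F : ℝ × ℝ → ℂ} (hF : StronglyMeasurable F) :
    ∫ X, F (χ X) = ∫ X, F X := by
  conv_rhs => rw [← hχ.map_eq, integral_map hχ.measurable.aemeasurable hF.aestronglyMeasurable]

/-! ### Decay, integrability and Fourier covariance of Wigner distributions -/

theorem SchwartzMap.exists_norm_le_inv_one_add_sq_pow (u : 𝓢(ℝ, ℂ)) (k : ℕ) :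
    ∃ C, 0 ≤ C ∧ ∀ x, (1 + x ^ 2) ^ k * ‖u x‖ ≤ C := by
  refine ⟨2 ^ (2 * k) * ((Finset.Iic (2 * k, 0)).sup
    (fun m => SchwartzMap.seminorm ℝ m.1 m.2)) u, by positivity, fun x => ?_⟩
  have h := SchwartzMap.one_add_le_sup_seminorm_apply (𝕜 := ℝ) (m := (2 * k, 0)) le_rfl le_rfl u x
  rw [norm_iteratedFDeriv_zero] at h
  refine le_trans ?_ h
  gcongr
  rw [pow_mul]
  gcongr
  rw [Real.norm_eq_abs, ← sq_abs]
  nlinarith [abs_nonneg x]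

/-- Both x = (s+t)/2 and y = s - t are controlled by (1+s²)(1+t²). Two powers of that product are
spent on x and one on y, hence the third-order decay asked of u and v. -/
theorem wigner_kernel_decay (u v : 𝓢(ℝ, ℂ)) : ∃ C, 0 ≤ C ∧ ∀ x y : ℝ,
    (1 + x ^ 2) ^ 2 * (1 + y ^ 2) * (‖u (x + y / 2)‖ * ‖v (x - y / 2)‖) ≤ C := by
  obtain ⟨C, hC, hu⟩ := u.exists_norm_le_inv_one_add_sq_pow 3
  obtain ⟨D, hD, hv⟩ := v.exists_norm_le_inv_one_add_sq_pow 3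
  refine ⟨2 * (C * D), by positivity, fun x y => ?_⟩
  set s := x + y / 2
  set t := x - y / 2
  have h1 : 1 + x ^ 2 ≤ (1 + s ^ 2) * (1 + t ^ 2) := by
    have : x = (s + t) / 2 := by simp only [s, t]; ring
    rw [this]; nlinarith [sq_nonneg (s - t), mul_nonneg (sq_nonneg s) (sq_nonneg t)]
  have h2 : 1 + y ^ 2 ≤ 2 * ((1 + s ^ 2) * (1 + t ^ 2)) := by
    have : y = s - t := by simp only [s, t]; ring
    rw [this]; nlinarith [sq_nonneg (s + t), mul_nonneg (sq_nonneg s) (sq_nonneg t)]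
  have h3 : (1 + x ^ 2) ^ 2 * (1 + y ^ 2) ≤
      ((1 + s ^ 2) * (1 + t ^ 2)) ^ 2 * (2 * ((1 + s ^ 2) * (1 + t ^ 2))) := by gcongr
  calc _ ≤ ((1 + s ^ 2) * (1 + t ^ 2)) ^ 2 * (2 * ((1 + s ^ 2) * (1 + t ^ 2))) *
        (‖u s‖ * ‖v t‖) := by gcongr
    _ = 2 * (((1 + s ^ 2) ^ 3 * ‖u s‖) * ((1 + t ^ 2) ^ 3 * ‖v t‖)) := by ring
    _ ≤ _ := by gcongr; exacts [hu s, hv t]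

theorem wigner_kernel_le (u v : 𝓢(ℝ, ℂ)) : ∃ C, 0 ≤ C ∧ ∀ x y : ℝ,
    ‖u (x + y / 2)‖ * ‖v (x - y / 2)‖ ≤ C * ((1 + x ^ 2) ^ 2)⁻¹ * (1 + y ^ 2)⁻¹ := by
  obtain ⟨C, hC, h⟩ := wigner_kernel_decay u v
  refine ⟨C, hC, fun x y => ?_⟩
  rw [mul_assoc, ← mul_inv, ← div_eq_mul_inv, le_div_iff₀ (by positivity), mul_comm]
  exact h x y

theorem wigner_decay_fst (u v : 𝓢(ℝ, ℂ)) : ∃ C, 0 ≤ C ∧ ∀ X : ℝ × ℝ,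
    ‖wigner u v X‖ ≤ C * ((1 + X.1 ^ 2) ^ 2)⁻¹ := by
  obtain ⟨C, hC, h⟩ := wigner_kernel_le u v
  refine ⟨C * Real.pi, by positivity, fun X => (norm_wigner_le_integral _ _ X).trans ?_⟩
  calc _ ≤ ∫ y : ℝ, C * ((1 + X.1 ^ 2) ^ 2)⁻¹ * (1 + y ^ 2)⁻¹ := by
        refine integral_mono_of_nonneg (Filter.Eventually.of_forall fun _ => by positivity)
          (integrable_inv_one_add_sq.const_mul _) (Filter.Eventually.of_forall fun y => h X.1 y)
    _ = _ := by rw [integral_const_mul, integral_univ_inv_one_add_sq]; ring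

theorem continuous_wigner (u v : 𝓢(ℝ, ℂ)) : Continuous (wigner u v) := by
  obtain ⟨C, hC, h⟩ := wigner_kernel_le u v
  unfold wigner
  refine continuous_of_dominated (bound := fun y => C * (1 + y ^ 2)⁻¹) ?_ ?_ ?_ ?_
  · intro X
    exact (integrable_wigner_integrand (sqInt_schwartz u) (sqInt_schwartz v) X).aestronglyMeasurable
  · intro X
    filter_upwards with y
    simp only [norm_mul, norm_exp_neg_mul_I, one_mul, RCLike.norm_conj]
    refine (h X.1 y).trans ?_
    have : ((1 + X.1 ^ 2) ^ 2)⁻¹ ≤ 1 :=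
      inv_le_one_of_one_le₀ (one_le_pow₀ (by nlinarith [sq_nonneg X.1]))
    have h3 : C * ((1 + X.1 ^ 2) ^ 2)⁻¹ ≤ C := mul_le_of_le_one_right hC this
    gcongr
  · exact integrable_inv_one_add_sq.const_mul _
  · filter_upwards with y
    have h1 := u.continuous
    have h2 := v.continuous
    fun_prop

theorem integrable_tensor {f g : ℝ → ℂ} (hf : Integrable f) (hg : Integrable g) :
    Integrable (fun p : ℝ × ℝ => f p.1 * starRingEnd ℂ (g p.2)) :=
  hf.mul_prod (Complex.conjCLE.toContinuousLinearMap.integrable_comp hg)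

theorem integrable_wigner_kernel_prod {f g : ℝ → ℂ} (hf : Integrable f) (hg : Integrable g) :
    Integrable (fun p : ℝ × ℝ => f (p.1 + p.2 / 2) * starRingEnd ℂ (g (p.1 - p.2 / 2))) :=
  measurePreserving_wigner.integrable_comp_of_integrable (integrable_tensor hf hg)

theorem integrable_wigner_fst (u v : 𝓢(ℝ, ℂ)) (x : ℝ) :
    Integrable fun p => wigner u v (p, x) := by
  have h := integrable_wigner_kernel_prod u.integrable v.integrable
  have h2 : Integrable (fun p : ℝ × ℝ => Complex.exp (-(2 * Real.pi * p.2 * x : ℝ) * I) *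
      u (p.1 + p.2 / 2) * starRingEnd ℂ (v (p.1 - p.2 / 2))) := by
    refine h.mono (Continuous.aestronglyMeasurable ?_) ?_
    · have h1 := u.continuous
      have h2 := v.continuous
      fun_prop
    · filter_upwards with p
      simp only [norm_mul, norm_exp_neg_mul_I, one_mul, le_refl]
  exact h2.integral_prod_left

/-- With s = p + y/2 and t = p - y/2 the total phase zp + yx equals s(x + z/2) - t(x - z/2), so the
double integral factors into two Fourier transforms. -/
theorem fourier_wigner_fst (u v : 𝓢(ℝ, ℂ)) (x z : ℝ) :
    𝓕 (fun p => wigner u v (p, x)) z =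
      𝓕 (u : ℝ → ℂ) (x + z / 2) * starRingEnd ℂ (𝓕 (v : ℝ → ℂ) (x - z / 2)) := by
  have cu := u.continuous
  have cv := v.continuous
  set H : ℝ × ℝ → ℂ := fun q =>
    (Complex.exp (-(2 * Real.pi * q.1 * (x + z / 2) : ℝ) * I) * u q.1) *
      starRingEnd ℂ (Complex.exp (-(2 * Real.pi * q.2 * (x - z / 2) : ℝ) * I) * v q.2) with hH
  have hHm : StronglyMeasurable H := by
    refine Continuous.stronglyMeasurable ?_
    simp only [hH]; fun_prop
  have hHint : Integrable H := by
    refine (integrable_tensor u.integrable v.integrable).mono hHm.aestronglyMeasurable ?_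
    filter_upwards with q
    simp only [hH, norm_mul, norm_exp_neg_mul_I, one_mul, RCLike.norm_conj, le_refl]
  have hHχ := measurePreserving_wigner.integrable_comp_of_integrable hHint
  have e : ∀ f : ℝ → ℂ, ∀ w : ℝ, 𝓕 f w = ∫ s, Complex.exp (-(2 * Real.pi * s * w : ℝ) * I) * f s := by
    intro f w
    rw [Real.fourier_real_eq_integral_exp_smul]
    congr 1; ext s
    rw [smul_eq_mul]; congr 3; push_cast; ring
  have hL : 𝓕 (fun p => wigner u v (p, x)) z =
      ∫ p : ℝ, ∫ y : ℝ, (H ∘ fun p : ℝ × ℝ => (p.1 + p.2 / 2, p.1 - p.2 / 2)) (p, y) := by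
    rw [e]
    congr 1; ext p
    unfold wigner
    rw [← integral_const_mul]
    congr 1; ext y
    simp only [hH, Function.comp_apply, map_mul, ← Complex.exp_conj, map_neg, Complex.conj_I,
      Complex.conj_ofReal]
    have : ∀ a b c d A B : ℂ, Complex.exp (a) * (Complex.exp b * A * B) =
      Complex.exp (a + b) * A * B := by intros; rw [Complex.exp_add]; ring
    rw [this _ _ 0 0]
    have : ∀ a b A B : ℂ, Complex.exp a * A * (Complex.exp b * B) =
      Complex.exp (a + b) * A * B := by intros; rw [Complex.exp_add]; ring
    rw [this]
    congr 3
    push_cast; ring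
  rw [hL, ← integral_prod _ hHχ]
  have := measurePreserving_wigner.integral_comp_sm hHm
  rw [show (volume : Measure ℝ).prod (volume : Measure ℝ) = volume from rfl]
  simp only [Function.comp_apply]
  rw [this, e u, e v, ← integral_conj]
  exact integral_prod_mul (μ := volume) (ν := volume)
    (fun s => Complex.exp (-(2 * Real.pi * s * (x + z / 2) : ℝ) * I) * u s)
    (fun s => starRingEnd ℂ (Complex.exp (-(2 * Real.pi * s * (x - z / 2) : ℝ) * I) * v s))

/-- The Wigner distribution of the Fourier transforms is the rotated Wigner distribution. -/
theorem wigner_fourier (u v : 𝓢(ℝ, ℂ)) (X : ℝ × ℝ) :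
    wigner (𝓕 u : 𝓢(ℝ, ℂ)) (𝓕 v : 𝓢(ℝ, ℂ)) X = wigner u v (-X.2, X.1) := by
  rw [wigner_eq_fourier]
  have h1 : (fun z => (𝓕 u : 𝓢(ℝ, ℂ)) (X.1 + z / 2) *
      starRingEnd ℂ ((𝓕 v : 𝓢(ℝ, ℂ)) (X.1 - z / 2))) = 𝓕 (fun p => wigner u v (p, X.1)) := by
    ext z; rw [fourier_wigner_fst]; rfl
  have hc : Continuous fun p => wigner u v (p, X.1) :=
    (continuous_wigner u v).comp (by fun_prop)
  have hi := integrable_wigner_kernel (sqInt_schwartz (𝓕 u)) (sqInt_schwartz (𝓕 v)) X.1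
  rw [h1] at hi ⊢
  have h := congrFun (hc.fourierInv_fourier_eq (integrable_wigner_fst u v X.1) hi) (-X.2)
  rwa [Real.fourierInv_eq_fourier_neg, neg_neg] at h

theorem wigner_eq_wigner_fourier (u v : 𝓢(ℝ, ℂ)) (X : ℝ × ℝ) :
    wigner u v X = wigner (𝓕 u : 𝓢(ℝ, ℂ)) (𝓕 v : 𝓢(ℝ, ℂ)) (X.2, -X.1) := by
  rw [wigner_fourier, neg_neg]

/-- The Wigner distribution of two Schwartz functions is integrable on the phase plane. -/
theorem integrable_wigner (u v : 𝓢(ℝ, ℂ)) : Integrable (wigner u v) := by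
  obtain ⟨C, hC, h1⟩ := wigner_decay_fst u v
  obtain ⟨D, hD, h2⟩ := wigner_decay_fst (𝓕 u) (𝓕 v)
  have h3 : Integrable (fun X : ℝ × ℝ => (1 + X.1 ^ 2)⁻¹ * (1 + X.2 ^ 2)⁻¹) :=
    integrable_inv_one_add_sq.mul_prod integrable_inv_one_add_sq
  refine (h3.const_mul √(C * D)).mono' (continuous_wigner u v).aestronglyMeasurable ?_
  filter_upwards with X
  have e2 := h2 (X.2, -X.1)
  rw [← wigner_eq_wigner_fourier] at e2
  -- The kernel gives decay in x only, the Fourier side decay in ξ only; their geometric mean decays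
  -- in both.
  refine abs_le_of_sq_le_sq' ?_ (by positivity) |>.2
  rw [mul_pow, Real.sq_sqrt (by positivity), mul_pow, sq ‖_‖]
  calc _ ≤ (C * ((1 + X.1 ^ 2) ^ 2)⁻¹) * (D * ((1 + X.2 ^ 2) ^ 2)⁻¹) := by
        exact mul_le_mul (h1 X) e2 (norm_nonneg _) (by positivity)
    _ = _ := by simp only [inv_pow]; ring_nf

theorem integrable_wigner_snd (u v : 𝓢(ℝ, ℂ)) (x : ℝ) : Integrable fun ξ => wigner u v (x, ξ) := by
  have h := integrable_wigner_fst (𝓕 u) (𝓕 v) (-x)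
  refine h.congr (Filter.Eventually.of_forall fun ξ => ?_)
  simp only [wigner_eq_wigner_fourier u v (x, ξ)]

/-- Fourier inversion in z, evaluated at z = 0. -/
theorem integral_wigner_snd (u v : 𝓢(ℝ, ℂ)) (x : ℝ) :
    ∫ ξ, wigner u v (x, ξ) = u x * starRingEnd ℂ (v x) := by
  have h1 : (fun ξ => wigner u v (x, ξ)) =
      𝓕 (fun z => u (x + z / 2) * starRingEnd ℂ (v (x - z / 2))) := by
    ext ξ; exact wigner_eq_fourier _ _ (x, ξ)
  have cu := u.continuous
  have cv := v.continuous
  have hc : Continuous (fun z => u (x + z / 2) * starRingEnd ℂ (v (x - z / 2))) := by fun_prop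
  have hi := integrable_wigner_snd u v x
  rw [h1] at hi ⊢
  have h := congrFun (hc.fourierInv_fourier_eq
    (integrable_wigner_kernel (sqInt_schwartz u) (sqInt_schwartz v) x) hi) 0
  rw [Real.fourierInv_eq] at h
  simpa using h

/-! ### Weyl forms and their symplectic covariance -/

/-- The sesquilinear form of the Weyl quantization of the symbol `a`. -/
noncomputable def weylForm (a : ℝ × ℝ → ℂ) (f g : ℝ → ℂ) : ℂ := ∫ X, a X * wigner f g X

/-- Measurable symbols bounded by one. -/
def UnitSymbol (a : ℝ × ℝ → ℂ) : Prop := StronglyMeasurable a ∧ ∀ X, ‖a X‖ ≤ 1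

/-- The Weyl form of `a` is bounded by `M` on Schwartz functions, for the `L²` norm. -/
def FormBound (a : ℝ × ℝ → ℂ) (M : ℝ) : Prop :=
  ∀ u v : 𝓢(ℝ, ℂ), ‖weylForm a u v‖ ≤ M * (l2norm u * l2norm v)

theorem unitSymbol_indicator {P : Set (ℝ × ℝ)} (hP : MeasurableSet P) :
    UnitSymbol (indicatorSymbol P) := by
  refine ⟨stronglyMeasurable_const.indicator hP, fun X => ?_⟩
  unfold indicatorSymbol
  by_cases h : X ∈ P <;> simp [h]

theorem UnitSymbol.integrable_mul {a : ℝ × ℝ → ℂ} (ha : UnitSymbol a) {W : ℝ × ℝ → ℂ}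
    (hW : Integrable W) : Integrable fun X => a X * W X :=
  hW.bdd_mul ha.1.aestronglyMeasurable (Filter.Eventually.of_forall ha.2)

theorem UnitSymbol.comp {a : ℝ × ℝ → ℂ} (ha : UnitSymbol a) {χ : ℝ × ℝ → ℝ × ℝ}
    (hχ : Measurable χ) : UnitSymbol (a ∘ χ) :=
  ⟨ha.1.comp_measurable hχ, fun X => ha.2 (χ X)⟩

theorem FormBound.mono {a : ℝ × ℝ → ℂ} {M M' : ℝ} (h : FormBound a M) (hM : M ≤ M') :
    FormBound a M' := fun u v => (h u v).trans (by
  have := l2norm_nonneg u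
  have := l2norm_nonneg v
  gcongr)

/-- A transformation of the phase plane implemented by an isometric map of the Schwartz space. -/
def Implemented (χ : ℝ × ℝ → ℝ × ℝ) : Prop :=
  MeasurePreserving χ volume volume ∧ ∃ U : 𝓢(ℝ, ℂ) → 𝓢(ℝ, ℂ), (∀ u, l2norm (U u) = l2norm u) ∧
    ∀ u v X, wigner (U u) (U v) (χ X) = wigner u v X

theorem Implemented.comp {χ ψ : ℝ × ℝ → ℝ × ℝ} (hχ : Implemented χ) (hψ : Implemented ψ) :
    Implemented (χ ∘ ψ) := by
  obtain ⟨h1, U, hU, hW⟩ := hχ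
  obtain ⟨h2, V, hV, hW'⟩ := hψ
  refine ⟨h1.comp h2, U ∘ V, fun u => ?_, fun u v X => ?_⟩
  · simp [hU, hV]
  · simp [hW, hW']

theorem weylForm_comp {a : ℝ × ℝ → ℂ} (ha : UnitSymbol a) {χ : ℝ × ℝ → ℝ × ℝ}
    {u v u' v' : 𝓢(ℝ, ℂ)} (hχ : MeasurePreserving χ volume volume)
    (h : ∀ X, wigner u' v' (χ X) = wigner u v X) :
    weylForm (a ∘ χ) u v = weylForm a u' v' := by
  unfold weylForm
  rw [← hχ.integral_comp_sm (F := fun X => a X * wigner u' v' X)]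
  · simp only [h, Function.comp_apply]
  · exact ha.1.mul (continuous_wigner u' v').stronglyMeasurable

theorem FormBound.comp {a : ℝ × ℝ → ℂ} (ha : UnitSymbol a) {M : ℝ} (h : FormBound a M)
    {χ : ℝ × ℝ → ℝ × ℝ} (hχ : Implemented χ) : FormBound (a ∘ χ) M := by
  obtain ⟨h1, U, hU, hW⟩ := hχ
  intro u v
  rw [weylForm_comp ha h1 (hW u v), ← hU u, ← hU v]
  exact h _ _

theorem l2norm_fourier (u : 𝓢(ℝ, ℂ)) : l2norm (𝓕 u : 𝓢(ℝ, ℂ)) = l2norm u := by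
  rw [← norm_toLp_eq_l2norm, ← norm_toLp_eq_l2norm, SchwartzMap.norm_fourier_toL2_eq]

theorem implemented_rotation_inv : Implemented (fun X => (X.2, -X.1)) := by
  refine ⟨measurePreserving_neg_snd.comp Measure.measurePreserving_swap,
    fun u => 𝓕 u, l2norm_fourier, fun u v X => ?_⟩
  rw [wigner_fourier]; simp

theorem implemented_neg : Implemented (fun X => (-X.1, -X.2)) :=
  implemented_rotation_inv.comp implemented_rotation_inv

/-- The quarter turn is the cube of its inverse, so the inverse Fourier transform is not needed. -/
theorem implemented_rotation : Implemented (fun X => (-X.2, X.1)) := by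
  have h := implemented_rotation_inv.comp implemented_neg
  convert h using 2 with X
  simp

theorem implemented_translation (h : ℝ) : Implemented (fun X => (X.1 + h, X.2)) := by
  refine ⟨measurePreserving_shear_fst (h := fun _ => h) measurable_const,
    fun u => u.compSubConstCLM ℂ h, fun u => ?_, fun u v X => ?_⟩
  · unfold l2norm
    congr 1
    exact integral_sub_right_eq_self (fun x => ‖u x‖ ^ 2) h
  · unfold wigner
    congr 1; ext z
    have e1 : X.1 + h + z / 2 - h = X.1 + z / 2 := by ring
    have e2 : X.1 + h - z / 2 - h = X.1 - z / 2 := by ring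
    simp only [SchwartzMap.compSubConstCLM_apply, e1, e2]

theorem iteratedDeriv_cexp_mul (α : ℂ) (n : ℕ) (y : ℝ) :
    iteratedDeriv n (fun y : ℝ => Complex.exp (α * y)) y = α ^ n * Complex.exp (α * y) := by
  induction n generalizing y with
  | zero => simp
  | succ n ih =>
    rw [iteratedDeriv_succ, show iteratedDeriv n (fun y : ℝ => Complex.exp (α * y)) =
      fun y : ℝ => α ^ n * Complex.exp (α * y) from funext ih]
    have h : HasDerivAt (fun y : ℝ => Complex.exp (α * y)) (Complex.exp (α * y) * (α * 1)) y :=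
      ((Complex.ofRealCLM.hasDerivAt (x := y)).const_mul α).cexp
    rw [(h.const_mul _).deriv]; ring

/-- Every derivative of y ↦ exp(αy) is a power of α times the exponential, hence bounded where
Re(αy) ≤ 1. The open set t lets the range of f be a closed half line, which is needed for Gaussians.
-/
theorem hasTemperateGrowth_cexp {f : ℝ → ℝ} (hf : f.HasTemperateGrowth) {α : ℂ} {t : Set ℝ}
    (ht : IsOpen t) (hft : ∀ x, f x ∈ t) (hα : ∀ y ∈ t, (α * y).re ≤ 1) :
    (fun x => Complex.exp (α * f x)).HasTemperateGrowth := by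
  have hc : ContDiff ℝ ∞ (fun y : ℝ => Complex.exp (α * y)) :=
    (contDiff_const.mul Complex.ofRealCLM.contDiff).cexp
  refine Function.HasTemperateGrowth.comp' (g := fun y : ℝ => Complex.exp (α * y)) (f := f)
    (t := t) (by rintro _ ⟨x, rfl⟩; exact hft x) ht.uniqueDiffOn hc.contDiffOn (fun N => ?_) hf
  refine ⟨0, (1 + ‖α‖) ^ N * Real.exp 1, by positivity, fun n hn y hy => ?_⟩
  rw [iteratedFDerivWithin_of_isOpen n ht hy, norm_iteratedFDeriv_eq_norm_iteratedDeriv,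
    iteratedDeriv_cexp_mul, norm_mul, norm_pow, pow_zero, mul_one, Complex.norm_exp]
  have h1 : ‖α‖ ^ n ≤ (1 + ‖α‖) ^ N :=
    (pow_le_pow_left₀ (norm_nonneg _) (by linarith) n).trans
      (pow_le_pow_right₀ (by linarith [norm_nonneg α]) hn)
  gcongr
  exact hα y hy

/-- The quadratic phase `e^{iπ(px² + 2qx)}`. -/
noncomputable def chirp (p q x : ℝ) : ℂ := Complex.exp (I * ((Real.pi * (p * x ^ 2 + 2 * q * x) : ℝ) : ℂ))

theorem hasTemperateGrowth_chirp (p q : ℝ) : (chirp p q).HasTemperateGrowth :=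
  hasTemperateGrowth_cexp (f := fun x => Real.pi * (p * x ^ 2 + 2 * q * x)) (by fun_prop) isOpen_univ
    (fun _ => Set.mem_univ _) (fun y _ => by simp)

theorem norm_chirp (p q x : ℝ) : ‖chirp p q x‖ = 1 := by
  rw [chirp, mul_comm, Complex.norm_exp_ofReal_mul_I]

/-- Since (x + z/2)² - (x - z/2)² = 2xz, multiplying by the chirp contributes the phase
e^{2πiz(px+q)} to the Wigner integrand, that is, a shift of ξ by px + q. -/
theorem implemented_shear (p q : ℝ) : Implemented (fun X => (X.1, X.2 + (p * X.1 + q))) := by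
  refine ⟨measurePreserving_shear_snd (h := fun x => p * x + q) (by fun_prop),
    fun u => SchwartzMap.smulLeftCLM ℂ (chirp p q) u, fun u => ?_, fun u v X => ?_⟩
  · unfold l2norm
    simp only [SchwartzMap.smulLeftCLM_apply_apply (hasTemperateGrowth_chirp p q), norm_smul,
      norm_chirp, one_mul]
  · unfold wigner
    congr 1; ext z
    simp only [SchwartzMap.smulLeftCLM_apply_apply (hasTemperateGrowth_chirp p q), smul_eq_mul,
      map_mul, chirp, ← Complex.exp_conj, Complex.conj_I, Complex.conj_ofReal]
    have : ∀ a b c A B : ℂ, Complex.exp a * (Complex.exp b * A) * (Complex.exp c * B) =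
      Complex.exp (a + b + c) * A * B := by intros; rw [Complex.exp_add, Complex.exp_add]; ring
    rw [this]
    congr 3
    push_cast; ring

/-! ### From bounded forms to bounded operators -/

theorem denseRange_toLp : DenseRange (SchwartzMap.toLpCLM ℂ ℂ 2 (volume : Measure ℝ)) := by
  have := SchwartzMap.denseRange_toLpCLM (F := ℂ) (p := 2) (μ := (volume : Measure ℝ)) (by norm_num)
  exact this

theorem weylForm_add_left {a : ℝ × ℝ → ℂ} (ha : UnitSymbol a) (u u' v : 𝓢(ℝ, ℂ)) :
    weylForm a (u + u' : 𝓢(ℝ, ℂ)) v = weylForm a u v + weylForm a u' v := by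
  unfold weylForm
  rw [← integral_add (ha.integrable_mul (integrable_wigner u v))
    (ha.integrable_mul (integrable_wigner u' v))]
  congr 1; ext X
  rw [← mul_add, ← wigner_add_left (sqInt_schwartz u) (sqInt_schwartz u') (sqInt_schwartz v)]
  rfl

theorem weylForm_add_right {a : ℝ × ℝ → ℂ} (ha : UnitSymbol a) (u v v' : 𝓢(ℝ, ℂ)) :
    weylForm a u (v + v' : 𝓢(ℝ, ℂ)) = weylForm a u v + weylForm a u v' := by
  unfold weylForm
  rw [← integral_add (ha.integrable_mul (integrable_wigner u v))
    (ha.integrable_mul (integrable_wigner u v'))]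
  congr 1; ext X
  rw [← mul_add, ← wigner_add_right (sqInt_schwartz u) (sqInt_schwartz v) (sqInt_schwartz v')]
  rfl

theorem weylForm_smul_left (a : ℝ × ℝ → ℂ) (c : ℂ) (u v : 𝓢(ℝ, ℂ)) :
    weylForm a (c • u : 𝓢(ℝ, ℂ)) v = c * weylForm a u v := by
  unfold weylForm
  rw [← integral_const_mul]
  congr 1; ext X
  rw [show wigner (c • u : 𝓢(ℝ, ℂ)) v X = c * wigner u v X from wigner_smul_left c u v X]
  ring

theorem weylForm_smul_right (a : ℝ × ℝ → ℂ) (c : ℂ) (u v : 𝓢(ℝ, ℂ)) :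
    weylForm a u (c • v : 𝓢(ℝ, ℂ)) = starRingEnd ℂ c * weylForm a u v := by
  unfold weylForm
  rw [← integral_const_mul]
  congr 1; ext X
  rw [show wigner u (c • v : 𝓢(ℝ, ℂ)) X = starRingEnd ℂ c * wigner u v X from
    wigner_smul_right c u v X]
  ring

/-- A bounded form determines a bounded operator. -/
theorem FormBound.exists_operator {a : ℝ × ℝ → ℂ} (ha : UnitSymbol a) {M : ℝ} (hM : 0 ≤ M)
    (h : FormBound a M) : ∃ A : L2R →L[ℂ] L2R, IsWeylQuantization a A := by
  set e := (SchwartzMap.toLpCLM ℂ ℂ 2 (volume : Measure ℝ)).toLinearMap with he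
  have hd : DenseRange e := denseRange_toLp
  -- Conjugation makes the form linear in v and antilinear in u, the shape to which the Riesz
  -- representation applies. It is extended by continuity first in v, then in u.
  let B : 𝓢(ℝ, ℂ) → 𝓢(ℝ, ℂ) →ₗ[ℂ] ℂ := fun u =>
    { toFun := fun v => starRingEnd ℂ (weylForm a u v)
      map_add' := fun v v' => by rw [weylForm_add_right ha u v v', map_add]
      map_smul' := fun c v => by
        rw [weylForm_smul_right a c u v, map_mul, Complex.conj_conj]; rfl }
  have hB : ∀ u v, ‖B u v‖ ≤ (M * l2norm u) * ‖e v‖ := fun u v => by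
    have h1 := h u v
    have h2 : ‖e v‖ = l2norm v := norm_toLp_eq_l2norm v
    rw [h2, mul_assoc]
    exact (RCLike.norm_conj _).trans_le h1
  let T : 𝓢(ℝ, ℂ) →ₗ⋆[ℂ] (L2R →L[ℂ] ℂ) :=
    { toFun := fun u => (B u).extendOfNorm e
      map_add' := fun u u' => by
        refine LinearMap.extendOfNorm_unique hd (M * l2norm (u + u' : 𝓢(ℝ, ℂ))) (hB _) _ ?_
        ext v
        have h1 := LinearMap.extendOfNorm_eq hd ⟨_, hB u⟩ v
        have h2 := LinearMap.extendOfNorm_eq hd ⟨_, hB u'⟩ v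
        have : ((B u).extendOfNorm e + (B u').extendOfNorm e) (e v) = B (u + u') v := by
          rw [add_apply, h1, h2]
          change _ = starRingEnd ℂ (weylForm a (u + u' : 𝓢(ℝ, ℂ)) v)
          rw [weylForm_add_left ha u u' v, map_add]
          rfl
        exact this
      map_smul' := fun c u => by
        refine LinearMap.extendOfNorm_unique hd (M * l2norm (c • u : 𝓢(ℝ, ℂ))) (hB _) _ ?_
        ext v
        have h1 := LinearMap.extendOfNorm_eq hd ⟨_, hB u⟩ v
        have : (starRingEnd ℂ c • (B u).extendOfNorm e) (e v) = B (c • u) v := by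
          rw [smul_apply, h1]
          change _ = starRingEnd ℂ (weylForm a (c • u : 𝓢(ℝ, ℂ)) v)
          rw [weylForm_smul_left a c u v, map_mul]
          rfl
        exact this }
  have hT : ∀ u, ‖T u‖ ≤ M * ‖e u‖ := fun u => by
    have h2 : ‖e u‖ = l2norm u := norm_toLp_eq_l2norm u
    rw [h2]
    exact LinearMap.opNorm_extendOfNorm_le hd (mul_nonneg hM (l2norm_nonneg _)) (hB u)
  refine ⟨InnerProductSpace.continuousLinearMapOfBilin (T.extendOfNorm e), fun u v => ?_⟩
  have h1 := InnerProductSpace.continuousLinearMapOfBilin_apply (T.extendOfNorm e) (e u) (e v)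
  rw [LinearMap.extendOfNorm_eq hd ⟨_, hT⟩ u] at h1
  have h2 : T u (e v) = starRingEnd ℂ (weylForm a u v) :=
    LinearMap.extendOfNorm_eq hd ⟨_, hB u⟩ v
  rw [h2] at h1
  rw [← inner_conj_symm]
  exact (congrArg (starRingEnd ℂ) h1).trans (Complex.conj_conj _)

theorem IsWeylQuantization.norm_le {a : ℝ × ℝ → ℂ} {A : L2R →L[ℂ] L2R}
    (hA : IsWeylQuantization a A) {M : ℝ} (hM : 0 ≤ M) (h : FormBound a M) : ‖A‖ ≤ M := by
  have key : ∀ f g : L2R, ‖inner ℂ g (A f)‖ ≤ M * (‖f‖ * ‖g‖) := by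
    intro f g
    refine denseRange_toLp.induction_on₂
      (p := fun f g : L2R => ‖inner ℂ g (A f)‖ ≤ M * (‖f‖ * ‖g‖)) ?_ ?_ f g
    · exact isClosed_le (by fun_prop) (by fun_prop)
    · intro u v
      simp only [SchwartzMap.toLpCLM_apply]
      rw [hA u v, norm_toLp_eq_l2norm, norm_toLp_eq_l2norm]
      exact h u v
  refine A.opNorm_le_bound hM fun f => ?_
  -- Testing against g = A f and dividing by ‖A f‖ turns the form bound into an operator bound.
  have h1 := key f (A f)
  rw [inner_self_eq_norm_sq_to_K, norm_pow, RCLike.norm_ofReal, abs_norm, sq, ← mul_assoc] at h1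
  rcases (norm_nonneg (A f)).eq_or_lt with h0 | h0
  · rw [← h0]; positivity
  · exact le_of_mul_le_mul_right h1 h0

theorem IsWeylQuantization.formBound {a : ℝ × ℝ → ℂ} {A : L2R →L[ℂ] L2R}
    (hA : IsWeylQuantization a A) : FormBound a ‖A‖ := by
  intro u v
  have h1 := hA u v
  have h2 : weylForm a u v = inner ℂ (v.toLp 2 volume : L2R) (A (u.toLp 2 volume)) := h1.symm
  rw [h2, ← norm_toLp_eq_l2norm, ← norm_toLp_eq_l2norm]
  calc _ ≤ ‖(v.toLp 2 volume : L2R)‖ * ‖A (u.toLp 2 volume)‖ := norm_inner_le_norm _ _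
    _ ≤ ‖(v.toLp 2 volume : L2R)‖ * (‖A‖ * ‖(u.toLp 2 volume : L2R)‖) := by
        gcongr; exact A.le_opNorm _
    _ = _ := by ring

theorem IsWeylQuantization.unique {a : ℝ × ℝ → ℂ} {A B : L2R →L[ℂ] L2R}
    (hA : IsWeylQuantization a A) (hB : IsWeylQuantization a B) : A = B := by
  have key : ∀ f g : L2R, inner ℂ g (A f) = inner ℂ g (B f) := by
    intro f g
    refine denseRange_toLp.induction_on₂
      (p := fun f g : L2R => inner ℂ g (A f) = inner ℂ g (B f)) ?_ ?_ f g
    · exact isClosed_eq (by fun_prop) (by fun_prop)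
    · intro u v
      exact (hA u v).trans (hB u v).symm
  ext1 f
  exact ext_inner_left ℂ fun g => key f g

theorem weylForm_conj (a : ℝ × ℝ → ℂ) (f g : ℝ → ℂ) :
    weylForm a g f = starRingEnd ℂ (weylForm (fun X => starRingEnd ℂ (a X)) f g) := by
  unfold weylForm
  rw [← integral_conj]
  congr 1; ext X
  rw [map_mul, Complex.conj_conj, ← wigner_conj]

theorem indicatorSymbol_conj (P : Set (ℝ × ℝ)) (X : ℝ × ℝ) :
    starRingEnd ℂ (indicatorSymbol P X) = indicatorSymbol P X := by
  unfold indicatorSymbol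
  by_cases h : X ∈ P <;> simp [h]

/-- The symbol is real and the Wigner distribution is Hermitian in its two arguments. -/
theorem IsWeylQuantization.isSelfAdjoint {P : Set (ℝ × ℝ)} {A : L2R →L[ℂ] L2R}
    (hA : IsWeylQuantization (indicatorSymbol P) A) : IsSelfAdjoint A := by
  rw [ContinuousLinearMap.isSelfAdjoint_iff_isSymmetric]
  intro f g
  refine denseRange_toLp.induction_on₂
      (p := fun f g : L2R => inner ℂ (A f) g = inner ℂ f (A g)) ?_ ?_ f g
  · exact isClosed_eq (by fun_prop) (by fun_prop)
  · intro u v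
    have h1 := hA u v
    have h2 := hA v u
    have h3 := weylForm_conj (indicatorSymbol P) u v
    simp only [indicatorSymbol_conj] at h3
    simp only [SchwartzMap.toLpCLM_apply]
    rw [← inner_conj_symm, h1, h2]
    exact h3.symm

/-! ### Gaussian regularisation of symbols -/

open ProbabilityTheory Filter Topology

/-- The standard Gaussian measure on the line. -/
noncomputable abbrev gaussProb : Measure ℝ := gaussianReal 0 1

/-- The Gaussian `e^{-4π²t²x²}`. -/
noncomputable def gaussWeight (t x : ℝ) : ℂ := Complex.exp (((-(4 * Real.pi ^ 2 * t ^ 2) : ℝ) : ℂ) * ((x ^ 2 : ℝ) : ℂ))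

theorem hasTemperateGrowth_gaussWeight (t : ℝ) : (gaussWeight t).HasTemperateGrowth := by
  have h : 0 < (4 * Real.pi ^ 2 * t ^ 2 + 1)⁻¹ := by positivity
  -- The range [0, ∞) of x² is not open; the half line is enlarged to the left by so little that the
  -- exponent stays at most 1.
  refine hasTemperateGrowth_cexp (f := fun x => x ^ 2) (by fun_prop)
    (isOpen_Ioi (a := -(4 * Real.pi ^ 2 * t ^ 2 + 1)⁻¹)) (fun x => ?_) (fun y hy => ?_)
  · exact lt_of_lt_of_le (by linarith) (sq_nonneg x)
  · rw [← Complex.ofReal_mul, Complex.ofReal_re]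
    have h1 : -y < (4 * Real.pi ^ 2 * t ^ 2 + 1)⁻¹ := by
      have := Set.mem_Ioi.1 hy; linarith
    have h2 : 4 * Real.pi ^ 2 * t ^ 2 * (4 * Real.pi ^ 2 * t ^ 2 + 1)⁻¹ ≤ 1 := by
      rw [← div_eq_mul_inv, div_le_one (by positivity)]; linarith
    have h3 : 0 ≤ 4 * Real.pi ^ 2 * t ^ 2 := by positivity
    nlinarith [mul_le_mul_of_nonneg_left h1.le h3]

theorem gaussWeight_eq (t x : ℝ) :
    gaussWeight t x = (Real.exp (-(4 * Real.pi ^ 2 * t ^ 2) * x ^ 2) : ℝ) := by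
  rw [gaussWeight, Complex.ofReal_exp, Complex.ofReal_mul]

theorem norm_gaussWeight_le (t x : ℝ) : ‖gaussWeight t x‖ ≤ 1 := by
  rw [gaussWeight_eq, Complex.norm_real, Real.norm_eq_abs, abs_of_pos (Real.exp_pos _),
    Real.exp_le_one_iff]
  have : 0 ≤ (4 * Real.pi ^ 2 * t ^ 2) * x ^ 2 := by positivity
  linarith

/-- Multiplication of a Schwartz function by a Gaussian. -/
noncomputable def gaussMul (t : ℝ) (u : 𝓢(ℝ, ℂ)) : 𝓢(ℝ, ℂ) :=
  SchwartzMap.smulLeftCLM ℂ (gaussWeight t) u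

theorem gaussMul_apply (t : ℝ) (u : 𝓢(ℝ, ℂ)) (x : ℝ) : gaussMul t u x = gaussWeight t x * u x := by
  rw [gaussMul, SchwartzMap.smulLeftCLM_apply_apply (hasTemperateGrowth_gaussWeight t), smul_eq_mul]

theorem l2norm_gaussMul_le (t : ℝ) (u : 𝓢(ℝ, ℂ)) : l2norm (gaussMul t u) ≤ l2norm u := by
  unfold l2norm
  refine Real.sqrt_le_sqrt (integral_mono (sqInt_schwartz _).integrable_sq
    (sqInt_schwartz u).integrable_sq fun x => ?_)
  simp only [gaussMul_apply, norm_mul]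
  gcongr
  exact mul_le_of_le_one_left (norm_nonneg _) (norm_gaussWeight_le t x)

theorem integral_exp_gaussProb (s : ℝ) :
    ∫ η, Complex.exp ((s * η : ℝ) * I) ∂gaussProb = (Real.exp (-(s ^ 2) / 2) : ℝ) := by
  have h := charFun_gaussianReal (μ := 0) (v := 1) s
  rw [charFun_apply_real] at h
  push_cast
  rw [h]
  congr 1
  push_cast; ring

/-- From (x + z/2)² + (x - z/2)² = 2x² + z²/2 the two Gaussian factors split into a damping in x and
the factor e^{-2π²t²z²}. The latter is the characteristic function of the standard normal law at
2πtz, so it acts as a Gaussian average in ξ of width t; the constant 4π² in the weight is chosen for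
this. -/
theorem wigner_gaussMul (t : ℝ) (u v : 𝓢(ℝ, ℂ)) (x ξ : ℝ) :
    wigner (gaussMul t u) (gaussMul t v) (x, ξ) =
      gaussWeight t x ^ 2 * ∫ η, wigner u v (x, ξ - t * η) ∂gaussProb := by
  have cu := u.continuous
  have cv := v.continuous
  unfold wigner
  have hint : Integrable (Function.uncurry fun η z : ℝ =>
      Complex.exp (-(2 * Real.pi * z * (ξ - t * η) : ℝ) * I) *
        u (x + z / 2) * starRingEnd ℂ (v (x - z / 2))) (gaussProb.prod volume) := by
    have h1 : Integrable (fun p : ℝ × ℝ => (1 : ℂ) *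
        (u (x + p.2 / 2) * starRingEnd ℂ (v (x - p.2 / 2)))) (gaussProb.prod volume) :=
      (integrable_const (1 : ℂ)).mul_prod
        (integrable_wigner_kernel (sqInt_schwartz u) (sqInt_schwartz v) x)
    refine h1.mono (Continuous.aestronglyMeasurable (by fun_prop)) ?_
    filter_upwards with p
    simp only [Function.uncurry, norm_mul, norm_exp_neg_mul_I, one_mul, le_refl]
  rw [integral_integral_swap hint, ← integral_const_mul]
  congr 1; ext z
  have e : ∀ η : ℝ, Complex.exp (-(2 * Real.pi * z * (ξ - t * η) : ℝ) * I) *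
        u (x + z / 2) * starRingEnd ℂ (v (x - z / 2)) =
      (Complex.exp (-(2 * Real.pi * z * ξ : ℝ) * I) *
        u (x + z / 2) * starRingEnd ℂ (v (x - z / 2))) *
        Complex.exp (((2 * Real.pi * z * t) * η : ℝ) * I) := by
    intro η
    rw [mul_right_comm _ _ (Complex.exp _), mul_right_comm _ _ (Complex.exp _), ← Complex.exp_add]
    congr 3
    push_cast; ring
  simp only [e]
  rw [integral_const_mul, integral_exp_gaussProb, gaussMul_apply, gaussMul_apply, map_mul]
  simp only [gaussWeight_eq, Complex.conj_ofReal]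
  have : ∀ E a b c d g A B : ℂ, a * b = c ^ 2 * g →
      E * (a * A) * (b * B) = c ^ 2 * (E * A * B * g) := by
    intros E a b c d g A B h; linear_combination E * A * B * h
  apply this _ _ _ _ 0
  rw [← Complex.ofReal_mul, ← Complex.ofReal_pow, ← Complex.ofReal_mul, ← Real.exp_add,
    ← Real.exp_nat_mul, ← Real.exp_add]
  congr 2
  push_cast; ring

/-- Gaussian smoothing of a symbol in the frequency, with Gaussian damping in the position. -/
noncomputable def smoothSymbol (t : ℝ) (a : ℝ × ℝ → ℂ) (X : ℝ × ℝ) : ℂ :=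
  gaussWeight t X.1 ^ 2 * ∫ η, a (X.1, X.2 + t * η) ∂gaussProb

theorem continuous_gaussWeight (t : ℝ) : Continuous (gaussWeight t) := by
  unfold gaussWeight; fun_prop

theorem UnitSymbol.smoothSymbol {a : ℝ × ℝ → ℂ} (ha : UnitSymbol a) (t : ℝ) :
    UnitSymbol (smoothSymbol t a) := by
  constructor
  · refine StronglyMeasurable.mul ?_ ?_
    · exact (((continuous_gaussWeight t).comp continuous_fst).pow 2).stronglyMeasurable
    · have : StronglyMeasurable (fun p : (ℝ × ℝ) × ℝ => a (p.1.1, p.1.2 + t * p.2)) :=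
        ha.1.comp_measurable (by fun_prop)
      exact this.integral_prod_right
  · intro X
    unfold _root_.smoothSymbol
    rw [norm_mul, norm_pow]
    have h1 := norm_gaussWeight_le t X.1
    have h2 : ‖∫ η, a (X.1, X.2 + t * η) ∂gaussProb‖ ≤ 1 := by
      refine (norm_integral_le_of_norm_le_const (C := 1)
        (Eventually.of_forall fun η => ha.2 _)).trans ?_
      simp
    exact mul_le_one₀ (pow_le_one₀ (norm_nonneg _) h1) (norm_nonneg _) h2

/-- The transpose of `wigner_gaussMul`: translations in ξ move from the Wigner distribution to the
symbol. -/
theorem weylForm_gaussMul {a : ℝ × ℝ → ℂ} (ha : UnitSymbol a) (t : ℝ) (u v : 𝓢(ℝ, ℂ)) :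
    weylForm a (gaussMul t u) (gaussMul t v) = weylForm (smoothSymbol t a) u v := by
  have cW := continuous_wigner u v
  have cg := continuous_gaussWeight t
  have iW := integrable_wigner u v
  have hmp : ∀ η : ℝ, MeasurePreserving (fun p : ℝ × ℝ => (p.1, p.2 + t * η)) volume volume :=
    fun η => measurePreserving_shear_snd (h := fun _ => t * η) measurable_const
  have hmp' : ∀ η : ℝ, MeasurePreserving (fun p : ℝ × ℝ => (p.1, p.2 - t * η)) volume volume := by
    intro η
    simpa [sub_eq_add_neg] using measurePreserving_shear_snd (h := fun _ => -(t * η)) measurable_const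
  have h1 : ∀ η : ℝ, ∫ X : ℝ × ℝ, a X * (gaussWeight t X.1 ^ 2 * wigner u v (X.1, X.2 - t * η)) =
      ∫ X : ℝ × ℝ, a (X.1, X.2 + t * η) * (gaussWeight t X.1 ^ 2 * wigner u v X) := by
    intro η
    rw [← (hmp η).integral_comp_sm]
    · simp
    · exact ha.1.mul (by fun_prop : Continuous fun X : ℝ × ℝ =>
        (gaussWeight t X.1 ^ 2 * wigner u v (X.1, X.2 - t * η))).stronglyMeasurable
  have hg : ∀ x, ‖gaussWeight t x ^ 2‖ ≤ 1 := fun x => by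
    rw [norm_pow]; exact pow_le_one₀ (norm_nonneg _) (norm_gaussWeight_le t x)
  have b1 : ∀ (c : ℂ) (X Y : ℝ × ℝ), ‖c‖ ≤ 1 →
      ‖c * (gaussWeight t X.1 ^ 2 * wigner u v Y)‖ ≤ ‖wigner u v Y‖ := by
    intro c X Y hc
    rw [norm_mul, norm_mul]
    calc _ ≤ 1 * (1 * ‖wigner u v Y‖) := by gcongr; exact hg _
      _ = _ := by ring
  have i1 : Integrable (Function.uncurry fun (X : ℝ × ℝ) (η : ℝ) =>
      a X * (gaussWeight t X.1 ^ 2 * wigner u v (X.1, X.2 - t * η)))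
      ((volume : Measure (ℝ × ℝ)).prod gaussProb) := by
    have hm : StronglyMeasurable (Function.uncurry fun (X : ℝ × ℝ) (η : ℝ) =>
      a X * (gaussWeight t X.1 ^ 2 * wigner u v (X.1, X.2 - t * η))) :=
      (ha.1.comp_measurable measurable_fst).mul (Continuous.stronglyMeasurable (by fun_prop))
    rw [integrable_prod_iff' hm.aestronglyMeasurable]
    have i2 : ∀ η : ℝ, Integrable fun X : ℝ × ℝ => ‖wigner u v (X.1, X.2 - t * η)‖ := fun η =>
      ((hmp' η).integrable_comp_of_integrable iW).norm
    refine ⟨Eventually.of_forall fun η => (i2 η).mono'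
      (hm.comp_measurable (by fun_prop : Measurable fun X : ℝ × ℝ => (X, η))).aestronglyMeasurable
      (Eventually.of_forall fun X => b1 _ _ _ (ha.2 X)), ?_⟩
    refine (integrable_const (∫ X, ‖wigner u v X‖)).mono'
      (hm.norm.integral_prod_left).aestronglyMeasurable (Eventually.of_forall fun η => ?_)
    rw [Real.norm_of_nonneg (integral_nonneg fun _ => norm_nonneg _)]
    have e : ∫ X, ‖wigner u v X‖ = ∫ X : ℝ × ℝ, ‖wigner u v (X.1, X.2 - t * η)‖ := by
      conv_lhs => rw [← (hmp' η).map_eq, integral_map (hmp' η).measurable.aemeasurable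
        cW.norm.aestronglyMeasurable]
    rw [e]
    exact integral_mono_of_nonneg (Eventually.of_forall fun _ => norm_nonneg _) (i2 η)
      (Eventually.of_forall fun X => b1 _ _ _ (ha.2 X))
  have i3 : Integrable (Function.uncurry fun (X : ℝ × ℝ) (η : ℝ) =>
      a (X.1, X.2 + t * η) * (gaussWeight t X.1 ^ 2 * wigner u v X))
      ((volume : Measure (ℝ × ℝ)).prod gaussProb) := by
    have h : Integrable (fun p : (ℝ × ℝ) × ℝ => wigner u v p.1 * (1 : ℂ))
      ((volume : Measure (ℝ × ℝ)).prod gaussProb) := iW.mul_prod (integrable_const 1)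
    refine h.mono (StronglyMeasurable.aestronglyMeasurable ?_)
      (Eventually.of_forall fun p => ?_)
    · exact (ha.1.comp_measurable (by fun_prop : Measurable fun p : (ℝ × ℝ) × ℝ =>
        (p.1.1, p.1.2 + t * p.2))).mul (Continuous.stronglyMeasurable (by fun_prop))
    · rw [mul_one]; exact b1 _ _ _ (ha.2 _)
  unfold weylForm
  calc _ = ∫ X : ℝ × ℝ, ∫ η, a X * (gaussWeight t X.1 ^ 2 * wigner u v (X.1, X.2 - t * η))
          ∂gaussProb := by
        congr 1; ext X
        rw [integral_const_mul, integral_const_mul, ← wigner_gaussMul]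
    _ = ∫ η, (∫ X : ℝ × ℝ, a (X.1, X.2 + t * η) * (gaussWeight t X.1 ^ 2 * wigner u v X))
          ∂gaussProb := by
        rw [integral_integral_swap i1]
        simp only [h1]
    _ = _ := by
        rw [← integral_integral_swap i3]
        congr 1; ext X
        rw [integral_mul_const, smoothSymbol]; ring

/-- Smoothing the symbol amounts to multiplying both test functions by a Gaussian bounded by 1,
which is a contraction of L². -/
theorem FormBound.smoothSymbol {a : ℝ × ℝ → ℂ} (ha : UnitSymbol a) {M : ℝ} (hM : 0 ≤ M)
    (h : FormBound a M) (t : ℝ) : FormBound (smoothSymbol t a) M := by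
  intro u v
  rw [← weylForm_gaussMul ha]
  refine (h _ _).trans ?_
  have h1 := l2norm_gaussMul_le t u
  have h2 := l2norm_gaussMul_le t v
  have := l2norm_nonneg (gaussMul t u)
  have := l2norm_nonneg (gaussMul t v)
  have := l2norm_nonneg u
  gcongr

/-- Gaussian regularisation of a symbol in both variables. -/
noncomputable def regSymbol (t : ℝ) (a : ℝ × ℝ → ℂ) : ℝ × ℝ → ℂ :=
  smoothSymbol t (smoothSymbol t a ∘ fun X => (-X.2, X.1)) ∘ fun X => (X.2, -X.1)

theorem UnitSymbol.regSymbol {a : ℝ × ℝ → ℂ} (ha : UnitSymbol a) (t : ℝ) :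
    UnitSymbol (regSymbol t a) :=
  (((ha.smoothSymbol t).comp (by fun_prop)).smoothSymbol t).comp (by fun_prop)

theorem FormBound.regSymbol {a : ℝ × ℝ → ℂ} (ha : UnitSymbol a) {M : ℝ} (hM : 0 ≤ M)
    (h : FormBound a M) (t : ℝ) : FormBound (regSymbol t a) M :=
  (((h.smoothSymbol ha hM t).comp (ha.smoothSymbol t) implemented_rotation).smoothSymbol
    ((ha.smoothSymbol t).comp (by fun_prop)) hM t).comp
    (((ha.smoothSymbol t).comp (by fun_prop)).smoothSymbol t) implemented_rotation_inv

theorem regSymbol_apply (t : ℝ) (a : ℝ × ℝ → ℂ) (x ξ : ℝ) :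
    regSymbol t a (x, ξ) = gaussWeight t ξ ^ 2 * ∫ η, gaussWeight t (x - t * η) ^ 2 *
      ∫ η', a (x - t * η, ξ + t * η') ∂gaussProb ∂gaussProb := by
  unfold regSymbol smoothSymbol
  simp only [Function.comp_apply]
  have : ∀ η : ℝ, -(-x + t * η) = x - t * η := fun η => by ring
  simp only [this]

theorem regSymbol_conj {a : ℝ × ℝ → ℂ} (ha : ∀ X, starRingEnd ℂ (a X) = a X) (t : ℝ) (X : ℝ × ℝ) :
    starRingEnd ℂ (regSymbol t a X) = regSymbol t a X := by
  obtain ⟨x, ξ⟩ := X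
  rw [regSymbol_apply]
  simp only [map_mul, map_pow, gaussWeight_eq, Complex.conj_ofReal, ← integral_conj, ha]

theorem integrable_gaussWeight_sq {t : ℝ} (ht : t ≠ 0) :
    Integrable fun x => ‖gaussWeight t x ^ 2‖ := by
  have h := integrable_exp_neg_mul_sq (b := 8 * Real.pi ^ 2 * t ^ 2) (by positivity)
  refine h.congr (Eventually.of_forall fun x => ?_)
  simp only
  rw [norm_pow, gaussWeight_eq, Complex.norm_real, Real.norm_eq_abs, abs_of_pos (Real.exp_pos _),
    ← Real.exp_nat_mul]
  congr 1
  push_cast; ring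

theorem norm_smoothSymbol_le {a : ℝ × ℝ → ℂ} (ha : UnitSymbol a) (t : ℝ) (X : ℝ × ℝ) :
    ‖smoothSymbol t a X‖ ≤ ‖gaussWeight t X.1 ^ 2‖ := by
  unfold smoothSymbol
  rw [norm_mul]
  refine mul_le_of_le_one_right (norm_nonneg _) ?_
  refine (norm_integral_le_of_norm_le_const (C := 1)
    (Eventually.of_forall fun η => ha.2 _)).trans ?_
  simp

/-- The second smoothing leaves an explicit Gaussian in ξ, and the first a Gaussian in x averaged
over translations; their product is an integrable majorant. -/
theorem integrable_regSymbol {a : ℝ × ℝ → ℂ} (ha : UnitSymbol a) {t : ℝ} (ht : t ≠ 0) :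
    Integrable (regSymbol t a) := by
  have cg := continuous_gaussWeight t
  have i1 := integrable_gaussWeight_sq ht
  have hm : StronglyMeasurable (fun p : ℝ × ℝ => ‖gaussWeight t (p.1 - t * p.2) ^ 2‖) :=
    Continuous.stronglyMeasurable (by fun_prop)
  have i2 : Integrable (fun x => ∫ η, ‖gaussWeight t (x - t * η) ^ 2‖ ∂gaussProb) := by
    have : Integrable (fun p : ℝ × ℝ => ‖gaussWeight t (p.1 - t * p.2) ^ 2‖)
        (volume.prod gaussProb) := by
      rw [integrable_prod_iff' hm.aestronglyMeasurable]
      refine ⟨Eventually.of_forall fun η => i1.comp_sub_right (t * η), ?_⟩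
      simp only [norm_norm]
      have : ∀ η : ℝ, ∫ x, ‖gaussWeight t (x - t * η) ^ 2‖ = ∫ x, ‖gaussWeight t x ^ 2‖ :=
        fun η => integral_sub_right_eq_self (fun x => ‖gaussWeight t x ^ 2‖) (t * η)
      simp only [this]
      exact integrable_const _
    exact this.integral_prod_left
  refine (i2.mul_prod i1).mono' (ha.regSymbol t).1.aestronglyMeasurable
    (Eventually.of_forall fun X => ?_)
  obtain ⟨x, ξ⟩ := X
  simp only [regSymbol, Function.comp_apply]
  rw [smoothSymbol, norm_mul, mul_comm]
  gcongr
  refine (norm_integral_le_integral_norm _).trans ?_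
  refine integral_mono_of_nonneg (Eventually.of_forall fun _ => norm_nonneg _) ?_
    (Eventually.of_forall fun η => ?_)
  · refine (integrable_const (1 : ℝ)).mono'
      ((hm.comp_measurable (measurable_prodMk_left (x := x))).aestronglyMeasurable)
      (Eventually.of_forall fun η => ?_)
    rw [norm_norm, norm_pow]
    exact pow_le_one₀ (norm_nonneg _) (norm_gaussWeight_le t _)
  · refine (norm_smoothSymbol_le ha t _).trans (le_of_eq ?_)
    simp only
    congr 3; ring

theorem tendsto_regSymbol {a : ℝ × ℝ → ℂ} (ha : UnitSymbol a) {X : ℝ × ℝ} (hX : ContinuousAt a X) :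
    Tendsto (fun t => regSymbol t a X) (𝓝 0) (𝓝 (a X)) := by
  obtain ⟨x, ξ⟩ := X
  have g0 : ∀ y, gaussWeight 0 y = 1 := fun y => by simp [gaussWeight]
  have gc : Continuous fun p : ℝ × ℝ => gaussWeight p.1 p.2 := by unfold gaussWeight; fun_prop
  have hin : ∀ η : ℝ, Tendsto (fun t => ∫ η', a (x - t * η, ξ + t * η') ∂gaussProb) (𝓝 0)
      (𝓝 (∫ _, a (x, ξ) ∂gaussProb)) := by
    intro η
    refine tendsto_integral_filter_of_dominated_convergence (fun _ => 1)
      (Eventually.of_forall fun t => (ha.1.comp_measurable (by fun_prop)).aestronglyMeasurable)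
      (Eventually.of_forall fun t => Eventually.of_forall fun η' => ha.2 _) (integrable_const _)
      (Eventually.of_forall fun η' => ?_)
    refine hX.tendsto.comp ?_
    have : Continuous fun t : ℝ => (x - t * η, ξ + t * η') := by fun_prop
    simpa using this.tendsto 0
  have hout : Tendsto (fun t => ∫ η, gaussWeight t (x - t * η) ^ 2 *
      ∫ η', a (x - t * η, ξ + t * η') ∂gaussProb ∂gaussProb) (𝓝 0)
      (𝓝 (∫ _, gaussWeight 0 x ^ 2 * ∫ _, a (x, ξ) ∂gaussProb ∂gaussProb)) := by
    refine tendsto_integral_filter_of_dominated_convergence (fun _ => 1) ?_ ?_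
      (integrable_const _) (Eventually.of_forall fun η => ?_)
    · refine Eventually.of_forall fun t => StronglyMeasurable.aestronglyMeasurable ?_
      refine StronglyMeasurable.mul (Continuous.stronglyMeasurable (by fun_prop)) ?_
      have : StronglyMeasurable (fun p : ℝ × ℝ => a (x - t * p.1, ξ + t * p.2)) :=
        ha.1.comp_measurable (by fun_prop)
      exact this.integral_prod_right
    · refine Eventually.of_forall fun t => Eventually.of_forall fun η => ?_
      rw [norm_mul, norm_pow]
      refine mul_le_one₀ (pow_le_one₀ (norm_nonneg _) (norm_gaussWeight_le t _)) (norm_nonneg _) ?_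
      refine (norm_integral_le_of_norm_le_const (C := 1)
        (Eventually.of_forall fun η => ha.2 _)).trans ?_
      simp
    · refine Tendsto.mul ?_ (hin η)
      have : Continuous fun t : ℝ => gaussWeight t (x - t * η) ^ 2 := by fun_prop
      simpa using this.tendsto 0
  have h1 : Tendsto (fun t => gaussWeight t ξ ^ 2) (𝓝 0) (𝓝 (gaussWeight 0 ξ ^ 2)) :=
    (by fun_prop : Continuous fun t : ℝ => gaussWeight t ξ ^ 2).tendsto 0
  have h := h1.mul hout
  simp only [g0, integral_const, probReal_univ, one_smul, one_pow, one_mul] at h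
  simpa only [regSymbol_apply] using h

theorem continuousAt_indicatorSymbol {P : Set (ℝ × ℝ)} {X : ℝ × ℝ} (hX : X ∉ frontier P) :
    ContinuousAt (indicatorSymbol P) X := by
  by_cases hi : X ∈ interior P
  · refine (continuousAt_const (y := (1 : ℂ))).congr ?_
    filter_upwards [isOpen_interior.mem_nhds hi] with Y hY
    simp [indicatorSymbol, interior_subset hY]
  · have hc : X ∈ (closure P)ᶜ := fun hc => hX ⟨hc, hi⟩
    refine (continuousAt_const (y := (0 : ℂ))).congr ?_
    filter_upwards [isClosed_closure.isOpen_compl.mem_nhds hc] with Y hY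
    exact (Set.indicator_of_notMem (fun h => hY (subset_closure h)) _).symm

/-- The regularisation converges wherever the indicator is continuous, that is, off the frontier,
and the frontier of a convex set has measure zero. -/
theorem ae_tendsto_regSymbol {P : Set (ℝ × ℝ)} (hP : Convex ℝ P) (hPm : MeasurableSet P) :
    ∀ᵐ X, Tendsto (fun t => regSymbol t (indicatorSymbol P) X) (𝓝 0) (𝓝 (indicatorSymbol P X)) := by
  have h := hP.addHaar_frontier (volume : Measure (ℝ × ℝ))
  filter_upwards [measure_eq_zero_iff_ae_notMem.1 h] with X hX
  exact tendsto_regSymbol (unitSymbol_indicator hPm) (continuousAt_indicatorSymbol hX)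

/-! ### Integrable symbols: extension of forms to L² -/

theorem exists_schwartz_near {f : ℝ → ℂ} (hf : SqInt f) {ε : ℝ} (hε : 0 < ε) :
    ∃ u : 𝓢(ℝ, ℂ), l2norm (fun x => f x - u x) ≤ ε := by
  obtain ⟨g, h1, h2, h3⟩ := hf.2.exist_eLpNorm_sub_le (by norm_num) (by norm_num) hε
  refine ⟨h1.toSchwartzMap h2, ?_⟩
  have h4 : SqInt (fun x => f x - h1.toSchwartzMap h2 x) := hf.sub (sqInt_schwartz _)
  rw [l2norm_eq_eLpNorm h4.2]
  exact ENNReal.toReal_le_of_le_ofReal hε.le h3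

theorem l2norm_triangle {f g : ℝ → ℂ} (hf : SqInt f) (hg : SqInt g) :
    l2norm (fun x => f x + g x) ≤ l2norm f + l2norm g := by
  rw [l2norm_eq_eLpNorm hf.2, l2norm_eq_eLpNorm hg.2, l2norm_eq_eLpNorm (hf.add hg).2,
    ← ENNReal.toReal_add hf.2.2.ne hg.2.2.ne]
  exact ENNReal.toReal_mono (ENNReal.add_ne_top.2 ⟨hf.2.2.ne, hg.2.2.ne⟩)
    (eLpNorm_add_le hf.2.1 hg.2.1 (by norm_num))

theorem l2norm_sub_comm (f g : ℝ → ℂ) :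
    l2norm (fun x => f x - g x) = l2norm (fun x => g x - f x) := by
  unfold l2norm; simp only [norm_sub_rev]

theorem integrable_mul_wigner {b : ℝ × ℝ → ℂ} (hb : Integrable b) {f g : ℝ → ℂ} (hf : SqInt f)
    (hg : SqInt g) : Integrable fun X => b X * wigner f g X :=
  hb.mul_bdd (stronglyMeasurable_wigner hf.1 hg.1).aestronglyMeasurable
    (Eventually.of_forall fun X => norm_wigner_le hf hg X)

theorem norm_weylForm_le {b : ℝ × ℝ → ℂ} (hb : Integrable b) {f g : ℝ → ℂ} (hf : SqInt f)
    (hg : SqInt g) : ‖weylForm b f g‖ ≤ (2 * ∫ X, ‖b X‖) * (l2norm f * l2norm g) := by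
  unfold weylForm
  refine (norm_integral_le_integral_norm _).trans ?_
  calc _ ≤ ∫ X, ‖b X‖ * (2 * (l2norm f * l2norm g)) := by
        refine integral_mono (integrable_mul_wigner hb hf hg).norm (hb.norm.mul_const _) fun X => ?_
        simp only [norm_mul]
        gcongr
        exact norm_wigner_le hf hg X
    _ = _ := by rw [integral_mul_const]; ring

theorem weylForm_add_left' {b : ℝ × ℝ → ℂ} (hb : Integrable b) {f f' g : ℝ → ℂ} (hf : SqInt f)
    (hf' : SqInt f') (hg : SqInt g) :
    weylForm b (fun x => f x + f' x) g = weylForm b f g + weylForm b f' g := by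
  unfold weylForm
  rw [← integral_add (integrable_mul_wigner hb hf hg) (integrable_mul_wigner hb hf' hg)]
  congr 1; ext X
  rw [wigner_add_left hf hf' hg, mul_add]

theorem weylForm_add_right' {b : ℝ × ℝ → ℂ} (hb : Integrable b) {f g g' : ℝ → ℂ} (hf : SqInt f)
    (hg : SqInt g) (hg' : SqInt g') :
    weylForm b f (fun x => g x + g' x) = weylForm b f g + weylForm b f g' := by
  unfold weylForm
  rw [← integral_add (integrable_mul_wigner hb hf hg) (integrable_mul_wigner hb hf hg')]
  congr 1; ext X
  rw [wigner_add_right hf hg hg', mul_add]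

/-- For integrable symbols, a bound of the Weyl form on Schwartz functions extends to `L²`. -/
theorem FormBound.sqInt {b : ℝ × ℝ → ℂ} (hb : Integrable b) {M : ℝ} (hM : 0 ≤ M)
    (h : FormBound b M) {f g : ℝ → ℂ} (hf : SqInt f) (hg : SqInt g) :
    ‖weylForm b f g‖ ≤ M * (l2norm f * l2norm g) := by
  set K := 2 * ∫ X, ‖b X‖
  have hK : 0 ≤ K := mul_nonneg (by norm_num) (integral_nonneg fun _ => norm_nonneg _)
  set F := l2norm f
  set G := l2norm g
  have hF : 0 ≤ F := l2norm_nonneg f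
  have hG : 0 ≤ G := l2norm_nonneg g
  -- Replacing f and g by ε-close Schwartz functions costs at most K times the errors, with K =
  -- 2‖b‖₁ coming from the pointwise bound |W(f,g)| ≤ 2‖f‖‖g‖.
  have key : ∀ ε : ℝ, 0 < ε → ‖weylForm b f g‖ ≤
      M * ((F + ε) * (G + ε)) + K * (ε * G) + K * ((F + ε) * ε) := by
    intro ε hε
    obtain ⟨u, hu⟩ := exists_schwartz_near hf hε
    obtain ⟨v, hv⟩ := exists_schwartz_near hg hε
    have su := sqInt_schwartz u
    have sv := sqInt_schwartz v
    have du := hf.sub su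
    have dv := hg.sub sv
    have nu : l2norm u ≤ F + ε := by
      have h1 := l2norm_triangle hf (su.sub hf)
      rw [l2norm_sub_comm] at h1
      simp only [add_sub_cancel] at h1
      linarith
    have nv : l2norm v ≤ G + ε := by
      have h1 := l2norm_triangle hg (sv.sub hg)
      rw [l2norm_sub_comm] at h1
      simp only [add_sub_cancel] at h1
      linarith
    have e1 : weylForm b f g = weylForm b u v + weylForm b (fun x => f x - u x) g +
        weylForm b u (fun x => g x - v x) := by
      have h1 := weylForm_add_left' hb su du hg
      have h2 := weylForm_add_right' hb su sv dv
      simp only [add_sub_cancel] at h1 h2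
      rw [h1]
      rw [show weylForm b u g = _ from h2]
      ring
    rw [e1]
    refine (norm_add₃_le).trans ?_
    have t1 := h u v
    have t2 := norm_weylForm_le hb du hg
    have t3 := norm_weylForm_le hb su dv
    have p1 : M * (l2norm u * l2norm v) ≤ M * ((F + ε) * (G + ε)) := by
      have := l2norm_nonneg u
      have := l2norm_nonneg v
      gcongr
    have p2 : K * (l2norm (fun x => f x - u x) * G) ≤ K * (ε * G) := by gcongr
    have p3 : K * (l2norm u * l2norm (fun x => g x - v x)) ≤ K * ((F + ε) * ε) := by
      have := l2norm_nonneg (fun x => g x - v x)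
      gcongr
    linarith
  have hlim : Tendsto (fun ε : ℝ => M * ((F + ε) * (G + ε)) + K * (ε * G) + K * ((F + ε) * ε))
      (𝓝[>] 0) (𝓝 (M * ((F + 0) * (G + 0)) + K * (0 * G) + K * ((F + 0) * 0))) := by
    refine tendsto_nhdsWithin_of_tendsto_nhds ?_
    exact (by fun_prop : Continuous fun ε : ℝ =>
      M * ((F + ε) * (G + ε)) + K * (ε * G) + K * ((F + ε) * ε)).tendsto 0
  have := ge_of_tendsto hlim (eventually_nhdsWithin_of_forall fun ε hε => key ε hε)
  simpa using this

/-! ### Fourier transforms of slices of convex sets -/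

theorem norm_integral_exp_Icc_le {S : Set ℝ} (hS : S.OrdConnected) (hb : Bornology.IsBounded S)
    {z : ℝ} (hz : 0 < z) :
    ‖∫ ξ in S, Complex.exp (-(2 * Real.pi * z * ξ : ℝ) * I)‖ ≤ 1 / (Real.pi * z) := by
  rcases S.eq_empty_or_nonempty with rfl | hne
  · simp; positivity
  have ha := hb.bddBelow
  have hb' := hb.bddAbove
  set a := sInf S
  set b := sSup S
  have hab : a ≤ b := by
    obtain ⟨x, hx⟩ := hne
    exact (csInf_le ha hx).trans (le_csSup hb' hx)
  have h1 : Set.Ioo a b ⊆ S := by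
    intro x hx
    obtain ⟨y, hy, hyx⟩ := exists_lt_of_csInf_lt hne hx.1
    obtain ⟨w, hw, hxw⟩ := exists_lt_of_lt_csSup hne hx.2
    exact hS.out hy hw ⟨hyx.le, hxw.le⟩
  have h2 : S ⊆ Set.Icc a b := fun x hx => ⟨csInf_le ha hx, le_csSup hb' hx⟩
  -- A bounded order-connected set is an interval up to its endpoints; the integral is then
  -- explicit, with numerator at most 2 and denominator 2πz.
  have h3 : S =ᵐ[volume] Set.Ioc a b := by
    refine (EventuallyLE.antisymm ?_ ?_)
    · exact (LE.le.eventuallyLE h2).trans Ioc_ae_eq_Icc.symm.le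
    · exact (Ioo_ae_eq_Ioc.symm.le).trans (LE.le.eventuallyLE h1)
  rw [setIntegral_congr_set h3, ← intervalIntegral.integral_of_le hab]
  have hc : (-(2 * Real.pi * z : ℝ) * I : ℂ) ≠ 0 := by
    simp [hz.ne', Real.pi_ne_zero]
  have e : ∀ ξ : ℝ, Complex.exp (-(2 * Real.pi * z * ξ : ℝ) * I) =
      Complex.exp ((-(2 * Real.pi * z : ℝ) * I) * ξ) := by
    intro ξ; congr 1; push_cast; ring
  simp only [e]
  rw [integral_exp_mul_complex hc, norm_div]
  have n1 : ‖(-(2 * Real.pi * z : ℝ) * I : ℂ)‖ = 2 * Real.pi * z := by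
    rw [norm_mul, norm_neg, Complex.norm_real, Complex.norm_I, mul_one, Real.norm_of_nonneg]
    positivity
  rw [n1, div_le_div_iff₀ (by positivity) (by positivity)]
  have n2 : ‖Complex.exp ((-(2 * Real.pi * z : ℝ) * I) * b) -
      Complex.exp ((-(2 * Real.pi * z : ℝ) * I) * a)‖ ≤ 1 + 1 := by
    refine (norm_sub_le _ _).trans ?_
    rw [← e, ← e, norm_exp_neg_mul_I, norm_exp_neg_mul_I]
  have hpz : 0 < Real.pi * z := by positivity
  nlinarith

/-- The Fourier transform of a Gaussian weight restricted to an interval. -/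
theorem norm_integral_exp_gaussian_le {J : Set ℝ} (hJ : J.OrdConnected) (hJm : MeasurableSet J)
    {κ : ℝ} (hκ : 0 < κ) {z : ℝ} (hz : 0 < z) :
    ‖∫ ξ, Complex.exp (-(2 * Real.pi * z * ξ : ℝ) * I) *
      ((Real.exp (-κ * ξ ^ 2) : ℝ) * J.indicator (fun _ => (1 : ℂ)) ξ)‖ ≤ 1 / (Real.pi * z) := by
  -- Layer-cake formula: the weighted indicator is the integral over the height r of the indicators
  -- of the horizontal sections of D. Only 0 < r < 1 contributes, so a bound on each section passes
  -- to the total with no loss.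
  set D : Set (ℝ × ℝ) := {p | p.1 ∈ J ∧ 0 < p.2 ∧ p.2 < Real.exp (-κ * p.1 ^ 2)} with hD
  have hDm : MeasurableSet D := by
    refine (measurable_fst hJm).inter (MeasurableSet.inter ?_ ?_)
    · exact measurableSet_lt measurable_const measurable_snd
    · exact measurableSet_lt measurable_snd (by fun_prop)
  set E : ℝ → ℂ := fun ξ => Complex.exp (-(2 * Real.pi * z * ξ : ℝ) * I) with hE
  have hEc : Continuous E := by simp only [hE]; fun_prop
  have nE : ∀ ξ, ‖E ξ‖ = 1 := fun ξ => norm_exp_neg_mul_I _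
  set F : ℝ × ℝ → ℂ := fun p => E p.1 * D.indicator (fun _ => (1 : ℂ)) p with hF
  have hFm : StronglyMeasurable F :=
    (hEc.comp continuous_fst).stronglyMeasurable.mul (stronglyMeasurable_const.indicator hDm)
  have hsec : ∀ ξ, (fun r => D.indicator (fun _ => (1 : ℂ)) (ξ, r)) =
      (Set.Ioo 0 (Real.exp (-κ * ξ ^ 2))).indicator (fun _ => J.indicator (fun _ => (1 : ℂ)) ξ) := by
    intro ξ; ext r
    by_cases h1 : ξ ∈ J <;> by_cases h2 : r ∈ Set.Ioo 0 (Real.exp (-κ * ξ ^ 2)) <;>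
      simp_all [Set.indicator]
  have hsecI : ∀ ξ, ∫ r, D.indicator (fun _ => (1 : ℂ)) (ξ, r) =
      (Real.exp (-κ * ξ ^ 2) : ℝ) * J.indicator (fun _ => (1 : ℂ)) ξ := by
    intro ξ
    rw [hsec, integral_indicator measurableSet_Ioo, setIntegral_const]
    simp [Measure.real, Real.exp_nonneg]
  have hFi : Integrable F (volume.prod volume) := by
    rw [integrable_prod_iff hFm.aestronglyMeasurable]
    have h0 : ∀ ξ, Integrable (fun r => F (ξ, r)) := by
      intro ξ
      simp only [hF]
      refine Integrable.const_mul ?_ _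
      rw [hsec]
      exact (integrable_indicator_iff measurableSet_Ioo).2
        (integrableOn_const (by simp))
    refine ⟨Eventually.of_forall h0, ?_⟩
    refine (integrable_exp_neg_mul_sq hκ).mono' (hFm.norm.integral_prod_right).aestronglyMeasurable
      (Eventually.of_forall fun ξ => ?_)
    rw [Real.norm_of_nonneg (integral_nonneg fun _ => norm_nonneg _)]
    have : ∀ r, ‖F (ξ, r)‖ ≤ (Set.Ioo 0 (Real.exp (-κ * ξ ^ 2))).indicator (fun _ => (1 : ℝ)) r := by
      intro r
      simp only [hF]
      rw [norm_mul, nE, one_mul, show D.indicator (fun _ => (1 : ℂ)) (ξ, r) = _ from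
        congrFun (hsec ξ) r]
      by_cases h1 : ξ ∈ J <;> by_cases h2 : r ∈ Set.Ioo 0 (Real.exp (-κ * ξ ^ 2)) <;>
        simp [h1, Set.indicator]
      all_goals split_ifs <;> simp
    calc _ ≤ ∫ r, (Set.Ioo 0 (Real.exp (-κ * ξ ^ 2))).indicator (fun _ => (1 : ℝ)) r :=
          integral_mono (h0 ξ).norm ((integrable_indicator_iff measurableSet_Ioo).2
            (integrableOn_const (by simp))) this
      _ = _ := by
        rw [integral_indicator measurableSet_Ioo, setIntegral_const]
        simp [Measure.real, Real.exp_nonneg]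
  have e1 : ∫ ξ, E ξ * ((Real.exp (-κ * ξ ^ 2) : ℝ) * J.indicator (fun _ => (1 : ℂ)) ξ) =
      ∫ r, ∫ ξ, F (ξ, r) := by
    rw [← integral_integral_swap (f := fun ξ r => F (ξ, r)) hFi]
    congr 1; ext ξ
    simp only [hF]
    rw [integral_const_mul, hsecI]
  rw [e1]
  have b : ∀ r, ‖∫ ξ, F (ξ, r)‖ ≤ (Set.Ioo (0 : ℝ) 1).indicator (fun _ => 1 / (Real.pi * z)) r := by
    intro r
    by_cases hr : r ∈ Set.Ioo (0 : ℝ) 1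
    · rw [Set.indicator_of_mem hr]
      set S : Set ℝ := {ξ | (ξ, r) ∈ D}
      have hSm : MeasurableSet S := measurable_prodMk_right hDm
      have e2 : ∫ ξ, F (ξ, r) = ∫ ξ in S, E ξ := by
        rw [← integral_indicator hSm]
        congr 1; ext ξ
        simp only [hF]
        by_cases h : (ξ, r) ∈ D
        · rw [Set.indicator_of_mem h, Set.indicator_of_mem (show ξ ∈ S from h), mul_one]
        · rw [Set.indicator_of_notMem h, Set.indicator_of_notMem (show ξ ∉ S from h), mul_zero]
      rw [e2]
      have hS : ∀ ξ ∈ S, κ * ξ ^ 2 < -Real.log r := by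
        intro ξ hξ
        have := (Real.log_lt_iff_lt_exp hr.1).2 hξ.2.2
        linarith
      -- Superlevel sets of a centred Gaussian are bounded intervals, and so are their intersections
      -- with J.
      refine norm_integral_exp_Icc_le ⟨fun x hx y hy w hw => ?_⟩ ?_ hz
      · refine ⟨hJ.out hx.1 hy.1 hw, hr.1, ?_⟩
        have hw2 : w ^ 2 ≤ max (x ^ 2) (y ^ 2) := by
          rcases le_total 0 w with h | h
          · exact le_max_of_le_right (by nlinarith [hw.2])
          · exact le_max_of_le_left (by nlinarith [hw.1])
        rcases le_max_iff.1 hw2 with h | h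
        · exact hx.2.2.trans_le (Real.exp_le_exp.2 (by nlinarith))
        · exact hy.2.2.trans_le (Real.exp_le_exp.2 (by nlinarith))
      · refine (Metric.isBounded_closedBall (x := (0 : ℝ)) (r := -Real.log r / κ + 1)).subset ?_
        intro ξ hξ
        rw [mem_closedBall_zero_iff, Real.norm_eq_abs]
        have h1 : ξ ^ 2 ≤ -Real.log r / κ := by
          rw [le_div_iff₀ hκ]; linarith [hS ξ hξ]
        rw [← sq_abs] at h1
        nlinarith [sq_nonneg (|ξ| - 1), abs_nonneg ξ]
    · rw [Set.indicator_of_notMem hr]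
      have : ∀ ξ, F (ξ, r) = 0 := by
        intro ξ
        have : (ξ, r) ∉ D := fun h => hr ⟨h.2.1, h.2.2.trans_le (Real.exp_le_one_iff.2 (by
          have : 0 ≤ κ * ξ ^ 2 := by positivity
          simp only; linarith))⟩
        simp [hF, Set.indicator_of_notMem this]
      simp [this]
  refine (norm_integral_le_of_norm_le ?_ (Eventually.of_forall b)).trans ?_
  · exact (integrable_indicator_iff measurableSet_Ioo).2 (integrableOn_const (by simp))
  · rw [integral_indicator measurableSet_Ioo, setIntegral_const]
    simp

open scoped ENNReal

/-- For fixed displacements the slice of the translated convex set is an interval, and the remaining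
weight is a Gaussian in ξ times a factor at most 1. Averaging over the two Gaussian displacements
preserves the bound, which is therefore uniform in t. -/
theorem norm_integral_exp_regSymbol_le {P : Set (ℝ × ℝ)} (hP : Convex ℝ P) (hPm : MeasurableSet P)
    {t : ℝ} (ht : t ≠ 0) (x : ℝ) {z : ℝ} (hz : 0 < z) :
    ‖∫ ξ, Complex.exp (-(2 * Real.pi * z * ξ : ℝ) * I) * regSymbol t (indicatorSymbol P) (x, ξ)‖ ≤
      1 / (Real.pi * z) := by
  have ha := unitSymbol_indicator hPm
  have cg := continuous_gaussWeight t
  have hg : ∀ x, ‖gaussWeight t x ^ 2‖ ≤ 1 := fun x => by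
    rw [norm_pow]; exact pow_le_one₀ (norm_nonneg _) (norm_gaussWeight_le t x)
  set E : ℝ → ℂ := fun ξ => Complex.exp (-(2 * Real.pi * z * ξ : ℝ) * I) with hE
  have hEc : Continuous E := by simp only [hE]; fun_prop
  have nE : ∀ ξ, ‖E ξ‖ = 1 := fun ξ => norm_exp_neg_mul_I _
  set A : ℝ → ℝ × ℝ → ℂ := fun ξ η => gaussWeight t (x - t * η.1) ^ 2 *
      indicatorSymbol P (x - t * η.1, ξ + t * η.2) with hA
  have hAm : StronglyMeasurable (fun p : ℝ × (ℝ × ℝ) => A p.1 p.2) :=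
    (Continuous.stronglyMeasurable (by fun_prop)).mul (ha.1.comp_measurable (by fun_prop))
  have nA : ∀ ξ η, ‖A ξ η‖ ≤ 1 := fun ξ η => by
    simp only [hA]; rw [norm_mul]
    exact mul_le_one₀ (hg _) (norm_nonneg _) (ha.2 _)
  have iA : ∀ ξ, Integrable (A ξ) (gaussProb.prod gaussProb) := fun ξ =>
    (integrable_const (1 : ℝ)).mono'
      (hAm.comp_measurable (measurable_prodMk_left (x := ξ))).aestronglyMeasurable
      (Eventually.of_forall (nA ξ))
  have e1 : ∀ ξ, E ξ * regSymbol t (indicatorSymbol P) (x, ξ) =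
      ∫ η, E ξ * (gaussWeight t ξ ^ 2 * A ξ η) ∂(gaussProb.prod gaussProb) := by
    intro ξ
    rw [regSymbol_apply, integral_const_mul, integral_const_mul, integral_prod _ (iA ξ)]
    simp only [hA, integral_const_mul]
  have hint : Integrable (Function.uncurry fun ξ (η : ℝ × ℝ) => E ξ * (gaussWeight t ξ ^ 2 * A ξ η))
      (volume.prod (gaussProb.prod gaussProb)) := by
    have h1 : Integrable (fun p : ℝ × (ℝ × ℝ) => ‖gaussWeight t p.1 ^ 2‖ * (1 : ℝ))
        (volume.prod (gaussProb.prod gaussProb)) :=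
      (integrable_gaussWeight_sq ht).mul_prod (integrable_const _)
    refine h1.mono' (StronglyMeasurable.aestronglyMeasurable ?_) (Eventually.of_forall fun p => ?_)
    · exact (hEc.comp continuous_fst).stronglyMeasurable.mul
        (((cg.comp continuous_fst).pow 2).stronglyMeasurable.mul hAm)
    · simp only [Function.uncurry]
      rw [norm_mul, norm_mul, nE, one_mul]
      gcongr
      exact nA _ _
  change ‖∫ ξ, E ξ * regSymbol t (indicatorSymbol P) (x, ξ)‖ ≤ _
  simp only [e1]
  rw [integral_integral_swap hint]
  refine (norm_integral_le_of_norm_le_const (C := 1 / (Real.pi * z))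
    (Eventually.of_forall fun η => ?_)).trans (by simp)
  set J : Set ℝ := {ξ | (x - t * η.1, ξ + t * η.2) ∈ P} with hJ
  have hJm : MeasurableSet J :=
    (by fun_prop : Measurable fun ξ : ℝ => (x - t * η.1, ξ + t * η.2)) hPm
  have hJo : J.OrdConnected := by
    refine Convex.ordConnected fun y hy w hw a b ha hb hab => ?_
    have := hP hy hw ha hb hab
    simp only [hJ, Set.mem_ofPred_eq]
    convert this using 1
    ext
    · simp only [Prod.smul_mk, Prod.mk_add_mk, smul_eq_mul]
      linear_combination -(x - t * η.1) * hab
    · simp only [Prod.smul_mk, Prod.mk_add_mk, smul_eq_mul]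
      linear_combination -(t * η.2) * hab
  have e2 : ∀ ξ, E ξ * (gaussWeight t ξ ^ 2 * A ξ η) = gaussWeight t (x - t * η.1) ^ 2 *
      (E ξ * ((Real.exp (-(8 * Real.pi ^ 2 * t ^ 2) * ξ ^ 2) : ℝ) *
        J.indicator (fun _ => (1 : ℂ)) ξ)) := by
    intro ξ
    have h1 : gaussWeight t ξ ^ 2 = (Real.exp (-(8 * Real.pi ^ 2 * t ^ 2) * ξ ^ 2) : ℝ) := by
      rw [gaussWeight_eq, ← Complex.ofReal_pow, ← Real.exp_nat_mul]
      congr 2; push_cast; ring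
    have h2 : indicatorSymbol P (x - t * η.1, ξ + t * η.2) = J.indicator (fun _ => (1 : ℂ)) ξ := rfl
    simp only [hA]
    rw [h1, h2]; ring
  simp only [e2]
  rw [integral_const_mul, norm_mul]
  calc _ ≤ 1 * (1 / (Real.pi * z)) := by
        gcongr
        · exact hg _
        · exact norm_integral_exp_gaussian_le hJo hJm (by positivity) hz
    _ = _ := one_mul _

/-! ### A Schur test for half of Hilbert's kernel -/

/-- The weight of the Schur test for the truncated Hilbert kernel. -/
noncomputable def schurWeight (c w : ℝ) : ℝ := √(c / w) / (Real.pi * (w + c))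

/-- This primitive takes the values 0, 1/2 and 1 at w = 0, w = c and in the limit w → ∞, so the
weight has mass exactly 1/2 on each side of c. -/
theorem hasDerivAt_arctan_sqrt {c w : ℝ} (hc : 0 < c) (hw : 0 < w) :
    HasDerivAt (fun w => 2 / Real.pi * Real.arctan √(w / c)) (schurWeight c w) w := by
  have h1 : HasDerivAt (fun w => w / c) (1 / c) w := (hasDerivAt_id w).div_const c
  have h2 := (h1.sqrt (by positivity)).arctan.const_mul (2 / Real.pi)
  refine h2.congr_deriv ?_
  unfold schurWeight
  rw [Real.sq_sqrt (by positivity), Real.sqrt_div' _ hw.le, Real.sqrt_div' _ hc.le]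
  have e1 : √c * √c = c := Real.mul_self_sqrt hc.le
  have e3 : √c ≠ 0 := (Real.sqrt_pos.2 hc).ne'
  have e4 : √w ≠ 0 := (Real.sqrt_pos.2 hw).ne'
  field_simp
  ring

theorem schurWeight_nonneg {c w : ℝ} (hc : 0 ≤ c) (hw : 0 ≤ w) : 0 ≤ schurWeight c w := by
  unfold schurWeight; positivity

theorem lintegral_schurWeight_Ioc {c : ℝ} (hc : 0 < c) :
    ∫⁻ w in Set.Ioc 0 c, ENNReal.ofReal (schurWeight c w) = ENNReal.ofReal (1 / 2) := by
  have hcont : ContinuousOn (fun w => 2 / Real.pi * Real.arctan √(w / c)) (Set.Icc 0 c) := by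
    fun_prop
  have hder : ∀ w ∈ Set.Ioo 0 c, HasDerivAt (fun w => 2 / Real.pi * Real.arctan √(w / c))
      (schurWeight c w) w := fun w hw => hasDerivAt_arctan_sqrt hc hw.1
  have hint := intervalIntegral.integrableOn_deriv_of_nonneg hcont hder
    (fun w hw => schurWeight_nonneg hc.le hw.1.le)
  rw [← ofReal_integral_eq_lintegral_ofReal hint
    ((ae_restrict_iff' measurableSet_Ioc).2 (Eventually.of_forall fun w hw =>
      schurWeight_nonneg hc.le hw.1.le)), ← intervalIntegral.integral_of_le hc.le,
    intervalIntegral.integral_eq_sub_of_hasDerivAt_of_le hc.le hcont hder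
      ((intervalIntegrable_iff_integrableOn_Ioc_of_le hc.le).2 hint)]
  congr 1
  simp [div_self hc.ne']
  field_simp
  norm_num

theorem lintegral_schurWeight_Ioi {c : ℝ} (hc : 0 < c) :
    ∫⁻ w in Set.Ioi c, ENNReal.ofReal (schurWeight c w) = ENNReal.ofReal (1 / 2) := by
  have hder : ∀ w ∈ Set.Ici c, HasDerivAt (fun w => 2 / Real.pi * Real.arctan √(w / c))
      (schurWeight c w) w := fun w hw => hasDerivAt_arctan_sqrt hc (hc.trans_le hw)
  have hlim : Tendsto (fun w => 2 / Real.pi * Real.arctan √(w / c)) atTop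
      (𝓝 (2 / Real.pi * (Real.pi / 2))) := by
    refine Tendsto.const_mul _ ((Real.tendsto_arctan_atTop.mono_right nhdsWithin_le_nhds).comp ?_)
    exact Real.tendsto_sqrt_atTop.comp (tendsto_id.atTop_div_const hc)
  have hpos : ∀ w ∈ Set.Ioi c, 0 ≤ schurWeight c w := fun w hw =>
    schurWeight_nonneg hc.le (hc.trans hw).le
  have hint := integrableOn_Ioi_deriv_of_nonneg' hder hpos hlim
  rw [← ofReal_integral_eq_lintegral_ofReal hint
    ((ae_restrict_iff' measurableSet_Ioi).2 (Eventually.of_forall hpos)),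
    integral_Ioi_of_hasDerivAt_of_nonneg' hder hpos hlim]
  congr 1
  simp [div_self hc.ne']
  field_simp
  norm_num

theorem ENNReal.ofReal_sqrt_mul_sqrt {a : ℝ} (ha : 0 ≤ a) :
    ENNReal.ofReal √a * ENNReal.ofReal √a = ENNReal.ofReal a := by
  rw [← ENNReal.ofReal_mul (Real.sqrt_nonneg _), Real.mul_self_sqrt ha]

/-- Schur test: the kernel `1/(π(s+t))` on `0 < t ≤ s` has norm at most `1/2`. -/
theorem lintegral_hilbert_kernel_le {F G : ℝ → ℝ≥0∞} (hF : Measurable F) (hG : Measurable G) :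
    ∫⁻ s, ∫⁻ t, {p : ℝ × ℝ | 0 < p.2 ∧ p.2 ≤ p.1}.indicator
      (fun p => F p.1 * G p.2 * ENNReal.ofReal (1 / (Real.pi * (p.1 + p.2)))) (s, t) ≤
    ENNReal.ofReal (1 / 2) * ((∫⁻ s, F s ^ 2) ^ (1 / 2 : ℝ) * (∫⁻ t, G t ^ 2) ^ (1 / 2 : ℝ)) := by
  set D : Set (ℝ × ℝ) := {p : ℝ × ℝ | 0 < p.2 ∧ p.2 ≤ p.1} with hD
  have hDm : MeasurableSet D :=
    (measurableSet_lt measurable_const measurable_snd).inter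
      (measurableSet_le measurable_snd measurable_fst)
  have hsw : Measurable fun p : ℝ × ℝ => schurWeight p.1 p.2 := by
    unfold schurWeight; fun_prop
  -- The kernel is the geometric mean of the weights with s and t exchanged, because √(s/t)·√(t/s) =
  -- 1. Cauchy–Schwarz on D then leaves one marginal on (0, s] and one on [t, ∞), each equal to 1/2.
  set f : ℝ × ℝ → ℝ≥0∞ := D.indicator fun p => F p.1 * ENNReal.ofReal √(schurWeight p.1 p.2) with hf
  set g : ℝ × ℝ → ℝ≥0∞ := D.indicator fun p => G p.2 * ENNReal.ofReal √(schurWeight p.2 p.1) with hg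
  have hfm : Measurable f := (by fun_prop : Measurable fun p : ℝ × ℝ =>
    F p.1 * ENNReal.ofReal √(schurWeight p.1 p.2)).indicator hDm
  have hgm : Measurable g := by
    refine Measurable.indicator ?_ hDm
    have := hsw.comp measurable_swap
    simp only [Function.comp_def, Prod.fst_swap, Prod.snd_swap] at this
    fun_prop
  have hfg : ∀ p, D.indicator
      (fun p => F p.1 * G p.2 * ENNReal.ofReal (1 / (Real.pi * (p.1 + p.2)))) p = (f * g) p := by
    intro p
    by_cases hp : p ∈ D
    · have h2 : 0 < p.2 := hp.1
      have h1 : 0 < p.1 := h2.trans_le hp.2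
      simp only [hf, hg, Pi.mul_apply, Set.indicator_of_mem hp]
      have : ENNReal.ofReal √(schurWeight p.1 p.2) * ENNReal.ofReal √(schurWeight p.2 p.1) =
          ENNReal.ofReal (1 / (Real.pi * (p.1 + p.2))) := by
        rw [← ENNReal.ofReal_mul (Real.sqrt_nonneg _),
          ← Real.sqrt_mul (schurWeight_nonneg h1.le h2.le)]
        congr 1
        rw [Real.sqrt_eq_iff_mul_self_eq_of_pos (by positivity)]
        unfold schurWeight
        have e : √(p.1 / p.2) * √(p.2 / p.1) = 1 := by
          rw [← Real.sqrt_mul (by positivity)]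
          have : p.1 / p.2 * (p.2 / p.1) = 1 := by field_simp
          rw [this, Real.sqrt_one]
        simp only [div_mul_div_comm, e]
        rw [add_comm p.2 p.1, one_mul]
      rw [← this]; ring
    · simp [hf, hg, Set.indicator_of_notMem hp]
  simp only [hfg]
  rw [← lintegral_prod _ (hfm.mul hgm).aemeasurable]
  refine (ENNReal.lintegral_mul_le_Lp_mul_Lq _ Real.HolderConjugate.two_two hfm.aemeasurable
    hgm.aemeasurable).trans ?_
  have hIoi : ∀ t : ℝ, (Set.Ici t) =ᵐ[volume] Set.Ioi t := fun t => Ioi_ae_eq_Ici.symm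
  have bf : ∫⁻ p, f p ^ (2 : ℝ) ∂(volume.prod volume) ≤ ENNReal.ofReal (1 / 2) * ∫⁻ s, F s ^ 2 := by
    rw [lintegral_prod _ (by fun_prop), ← lintegral_const_mul _ (by fun_prop)]
    refine lintegral_mono fun s => ?_
    by_cases hs : 0 < s
    · have : ∀ t, f (s, t) ^ (2 : ℝ) = (Set.Ioc 0 s).indicator
          (fun t => F s ^ 2 * ENNReal.ofReal (schurWeight s t)) t := by
        intro t
        by_cases ht : t ∈ Set.Ioc 0 s
        · rw [Set.indicator_of_mem ht, hf, Set.indicator_of_mem (show (s, t) ∈ D from ht),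
            ENNReal.rpow_two, mul_pow, sq (ENNReal.ofReal _),
            ENNReal.ofReal_sqrt_mul_sqrt (schurWeight_nonneg hs.le ht.1.le)]
        · rw [Set.indicator_of_notMem ht, hf, Set.indicator_of_notMem (show (s, t) ∉ D from ht)]
          simp
      simp only [this]
      rw [lintegral_indicator measurableSet_Ioc, lintegral_const_mul _ (by
        have := hsw.comp (measurable_prodMk_left (x := s)); simp only [Function.comp_def] at this
        fun_prop), lintegral_schurWeight_Ioc hs, mul_comm]
    · have : ∀ t, f (s, t) ^ (2 : ℝ) = 0 := by
        intro t
        rw [hf, Set.indicator_of_notMem (fun h => hs (h.1.trans_le h.2))]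
        simp
      simp [this]
  have bg : ∫⁻ p, g p ^ (2 : ℝ) ∂(volume.prod volume) ≤ ENNReal.ofReal (1 / 2) * ∫⁻ s, G s ^ 2 := by
    rw [lintegral_prod_symm _ (by fun_prop), ← lintegral_const_mul _ (by fun_prop)]
    refine lintegral_mono fun t => ?_
    by_cases ht : 0 < t
    · have : ∀ s, g (s, t) ^ (2 : ℝ) = (Set.Ici t).indicator
          (fun s => G t ^ 2 * ENNReal.ofReal (schurWeight t s)) s := by
        intro s
        by_cases hs : s ∈ Set.Ici t
        · rw [Set.indicator_of_mem hs, hg, Set.indicator_of_mem (show (s, t) ∈ D from ⟨ht, hs⟩),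
            ENNReal.rpow_two, mul_pow, sq (ENNReal.ofReal _),
            ENNReal.ofReal_sqrt_mul_sqrt (schurWeight_nonneg ht.le (ht.le.trans hs))]
        · rw [Set.indicator_of_notMem hs, hg, Set.indicator_of_notMem (fun h => hs h.2)]
          simp
      simp only [this]
      rw [lintegral_indicator measurableSet_Ici, lintegral_const_mul _ (by
        have := hsw.comp (measurable_prodMk_left (x := t)); simp only [Function.comp_def] at this
        fun_prop), setLIntegral_congr (hIoi t), lintegral_schurWeight_Ioi ht, mul_comm]
    · have : ∀ s, g (s, t) ^ (2 : ℝ) = 0 := by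
        intro s
        rw [hg, Set.indicator_of_notMem (fun h => ht h.1)]
        simp
      simp [this]
  calc _ ≤ (ENNReal.ofReal (1 / 2) * ∫⁻ s, F s ^ 2) ^ (1 / 2 : ℝ) *
        (ENNReal.ofReal (1 / 2) * ∫⁻ s, G s ^ 2) ^ (1 / 2 : ℝ) := by gcongr
    _ = _ := by
      rw [ENNReal.mul_rpow_of_nonneg _ _ (by norm_num), ENNReal.mul_rpow_of_nonneg _ _ (by norm_num)]
      have : ENNReal.ofReal (1 / 2) ^ (1 / 2 : ℝ) * ENNReal.ofReal (1 / 2) ^ (1 / 2 : ℝ) =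
          ENNReal.ofReal (1 / 2) := by
        rw [← ENNReal.rpow_add_of_nonneg _ _ (by norm_num) (by norm_num)]; norm_num
      rw [mul_mul_mul_comm, this]

theorem l2norm_eq_lintegral {f : ℝ → ℂ} (hf : SqInt f) :
    (∫⁻ x, ‖f x‖ₑ ^ 2) ^ (1 / 2 : ℝ) = ENNReal.ofReal (l2norm f) := by
  rw [l2norm_eq_eLpNorm hf.2, ENNReal.ofReal_toReal hf.2.2.ne,
    eLpNorm_eq_lintegral_rpow_enorm_toReal (by norm_num) (by norm_num)]
  simp

theorem SqInt.comp_neg {f : ℝ → ℂ} (hf : SqInt f) : SqInt fun x => f (-x) := by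
  simpa using sqInt_comp_affine hf 0 (c := -1) (by norm_num)

theorem l2norm_comp_neg (f : ℝ → ℂ) : l2norm (fun x => f (-x)) = l2norm f := by
  unfold l2norm
  rw [integral_neg_eq_self (fun x => ‖f x‖ ^ 2)]

/-- The off-diagonal blocks, relative to the splitting of the line at the origin. -/
theorem norm_weylForm_offDiag_le {b : ℝ × ℝ → ℂ} (hbm : StronglyMeasurable b) (hb : Integrable b)
    (hs : ∀ x z : ℝ, 0 < z → ‖∫ ξ, Complex.exp (-(2 * Real.pi * z * ξ : ℝ) * I) * b (x, ξ)‖ ≤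
      1 / (Real.pi * z))
    {f g : ℝ → ℂ} (hf : SqInt f) (hg : SqInt g) (hf0 : ∀ x < 0, f x = 0) (hg0 : ∀ x, 0 ≤ x → g x = 0) :
    ‖weylForm ({X : ℝ × ℝ | 0 ≤ X.1}.indicator b) f g‖ ≤ 1 / 2 * (l2norm f * l2norm g) := by
  set H : Set (ℝ × ℝ) := {X : ℝ × ℝ | 0 ≤ X.1} with hH
  have hHm : MeasurableSet H := measurableSet_le measurable_const measurable_fst
  set b' := H.indicator b with hb'
  have hbm' : StronglyMeasurable b' := hbm.indicator hHm
  have hbi' : Integrable b' := hb.indicator hHm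
  set k : ℝ → ℝ → ℂ := fun x z => f (x + z / 2) * starRingEnd ℂ (g (x - z / 2)) with hk
  set Φ : (ℝ × ℝ) × ℝ → ℂ := fun p => b' p.1 *
    (Complex.exp (-(2 * Real.pi * p.2 * p.1.2 : ℝ) * I) *
      f (p.1.1 + p.2 / 2) * starRingEnd ℂ (g (p.1.1 - p.2 / 2))) with hΦ
  have hΦm : StronglyMeasurable Φ :=
    (hbm'.comp_measurable measurable_fst).mul (stronglyMeasurable_wigner_integrand hf.1 hg.1)
  have hΦi : Integrable Φ ((volume : Measure (ℝ × ℝ)).prod volume) := by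
    rw [integrable_prod_iff hΦm.aestronglyMeasurable]
    refine ⟨Eventually.of_forall fun X => (integrable_wigner_integrand hf hg X).const_mul (b' X), ?_⟩
    refine (hbi'.norm.mul_const (2 * (l2norm f * l2norm g))).mono'
      (hΦm.norm.integral_prod_right).aestronglyMeasurable (Eventually.of_forall fun X => ?_)
    rw [Real.norm_of_nonneg (integral_nonneg fun _ => norm_nonneg _)]
    simp only [hΦ, norm_mul, norm_exp_neg_mul_I, RCLike.norm_conj, one_mul]
    rw [integral_const_mul]
    gcongr
    refine (integral_norm_mul_le (sqInt_wigner_left hf X.1) (sqInt_wigner_right hg X.1)).trans ?_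
    rw [l2norm_wigner_left, l2norm_wigner_right]
    have : √2 * √2 = 2 := Real.mul_self_sqrt (by norm_num)
    exact le_of_eq (by linear_combination l2norm f * l2norm g * this)
  -- reassociate the variables as `(x, (ξ, z))`
  have hΦi2 : Integrable (fun q : ℝ × (ℝ × ℝ) => Φ ((q.1, q.2.1), q.2.2))
      ((volume : Measure ℝ).prod ((volume : Measure ℝ).prod volume)) :=
    (measurePreserving_prodAssoc (volume : Measure ℝ) (volume : Measure ℝ)
      (volume : Measure ℝ)).symm.integrable_comp_of_integrable hΦi
  have e1 : weylForm b' f g = ∫ x, ∫ z, ∫ ξ, Φ ((x, ξ), z) := by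
    have h1 : weylForm b' f g = ∫ X : ℝ × ℝ, ∫ z, Φ (X, z) := by
      unfold weylForm wigner
      congr 1; ext X
      rw [← integral_const_mul]
    rw [h1, show (volume : Measure (ℝ × ℝ)) = (volume : Measure ℝ).prod volume from rfl,
      integral_prod _ hΦi.integral_prod_left]
    refine integral_congr_ae ?_
    filter_upwards [hΦi2.prod_right_ae] with x hx
    exact integral_integral_swap (f := fun ξ z => Φ ((x, ξ), z)) hx
  -- With s = x + z/2 in the support of f and t = x - z/2 in that of g, one has s ≥ 0 > t, so z > 0;
  -- the cut x ≥ 0 reads -t ≤ s. The reflection t ↦ -t turns 1/(π(s-t)) on this region into the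
  -- kernel of the Schur test.
  set D : Set (ℝ × ℝ) := {p : ℝ × ℝ | 0 < -p.2 ∧ -p.2 ≤ p.1} with hD
  have hDm : MeasurableSet D :=
    (measurableSet_lt measurable_const measurable_snd.neg).inter
      (measurableSet_le measurable_snd.neg measurable_fst)
  set G : ℝ × ℝ → ℝ≥0∞ := D.indicator
    (fun p => ‖f p.1‖ₑ * ‖g p.2‖ₑ * ENNReal.ofReal (1 / (Real.pi * (p.1 - p.2)))) with hG
  have hfe : Measurable fun x => ‖f x‖ₑ := hf.1.measurable.enorm
  have hge : Measurable fun x => ‖g x‖ₑ := hg.1.measurable.enorm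
  have hGm : Measurable G := (((hfe.comp measurable_fst).mul (hge.comp measurable_snd)).mul
    (by fun_prop : Measurable fun p : ℝ × ℝ =>
      ENNReal.ofReal (1 / (Real.pi * (p.1 - p.2))))).indicator hDm
  have hpt : ∀ x z, ‖∫ ξ, Φ ((x, ξ), z)‖ₑ ≤ G (x + z / 2, x - z / 2) := by
    intro x z
    have e2 : ∫ ξ, Φ ((x, ξ), z) =
        (∫ ξ, Complex.exp (-(2 * Real.pi * z * ξ : ℝ) * I) * b' (x, ξ)) * k x z := by
      rw [← integral_mul_const]
      congr 1; ext ξ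
      simp only [hΦ, hk]; ring
    rw [e2]
    by_cases hx : 0 ≤ x
    · by_cases hfz : x + z / 2 < 0
      · simp [hk, hf0 _ hfz]
      by_cases hgz : 0 ≤ x - z / 2
      · simp [hk, hg0 _ hgz]
      have hz : 0 < z := by linarith
      have hmem : (x + z / 2, x - z / 2) ∈ D := ⟨by simp only; linarith, by simp only; linarith⟩
      rw [hG, Set.indicator_of_mem hmem]
      have e3 : ∀ ξ, b' (x, ξ) = b (x, ξ) := fun ξ => by
        rw [hb', Set.indicator_of_mem (show (x, ξ) ∈ H from hx)]
      simp only [e3]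
      rw [enorm_mul, mul_comm, hk]
      simp only
      rw [enorm_mul, ← ofReal_norm (starRingEnd ℂ _), RCLike.norm_conj, ofReal_norm]
      gcongr
      rw [← ofReal_norm]
      refine ENNReal.ofReal_le_ofReal ((hs x z hz).trans (le_of_eq ?_))
      congr 2; ring
    · have e3 : ∀ ξ, b' (x, ξ) = 0 := fun ξ => by
        rw [hb', Set.indicator_of_notMem (show (x, ξ) ∉ H from hx)]
      simp [e3]
  have main : ‖weylForm b' f g‖ₑ ≤ ENNReal.ofReal (1 / 2 * (l2norm f * l2norm g)) := by
    calc ‖weylForm b' f g‖ₑ ≤ ∫⁻ x, ∫⁻ z, G (x + z / 2, x - z / 2) := by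
          rw [e1]
          refine (enorm_integral_le_lintegral_enorm _).trans (lintegral_mono fun x => ?_)
          exact (enorm_integral_le_lintegral_enorm _).trans (lintegral_mono fun z => hpt x z)
      _ = ∫⁻ p : ℝ × ℝ, G (p.1 + p.2 / 2, p.1 - p.2 / 2) :=
          (lintegral_prod (fun p : ℝ × ℝ => G (p.1 + p.2 / 2, p.1 - p.2 / 2))
            (hGm.comp measurePreserving_wigner.measurable).aemeasurable).symm
      _ = ∫⁻ p : ℝ × ℝ, G p := measurePreserving_wigner.lintegral_comp hGm
      _ = ∫⁻ p : ℝ × ℝ, G (p.1, -p.2) := (measurePreserving_neg_snd.lintegral_comp hGm).symm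
      _ = ∫⁻ s, ∫⁻ t, G (s, -t) := lintegral_prod (fun p : ℝ × ℝ => G (p.1, -p.2))
            (hGm.comp measurePreserving_neg_snd.measurable).aemeasurable
      _ = ∫⁻ s, ∫⁻ t, {p : ℝ × ℝ | 0 < p.2 ∧ p.2 ≤ p.1}.indicator
            (fun p => ‖f p.1‖ₑ * ‖g (-p.2)‖ₑ * ENNReal.ofReal (1 / (Real.pi * (p.1 + p.2))))
            (s, t) := by
          congr 1; ext s; congr 1; ext t
          simp only [hG, hD, Set.indicator, Set.mem_ofPred_eq, neg_neg, sub_neg_eq_add]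
      _ ≤ _ := by
          refine (lintegral_hilbert_kernel_le (G := fun t => ‖g (-t)‖ₑ) hfe
            (hge.comp measurable_neg)).trans (le_of_eq ?_)
          rw [l2norm_eq_lintegral hf, l2norm_eq_lintegral hg.comp_neg, l2norm_comp_neg,
            ← ENNReal.ofReal_mul (l2norm_nonneg _), ← ENNReal.ofReal_mul (by norm_num)]
  rw [← ofReal_norm, ENNReal.ofReal_le_ofReal_iff] at main
  · exact main
  · have := l2norm_nonneg f
    have := l2norm_nonneg g
    positivity

/-! ### Cutting a convex set by a half plane -/

theorem l2norm_sq_split {f : ℝ → ℂ} (hf : SqInt f) {s : Set ℝ} (hs : MeasurableSet s) :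
    l2norm f ^ 2 = l2norm (s.indicator f) ^ 2 + l2norm (sᶜ.indicator f) ^ 2 := by
  rw [l2norm_sq, l2norm_sq, l2norm_sq, ← integral_add (hf.indicator hs).integrable_sq
    (hf.indicator hs.compl).integrable_sq]
  congr 1; ext x
  by_cases h : x ∈ s <;> simp [h]

/-- The largest eigenvalue of the matrix `((M, 1/2), (1/2, 0))`. -/
noncomputable def nextBound (M : ℝ) : ℝ := (M + √(M ^ 2 + 1)) / 2

theorem nextBound_sq (M : ℝ) : nextBound M ^ 2 = M * nextBound M + 1 / 4 := by
  unfold nextBound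
  have h : √(M ^ 2 + 1) ^ 2 = M ^ 2 + 1 := Real.sq_sqrt (by positivity)
  linear_combination h / 4

theorem le_nextBound (M : ℝ) : M ≤ nextBound M := by
  unfold nextBound
  have : M ≤ √(M ^ 2 + 1) := Real.le_sqrt_of_sq_le (by linarith)
  linarith

theorem nextBound_nonneg (M : ℝ) : 0 ≤ nextBound M := by
  unfold nextBound
  have : -M ≤ √(M ^ 2 + 1) := Real.le_sqrt_of_sq_le (by nlinarith)
  linarith

/-- The norm of a symmetric matrix bounds its bilinear form; here the norm is the larger root L of
L² = ML + 1/4. The numbers a, b and c, d are the norms of the two halves of u and v. -/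
theorem two_by_two_bound {M : ℝ} (hM : 0 ≤ M) {a b c d p q : ℝ} (hp : 0 ≤ p) (hq : 0 ≤ q) (h1 : p ^ 2 = a ^ 2 + b ^ 2)
    (h2 : q ^ 2 = c ^ 2 + d ^ 2) :
    M * (a * c) + 1 / 2 * (a * d) + 1 / 2 * (b * c) ≤ nextBound M * (p * q) := by
  set L := nextBound M
  have hL : L ^ 2 = M * L + 1 / 4 := nextBound_sq M
  have hL0 : 0 ≤ L := nextBound_nonneg M
  have hML : M ≤ L := le_nextBound M
  refine abs_le_of_sq_le_sq' ?_ (by positivity) |>.2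
  have e1 : (L * (p * q)) ^ 2 = L ^ 2 * ((a ^ 2 + b ^ 2) * (c ^ 2 + d ^ 2)) := by
    rw [mul_pow, mul_pow, h1, h2]
  rw [e1]
  set X := M * c + 1 / 2 * d
  set Y := 1 / 2 * c
  have e2 : M * (a * c) + 1 / 2 * (a * d) + 1 / 2 * (b * c) = a * X + b * Y := by
    simp only [X, Y]; ring
  rw [e2]
  have cs : (a * X + b * Y) ^ 2 ≤ (a ^ 2 + b ^ 2) * (X ^ 2 + Y ^ 2) := by
    nlinarith [sq_nonneg (a * Y - b * X)]
  have hXY : X ^ 2 + Y ^ 2 ≤ L ^ 2 * (c ^ 2 + d ^ 2) := by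
    have e3 : L ^ 2 * (c ^ 2 + d ^ 2) - (X ^ 2 + Y ^ 2) =
        M * ((L - M) * c ^ 2 - c * d + L * d ^ 2) := by
      simp only [X, Y]; linear_combination (c ^ 2 + d ^ 2) * hL
    -- The defect is a perfect square because 4L(L - M) = 1.
    have e4 : 4 * L * ((L - M) * c ^ 2 - c * d + L * d ^ 2) = (c - 2 * L * d) ^ 2 := by
      linear_combination 4 * c ^ 2 * hL
    have hL1 : 0 < L := by
      rcases hL0.eq_or_lt with h | h
      · rw [← h] at hL; norm_num at hL
      · exact h
    have e5 : 0 ≤ (L - M) * c ^ 2 - c * d + L * d ^ 2 := by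
      have : 0 ≤ 4 * L * ((L - M) * c ^ 2 - c * d + L * d ^ 2) := e4 ▸ sq_nonneg _
      exact nonneg_of_mul_nonneg_right this (by positivity)
    nlinarith [mul_nonneg hM e5]
  calc _ ≤ (a ^ 2 + b ^ 2) * (X ^ 2 + Y ^ 2) := cs
    _ ≤ (a ^ 2 + b ^ 2) * (L ^ 2 * (c ^ 2 + d ^ 2)) := by gcongr
    _ = _ := by ring

theorem weylForm_congr {a b : ℝ × ℝ → ℂ} {f g : ℝ → ℂ}
    (h : ∀ X, a X * wigner f g X = b X * wigner f g X) : weylForm a f g = weylForm b f g := by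
  unfold weylForm; simp only [h]

theorem wigner_eq_zero_of_neg {f g : ℝ → ℂ} (hf : ∀ x < 0, f x = 0) (hg : ∀ x < 0, g x = 0)
    {X : ℝ × ℝ} (hX : X.1 < 0) : wigner f g X = 0 := by
  unfold wigner
  rw [← integral_zero ℝ ℂ]
  congr 1; ext z
  rcases lt_or_ge (X.1 + z / 2) 0 with h | h
  · simp [hf _ h]
  · simp [hg (X.1 - z / 2) (by linarith)]

theorem wigner_eq_zero_of_nonneg {f g : ℝ → ℂ} (hf : ∀ x, 0 ≤ x → f x = 0)
    (hg : ∀ x, 0 ≤ x → g x = 0) {X : ℝ × ℝ} (hX : 0 ≤ X.1) : wigner f g X = 0 := by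
  unfold wigner
  rw [← integral_zero ℝ ℂ]
  congr 1; ext z
  rcases le_or_gt 0 (X.1 + z / 2) with h | h
  · simp [hf _ h]
  · simp [hg (X.1 - z / 2) (by linarith)]

/-- Cutting a symbol with controlled slices by the half plane `x ≥ 0`. -/
theorem FormBound.indicator_halfPlane {b : ℝ × ℝ → ℂ} (hbm : StronglyMeasurable b)
    (hb : Integrable b) (hreal : ∀ X, starRingEnd ℂ (b X) = b X)
    (hs : ∀ x z : ℝ, 0 < z → ‖∫ ξ, Complex.exp (-(2 * Real.pi * z * ξ : ℝ) * I) * b (x, ξ)‖ ≤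
      1 / (Real.pi * z)) {M : ℝ} (hM : 0 ≤ M) (h : FormBound b M) :
    FormBound ({X : ℝ × ℝ | 0 ≤ X.1}.indicator b) (nextBound M) := by
  intro u v
  set H : Set (ℝ × ℝ) := {X : ℝ × ℝ | 0 ≤ X.1} with hH
  have hHm : MeasurableSet H := measurableSet_le measurable_const measurable_fst
  set b' := H.indicator b with hb'
  have hbi' : Integrable b' := hb.indicator hHm
  have hr' : ∀ X, starRingEnd ℂ (b' X) = b' X := fun X => by
    by_cases hX : X ∈ H
    · rw [hb', Set.indicator_of_mem hX, hreal]
    · rw [hb', Set.indicator_of_notMem hX, map_zero]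
  have hI : MeasurableSet (Set.Ici (0 : ℝ)) := measurableSet_Ici
  set f := (Set.Ici (0 : ℝ)).indicator u
  set f' := (Set.Ici (0 : ℝ))ᶜ.indicator u
  set g := (Set.Ici (0 : ℝ)).indicator v
  set g' := (Set.Ici (0 : ℝ))ᶜ.indicator v
  have su := sqInt_schwartz u
  have sv := sqInt_schwartz v
  have sf : SqInt f := su.indicator hI
  have sf' : SqInt f' := su.indicator hI.compl
  have sg : SqInt g := sv.indicator hI
  have sg' : SqInt g' := sv.indicator hI.compl
  have f0 : ∀ x < 0, f x = 0 := fun x hx => Set.indicator_of_notMem (by simpa using hx) _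
  have g0 : ∀ x < 0, g x = 0 := fun x hx => Set.indicator_of_notMem (by simpa using hx) _
  have f0' : ∀ x, 0 ≤ x → f' x = 0 := fun x hx => Set.indicator_of_notMem (by simpa using hx) _
  have g0' : ∀ x, 0 ≤ x → g' x = 0 := fun x hx => Set.indicator_of_notMem (by simpa using hx) _
  have eu : (u : ℝ → ℂ) = fun x => f x + f' x := by
    ext x; exact (Set.indicator_self_add_compl_apply _ _ _).symm
  have ev : (v : ℝ → ℂ) = fun x => g x + g' x := by
    ext x; exact (Set.indicator_self_add_compl_apply _ _ _).symm
  -- The (+,+) block: the Wigner distribution of two functions on the right half line already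
  -- vanishes for x < 0, so the uncut symbol can be used.
  have t1 : ‖weylForm b' f g‖ ≤ M * (l2norm f * l2norm g) := by
    rw [weylForm_congr (b := b)]
    · exact h.sqInt hb hM sf sg
    · intro X
      by_cases hX : X ∈ H
      · rw [hb', Set.indicator_of_mem hX]
      · rw [wigner_eq_zero_of_neg f0 g0 (lt_of_not_ge hX), mul_zero, mul_zero]
  have t2 : ‖weylForm b' f g'‖ ≤ 1 / 2 * (l2norm f * l2norm g') :=
    norm_weylForm_offDiag_le hbm hb hs sf sg' f0 g0'
  -- The transposed block; reality of the symbol reduces it to the previous one.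
  have t3 : ‖weylForm b' f' g‖ ≤ 1 / 2 * (l2norm f' * l2norm g) := by
    rw [weylForm_conj, RCLike.norm_conj, mul_comm (l2norm f')]
    simp only [hr']
    exact norm_weylForm_offDiag_le hbm hb hs sg sf' g0 f0'
  have t4 : weylForm b' f' g' = 0 := by
    unfold weylForm
    rw [← integral_zero (ℝ × ℝ) ℂ]
    congr 1; ext X
    by_cases hX : X ∈ H
    · rw [wigner_eq_zero_of_nonneg f0' g0' hX, mul_zero]
    · rw [hb', Set.indicator_of_notMem hX, zero_mul]
  have e : weylForm b' u v = weylForm b' f g + weylForm b' f g' + weylForm b' f' g := by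
    rw [eu, weylForm_add_left' hbi' sf sf' sv, ev, weylForm_add_right' hbi' sf sg sg',
      weylForm_add_right' hbi' sf' sg sg', t4, add_zero]
  rw [e]
  refine norm_add₃_le.trans (le_trans (by linarith) (two_by_two_bound hM (l2norm_nonneg u) (l2norm_nonneg v)
    (l2norm_sq_split su hI) (l2norm_sq_split sv hI)))

/-- Cutting a convex set by the half plane `x ≥ 0`. -/
theorem FormBound.inter_halfPlane {P : Set (ℝ × ℝ)} (hP : Convex ℝ P) (hPm : MeasurableSet P)
    {M : ℝ} (hM : 0 ≤ M) (h : FormBound (indicatorSymbol P) M) :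
    FormBound (indicatorSymbol (P ∩ {X | 0 ≤ X.1})) (nextBound M) := by
  intro u v
  have ha := unitSymbol_indicator hPm
  have hHm : MeasurableSet {X : ℝ × ℝ | 0 ≤ X.1} := measurableSet_le measurable_const measurable_fst
  -- The half plane must be cut sharply for the blocks to separate, so only P is regularised; the
  -- Wigner distribution of Schwartz functions is an integrable majorant when the regularisation is
  -- removed.
  have hlim : Tendsto (fun t => weylForm ({X : ℝ × ℝ | 0 ≤ X.1}.indicator
      (_root_.regSymbol t (indicatorSymbol P))) u v) (𝓝[≠] 0)
      (𝓝 (weylForm (indicatorSymbol (P ∩ {X | 0 ≤ X.1})) u v)) := by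
    refine tendsto_integral_filter_of_dominated_convergence (fun X => ‖wigner u v X‖)
      (Eventually.of_forall fun t => ?_) (Eventually.of_forall fun t => Eventually.of_forall
        fun X => ?_) (integrable_wigner u v).norm ?_
    · exact (((ha.regSymbol t).1.indicator hHm).mul
        (continuous_wigner u v).stronglyMeasurable).aestronglyMeasurable
    · rw [norm_mul]
      refine mul_le_of_le_one_left (norm_nonneg _) ?_
      refine (norm_indicator_le_norm_self _ _).trans ((ha.regSymbol t).2 X)
    · filter_upwards [ae_tendsto_regSymbol hP hPm] with X hX
      refine Tendsto.mul_const _ ?_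
      by_cases hX0 : X ∈ {X : ℝ × ℝ | 0 ≤ X.1}
      · simp only [Set.indicator_of_mem hX0]
        have : indicatorSymbol (P ∩ {X | 0 ≤ X.1}) X = indicatorSymbol P X := by
          unfold indicatorSymbol
          rw [Set.inter_comm, ← Set.indicator_indicator, Set.indicator_of_mem hX0]
        rw [this]
        exact hX.mono_left nhdsWithin_le_nhds
      · simp only [Set.indicator_of_notMem hX0]
        have : indicatorSymbol (P ∩ {X | 0 ≤ X.1}) X = 0 :=
          Set.indicator_of_notMem (fun h => hX0 h.2) _
        rw [this]
        exact tendsto_const_nhds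
  refine le_of_tendsto hlim.norm (eventually_nhdsWithin_of_forall fun t ht => ?_)
  exact (h.regSymbol ha hM t).indicator_halfPlane (ha.regSymbol t).1 (integrable_regSymbol ha ht)
    (regSymbol_conj (indicatorSymbol_conj P) t)
    (fun x z hz => norm_integral_exp_regSymbol_le hP hPm ht x hz) hM u v

/-! ### Polygons, normal forms of half planes, and the recursion -/

theorem convex_of_mem_polygons {N : ℕ} {P : Set (ℝ × ℝ)} (hP : P ∈ polygons N) : Convex ℝ P := by
  obtain ⟨L, c, rfl⟩ := hP
  have : {X | ∀ j, c j ≤ L j X} = ⋂ j, {X | c j ≤ L j X} := by ext; simp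
  rw [this]
  exact convex_iInter fun j => convex_halfSpace_ge (L j).isLinear (c j)

theorem measurableSet_of_mem_polygons {N : ℕ} {P : Set (ℝ × ℝ)} (hP : P ∈ polygons N) :
    MeasurableSet P := by
  obtain ⟨L, c, rfl⟩ := hP
  have : {X | ∀ j, c j ≤ L j X} = ⋂ j, {X | c j ≤ L j X} := by ext; simp
  rw [this]
  exact MeasurableSet.iInter fun j => measurableSet_le measurable_const
    (L j).continuous_of_finiteDimensional.measurable

theorem preimage_mem_polygons {N : ℕ} {P : Set (ℝ × ℝ)} (hP : P ∈ polygons N)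
    (T : ℝ × ℝ →ₗ[ℝ] ℝ × ℝ) (w : ℝ × ℝ) : (fun X => T X + w) ⁻¹' P ∈ polygons N := by
  obtain ⟨L, c, rfl⟩ := hP
  refine ⟨fun j => (L j).comp T, fun j => c j - L j w, ?_⟩
  ext X
  simp

theorem linearForm_apply (L : ℝ × ℝ →ₗ[ℝ] ℝ) (X : ℝ × ℝ) :
    L X = L (1, 0) * X.1 + L (0, 1) * X.2 := by
  have : X = X.1 • (1, 0) + X.2 • ((0, 1) : ℝ × ℝ) := by ext <;> simp
  conv_lhs => rw [this]
  rw [map_add, map_smul, map_smul, smul_eq_mul, smul_eq_mul]; ring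

/-- Implemented transformations with an affine left inverse. -/
def AffineImplemented (χ : ℝ × ℝ → ℝ × ℝ) : Prop :=
  Implemented χ ∧ ∃ (T : ℝ × ℝ →ₗ[ℝ] ℝ × ℝ) (w : ℝ × ℝ), ∀ X, T (χ X) + w = X

theorem AffineImplemented.comp {χ ψ : ℝ × ℝ → ℝ × ℝ} (hχ : AffineImplemented χ)
    (hψ : AffineImplemented ψ) : AffineImplemented (χ ∘ ψ) := by
  obtain ⟨h1, T, w, hT⟩ := hχ
  obtain ⟨h2, S, v, hS⟩ := hψ
  refine ⟨h1.comp h2, S.comp T, S w + v, fun X => ?_⟩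
  have := hT (ψ X)
  rw [Function.comp_apply, LinearMap.comp_apply, ← add_assoc, ← map_add, this, hS]

theorem affineImplemented_translation (h : ℝ) : AffineImplemented (fun X => (X.1 + h, X.2)) :=
  ⟨implemented_translation h, LinearMap.id, (-h, 0), fun X => by ext <;> simp⟩

theorem affineImplemented_neg : AffineImplemented (fun X => (-X.1, -X.2)) :=
  ⟨implemented_neg, -LinearMap.id, 0, fun X => by ext <;> simp⟩

theorem affineImplemented_rotation_inv : AffineImplemented (fun X => (X.2, -X.1)) :=
  ⟨implemented_rotation_inv, (-LinearMap.snd ℝ ℝ ℝ).prod (LinearMap.fst ℝ ℝ ℝ), 0,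
    fun X => by ext <;> simp⟩

theorem affineImplemented_shear (p : ℝ) : AffineImplemented (fun X => (X.1, X.2 + p * X.1)) :=
  ⟨by simpa using implemented_shear p 0, (LinearMap.fst ℝ ℝ ℝ).prod
    (LinearMap.snd ℝ ℝ ℝ - p • LinearMap.fst ℝ ℝ ℝ), 0, fun X => by ext <;> simp⟩

/-- Every half plane can be moved to `x ≥ 0`. -/
theorem exists_affineImplemented_halfPlane {L : ℝ × ℝ →ₗ[ℝ] ℝ} (hL : L ≠ 0) (c : ℝ) :
    ∃ χ, AffineImplemented χ ∧ ∃ k > 0, ∀ X, L X - c = k * (χ X).1 := by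
  have pos : ∀ (k : ℝ), 0 < k → ∃ χ, AffineImplemented χ ∧ ∃ k' > 0,
      ∀ X : ℝ × ℝ, k * X.1 - c = k' * (χ X).1 := fun k hk =>
    ⟨_, affineImplemented_translation (-(c / k)), k, hk, fun X => by field_simp; ring⟩
  have fst : ∀ (k : ℝ), k ≠ 0 → ∃ χ, AffineImplemented χ ∧ ∃ k' > 0,
      ∀ X : ℝ × ℝ, k * X.1 - c = k' * (χ X).1 := by
    intro k hk
    rcases hk.lt_or_gt with h | h
    · obtain ⟨χ, h1, k', hk', h2⟩ := pos (-k) (by linarith)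
      exact ⟨_, h1.comp affineImplemented_neg, k', hk', fun X => by
        rw [Function.comp_apply, ← h2]; ring⟩
    · exact pos k h
  by_cases hβ : L (0, 1) = 0
  · have hα : L (1, 0) ≠ 0 := fun h => hL (LinearMap.ext fun X => by
      rw [linearForm_apply, h, hβ]; simp)
    obtain ⟨χ, h1, k', hk', h2⟩ := fst _ hα
    exact ⟨χ, h1, k', hk', fun X => by rw [← h2, linearForm_apply, hβ]; ring⟩
  · obtain ⟨χ, h1, k', hk', h2⟩ := fst _ hβ
    -- A shear kills the dependence on x, a quarter turn exchanges the axes, and the form becomes a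
    -- multiple of the first coordinate.
    refine ⟨_, (h1.comp affineImplemented_rotation_inv).comp
      (affineImplemented_shear (L (1, 0) / L (0, 1))), k', hk', fun X => ?_⟩
    rw [Function.comp_apply, Function.comp_apply, ← h2, linearForm_apply]
    field_simp; ring

theorem indicatorSymbol_preimage (χ : ℝ × ℝ → ℝ × ℝ) (P : Set (ℝ × ℝ)) :
    indicatorSymbol (χ ⁻¹' P) = indicatorSymbol P ∘ χ := rfl

theorem formBound_empty {M : ℝ} (hM : 0 ≤ M) : FormBound (indicatorSymbol ∅) M := by
  intro u v
  have : weylForm (indicatorSymbol ∅) u v = 0 := by simp [weylForm, indicatorSymbol]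
  rw [this, norm_zero]
  have := l2norm_nonneg u
  have := l2norm_nonneg v
  positivity

theorem norm_integral_mul_conj_le {f g : ℝ → ℂ} (hf : SqInt f) (hg : SqInt g) :
    ‖∫ x, f x * starRingEnd ℂ (g x)‖ ≤ l2norm f * l2norm g := by
  refine (norm_integral_le_integral_norm _).trans ?_
  simp only [norm_mul, RCLike.norm_conj]
  exact integral_norm_mul_le hf hg

theorem weylForm_fst {S : Set ℝ} (hS : MeasurableSet S) (u v : 𝓢(ℝ, ℂ)) :
    weylForm (indicatorSymbol (Prod.fst ⁻¹' S)) u v =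
      ∫ x, S.indicator u x * starRingEnd ℂ (v x) := by
  have hi := (unitSymbol_indicator (measurable_fst (β := ℝ) hS)).integrable_mul
    (integrable_wigner u v)
  unfold weylForm
  rw [show (volume : Measure (ℝ × ℝ)) = (volume : Measure ℝ).prod volume from rfl,
    integral_prod _ hi]
  congr 1; ext x
  by_cases hx : x ∈ S
  · have : ∀ ξ : ℝ, indicatorSymbol (Prod.fst ⁻¹' S) (x, ξ) = 1 := fun ξ =>
      Set.indicator_of_mem (show (x, ξ) ∈ Prod.fst ⁻¹' S from hx) _
    simp only [this, one_mul]
    rw [integral_wigner_snd, Set.indicator_of_mem hx]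
  · have : ∀ ξ : ℝ, indicatorSymbol (Prod.fst ⁻¹' S) (x, ξ) = 0 := fun ξ =>
      Set.indicator_of_notMem (show (x, ξ) ∉ Prod.fst ⁻¹' S from hx) _
    simp [this, Set.indicator_of_notMem hx]

/-- Symbols depending on the position only are multiplication operators. -/
theorem formBound_fst {S : Set ℝ} (hS : MeasurableSet S) :
    FormBound (indicatorSymbol (Prod.fst ⁻¹' S)) 1 := by
  intro u v
  rw [weylForm_fst hS, one_mul]
  have su := sqInt_schwartz u
  refine (norm_integral_mul_conj_le (su.indicator hS) (sqInt_schwartz v)).trans ?_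
  refine mul_le_mul_of_nonneg_right ?_ (l2norm_nonneg _)
  refine Real.sqrt_le_sqrt (integral_mono (su.indicator hS).integrable_sq su.integrable_sq
    fun x => ?_)
  simp only
  gcongr
  exact norm_indicator_le_norm_self _ _

theorem polygons_zero {P : Set (ℝ × ℝ)} (hP : P ∈ polygons 0) : P = Set.univ := by
  obtain ⟨L, c, rfl⟩ := hP
  ext; simp

theorem polygons_succ {N : ℕ} {P : Set (ℝ × ℝ)} (hP : P ∈ polygons (N + 1)) :
    ∃ Q ∈ polygons N, ∃ (L : ℝ × ℝ →ₗ[ℝ] ℝ) (c : ℝ), P = Q ∩ {X | c ≤ L X} := by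
  obtain ⟨L, c, rfl⟩ := hP
  refine ⟨_, ⟨fun j => L j.succ, fun j => c j.succ, rfl⟩, L 0, c 0, ?_⟩
  ext X
  simp only [Fin.forall_fin_succ, Set.mem_ofPred_eq, Set.mem_inter_iff]
  exact and_comm

theorem inter_halfPlane_eq_preimage {χ : ℝ × ℝ → ℝ × ℝ} {T : ℝ × ℝ →ₗ[ℝ] ℝ × ℝ} {w : ℝ × ℝ}
    (hT : ∀ X, T (χ X) + w = X) {L : ℝ × ℝ →ₗ[ℝ] ℝ} {c k : ℝ} (hk : 0 < k)
    (hL : ∀ X, L X - c = k * (χ X).1) (Q : Set (ℝ × ℝ)) :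
    Q ∩ {X | c ≤ L X} = χ ⁻¹' (((fun X => T X + w) ⁻¹' Q) ∩ {X | 0 ≤ X.1}) := by
  ext X
  simp only [Set.mem_inter_iff, Set.mem_preimage, hT, Set.mem_ofPred_eq]
  refine and_congr_right fun _ => ?_
  rw [← sub_nonneg, hL]
  exact mul_nonneg_iff_of_pos_left hk

/-- One more side changes the bound `M` into `nextBound M`. -/
theorem formBound_polygons_succ {N : ℕ} {M : ℝ} (hM : 0 ≤ M)
    (h : ∀ P ∈ polygons N, FormBound (indicatorSymbol P) M) {P : Set (ℝ × ℝ)}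
    (hP : P ∈ polygons (N + 1)) : FormBound (indicatorSymbol P) (nextBound M) := by
  obtain ⟨Q, hQ, L, c, rfl⟩ := polygons_succ hP
  -- A zero form imposes either no condition or an impossible one.
  by_cases hL : L = 0
  · subst hL
    by_cases hc : c ≤ 0
    · have : Q ∩ {X : ℝ × ℝ | c ≤ (0 : ℝ × ℝ →ₗ[ℝ] ℝ) X} = Q := by ext; simp [hc]
      rw [this]
      exact (h Q hQ).mono (le_nextBound M)
    · have : Q ∩ {X : ℝ × ℝ | c ≤ (0 : ℝ × ℝ →ₗ[ℝ] ℝ) X} = ∅ := by ext; simp [hc]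
      rw [this]
      exact formBound_empty (nextBound_nonneg M)
  · obtain ⟨χ, ⟨h1, T, w, hT⟩, k, hk, h2⟩ := exists_affineImplemented_halfPlane hL c
    have hQ' := preimage_mem_polygons hQ T w
    have hm := measurableSet_of_mem_polygons hQ'
    rw [inter_halfPlane_eq_preimage hT hk h2, indicatorSymbol_preimage]
    exact (FormBound.inter_halfPlane (convex_of_mem_polygons hQ') hm hM (h _ hQ')).comp
      (unitSymbol_indicator (hm.inter (measurableSet_le measurable_const measurable_fst))) h1

theorem formBound_polygons_zero {P : Set (ℝ × ℝ)} (hP : P ∈ polygons 0) :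
    FormBound (indicatorSymbol P) 1 := by
  rw [polygons_zero hP, ← Set.preimage_univ (f := Prod.fst)]
  exact formBound_fst MeasurableSet.univ

/-- The induction starts at N = 0 with the whole plane, whose quantization is the identity. -/
theorem exists_formBound_polygons (N : ℕ) :
    ∃ M, 0 ≤ M ∧ ∀ P ∈ polygons N, FormBound (indicatorSymbol P) M := by
  induction N with
  | zero => exact ⟨1, zero_le_one, fun P hP => formBound_polygons_zero hP⟩
  | succ N ih =>
    obtain ⟨M, hM, h⟩ := ih
    exact ⟨nextBound M, nextBound_nonneg M, fun P hP => formBound_polygons_succ hM h hP⟩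

theorem exists_weyl_polygon {N : ℕ} {P : Set (ℝ × ℝ)} (hP : P ∈ polygons N) :
    ∃ A : L2R →L[ℂ] L2R, IsWeylQuantization (indicatorSymbol P) A := by
  obtain ⟨M, hM, h⟩ := exists_formBound_polygons N
  exact (h P hP).exists_operator (unitSymbol_indicator (measurableSet_of_mem_polygons hP)) hM

theorem le_of_mem_polygonNorms {N : ℕ} {M : ℝ} (hM : 0 ≤ M)
    (h : ∀ P ∈ polygons N, FormBound (indicatorSymbol P) M) {r : ℝ} (hr : r ∈ polygonNorms N) :
    r ≤ M := by
  obtain ⟨P, hP, A, hA, rfl⟩ := hr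
  exact hA.norm_le hM (h P hP)

theorem bddAbove_polygonNorms (N : ℕ) : BddAbove (polygonNorms N) := by
  obtain ⟨M, hM, h⟩ := exists_formBound_polygons N
  exact ⟨M, fun r hr => le_of_mem_polygonNorms hM h hr⟩

theorem polygons_nonempty (N : ℕ) : (polygons N).Nonempty := ⟨_, 0, 0, rfl⟩

theorem polygonNorms_nonempty (N : ℕ) : (polygonNorms N).Nonempty := by
  obtain ⟨P, hP⟩ := polygons_nonempty N
  obtain ⟨A, hA⟩ := exists_weyl_polygon hP
  exact ⟨_, P, hP, A, hA, rfl⟩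

theorem muPlus_nonneg (N : ℕ) : 0 ≤ muPlus N := by
  refine Real.sSup_nonneg fun r hr => ?_
  obtain ⟨P, hP, A, hA, rfl⟩ := hr
  exact norm_nonneg A

theorem norm_le_muPlus {N : ℕ} {P : Set (ℝ × ℝ)} (hP : P ∈ polygons N) {A : L2R →L[ℂ] L2R}
    (hA : IsWeylQuantization (indicatorSymbol P) A) : ‖A‖ ≤ muPlus N :=
  le_csSup (bddAbove_polygonNorms N) ⟨P, hP, A, hA, rfl⟩

/-- Lets the recursion run with the supremum itself in place of an arbitrary common bound. -/
theorem formBound_muPlus {N : ℕ} {P : Set (ℝ × ℝ)} (hP : P ∈ polygons N) :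
    FormBound (indicatorSymbol P) (muPlus N) := by
  obtain ⟨A, hA⟩ := exists_weyl_polygon hP
  exact hA.formBound.mono (norm_le_muPlus hP hA)

theorem muPlus_succ_le (N : ℕ) : muPlus (N + 1) ≤ nextBound (muPlus N) :=
  csSup_le (polygonNorms_nonempty _) fun _ hr => le_of_mem_polygonNorms (nextBound_nonneg _)
    (fun _ hP => formBound_polygons_succ (muPlus_nonneg N) (fun _ hQ => formBound_muPlus hQ) hP) hr

theorem quarterPlane_mem_polygons : quarterPlane ∈ polygons 2 := by
  refine ⟨![LinearMap.fst ℝ ℝ ℝ, LinearMap.snd ℝ ℝ ℝ], 0, ?_⟩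
  ext X
  simp [quarterPlane, Fin.forall_fin_two]

theorem measurableSet_quarterPlane : MeasurableSet quarterPlane :=
  measurableSet_of_mem_polygons quarterPlane_mem_polygons

/-- Among the convex polygons with two sides, the quarter plane has the largest norm, as soon as
this norm is at least one. -/
theorem formBound_polygons_two {M : ℝ} (hM : 1 ≤ M) (h : FormBound (indicatorSymbol quarterPlane) M)
    {P : Set (ℝ × ℝ)} (hP : P ∈ polygons 2) : FormBound (indicatorSymbol P) M := by
  have hqm := unitSymbol_indicator measurableSet_quarterPlane
  obtain ⟨Q, hQ, L, c, rfl⟩ := polygons_succ hP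
  -- After normalising one side to x ≥ 0, the other is αx + βξ ≥ c. If β ≠ 0 a shear with a shift
  -- straightens it to the ξ-axis direction; no dilation is needed, since division by |β| does not
  -- change the inequality. If β = 0 the set depends on x alone.
  have key : ∀ Q ∈ polygons 1, FormBound (indicatorSymbol (Q ∩ {X | 0 ≤ X.1})) M := by
    intro Q hQ
    obtain ⟨R, hR, L, c, rfl⟩ := polygons_succ hQ
    rw [polygons_zero hR, Set.univ_inter]
    set α := L (1, 0)
    set β := L (0, 1)
    have hL : ∀ X, L X = α * X.1 + β * X.2 := linearForm_apply L
    rcases lt_trichotomy β 0 with hβ | hβ | hβ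
    -- For β < 0 the sheared cone is the fourth quadrant, which a quarter turn brings to the first.
    · have e : {X | c ≤ L X} ∩ {X | 0 ≤ X.1} = ((fun X : ℝ × ℝ => (-X.2, X.1)) ∘
          fun X : ℝ × ℝ => (X.1, X.2 + (α / β * X.1 + -(c / β)))) ⁻¹' quarterPlane := by
        ext X
        simp only [Set.mem_inter_iff, Set.mem_ofPred_eq, hL, quarterPlane, Function.comp_apply,
          Set.mem_preimage]
        refine and_congr_left fun _ => ?_
        have hβ' : β ≠ 0 := hβ.ne
        have : α * X.1 + β * X.2 - c = -β * -(X.2 + (α / β * X.1 + -(c / β))) := by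
          field_simp
          ring
        rw [← sub_nonneg, this]
        exact mul_nonneg_iff_of_pos_left (by linarith)
      rw [e, indicatorSymbol_preimage]
      exact h.comp hqm (implemented_rotation.comp (implemented_shear _ _))
    · have e : {X | c ≤ L X} ∩ {X | 0 ≤ X.1} = Prod.fst ⁻¹' {x : ℝ | c ≤ α * x ∧ 0 ≤ x} := by
        ext X
        simp [hL, hβ]
      rw [e]
      refine (formBound_fst ?_).mono hM
      exact (measurableSet_le measurable_const (measurable_const_mul α)).inter
        (measurableSet_le measurable_const measurable_id)
    · have e : {X | c ≤ L X} ∩ {X | 0 ≤ X.1} =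
          (fun X : ℝ × ℝ => (X.1, X.2 + (α / β * X.1 + -(c / β)))) ⁻¹' quarterPlane := by
        ext X
        simp only [Set.mem_inter_iff, Set.mem_ofPred_eq, hL, quarterPlane, Set.mem_preimage]
        rw [and_comm]
        refine and_congr_right fun _ => ?_
        have hβ' : β ≠ 0 := hβ.ne'
        have : α * X.1 + β * X.2 - c = β * (X.2 + (α / β * X.1 + -(c / β))) := by
          field_simp
          ring
        rw [← sub_nonneg, this]
        exact mul_nonneg_iff_of_pos_left hβ
      rw [e, indicatorSymbol_preimage]
      exact h.comp hqm (implemented_shear _ _)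
  have hmeas : ∀ Q ∈ polygons 1, UnitSymbol (indicatorSymbol (Q ∩ {X : ℝ × ℝ | 0 ≤ X.1})) :=
    fun Q hQ => unitSymbol_indicator ((measurableSet_of_mem_polygons hQ).inter
      (measurableSet_le measurable_const measurable_fst))
  by_cases hL : L = 0
  · subst hL
    by_cases hc : c ≤ 0
    · have e : Q ∩ {X : ℝ × ℝ | c ≤ (0 : ℝ × ℝ →ₗ[ℝ] ℝ) X} = Q := by ext; simp [hc]
      rw [e]
      obtain ⟨R, hR, L, c, rfl⟩ := polygons_succ hQ
      rw [polygons_zero hR, Set.univ_inter]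
      by_cases hL : L = 0
      · subst hL
        by_cases hc : c ≤ 0
        · have e : {X : ℝ × ℝ | c ≤ (0 : ℝ × ℝ →ₗ[ℝ] ℝ) X} = Set.univ := by ext; simp [hc]
          rw [e]
          exact (formBound_polygons_zero (by rwa [← polygons_zero hR])).mono hM
        · have e : {X : ℝ × ℝ | c ≤ (0 : ℝ × ℝ →ₗ[ℝ] ℝ) X} = ∅ := by ext; simp [hc]
          rw [e]
          exact formBound_empty (by linarith)
      · obtain ⟨χ, ⟨h1, T, w, hT⟩, k, hk, h2⟩ := exists_affineImplemented_halfPlane hL c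
        have hu : (Set.univ : Set (ℝ × ℝ)) ∈ polygons 1 := ⟨0, 0, by ext; simp⟩
        have e := inter_halfPlane_eq_preimage hT hk h2 Set.univ
        rw [Set.univ_inter] at e
        rw [e, indicatorSymbol_preimage]
        exact (key _ (preimage_mem_polygons hu T w)).comp (hmeas _ (preimage_mem_polygons hu T w)) h1
    · have e : Q ∩ {X : ℝ × ℝ | c ≤ (0 : ℝ × ℝ →ₗ[ℝ] ℝ) X} = ∅ := by ext; simp [hc]
      rw [e]
      exact formBound_empty (by linarith)
  · obtain ⟨χ, ⟨h1, T, w, hT⟩, k, hk, h2⟩ := exists_affineImplemented_halfPlane hL c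
    have hQ' := preimage_mem_polygons hQ T w
    rw [inter_halfPlane_eq_preimage hT hk h2, indicatorSymbol_preimage]
    exact (key _ hQ').comp (hmeas _ hQ') h1

/-! ### Explicit integrals: sin/sinh, cos/cosh and sin/cosh -/

theorem norm_cos_le_exp_abs_im (w : ℂ) : ‖Complex.cos w‖ ≤ Real.exp |w.im| := by
  have h1 : ‖Complex.exp (w * I)‖ ≤ Real.exp |w.im| := by
    rw [Complex.norm_exp]
    exact Real.exp_le_exp.2 (by simpa using neg_le_abs w.im)
  have h2 : ‖Complex.exp (-w * I)‖ ≤ Real.exp |w.im| := by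
    rw [Complex.norm_exp]
    exact Real.exp_le_exp.2 (by simpa using le_abs_self w.im)
  rw [Complex.cos, norm_div, Complex.norm_ofNat]
  linarith [norm_add_le (Complex.exp (w * I)) (Complex.exp (-w * I))]

theorem norm_sin_le_mul_exp_abs_im (w : ℂ) : ‖Complex.sin w‖ ≤ ‖w‖ * Real.exp |w.im| := by
  have hd : ∀ r ∈ Set.Icc (0 : ℝ) 1, HasDerivWithinAt (fun r : ℝ => Complex.sin (r * w))
      (Complex.cos (r * w) * w) (Set.Icc 0 1) r := fun r _ => by
    have h := ((hasDerivAt_id (r : ℂ)).mul_const w).csin.comp_ofReal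
    simpa using h.hasDerivWithinAt
  have := norm_image_sub_le_of_norm_deriv_le_segment_01' (C := ‖w‖ * Real.exp |w.im|) hd ?_
  · simpa using this
  · intro r hr
    rw [norm_mul, mul_comm]
    refine mul_le_mul_of_nonneg_left ((norm_cos_le_exp_abs_im _).trans ?_) (norm_nonneg _)
    rw [Real.exp_le_exp, Complex.im_ofReal_mul, abs_mul,
      abs_of_nonneg hr.1]
    exact mul_le_of_le_one_left (abs_nonneg _) hr.2.le

theorem integral_sin_mul_exp {z : ℂ} {c : ℝ} (hc : |z.im| < c) :
    IntegrableOn (fun t : ℝ => Complex.sin (z * t) * Complex.exp (-(c * t : ℝ))) (Set.Ioi 0) ∧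
      ∫ t in Set.Ioi (0 : ℝ), Complex.sin (z * t) * Complex.exp (-(c * t : ℝ)) =
        z / (c ^ 2 + z ^ 2) := by
  have h := abs_lt.1 hc
  have e : (fun t : ℝ => Complex.sin (z * t) * Complex.exp (-(c * t : ℝ))) = fun t : ℝ =>
      (I / 2) * Complex.exp ((-z * I - c) * t) - (I / 2) * Complex.exp ((z * I - c) * t) := by
    ext t
    rw [Complex.sin, show (-z * I - c) * t = -(z * t) * I + -(c * t : ℝ) by push_cast; ring,
      show (z * I - c) * t = (z * t) * I + -(c * t : ℝ) by push_cast; ring, Complex.exp_add,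
      Complex.exp_add]
    ring
  have h1 : (-z * I - c).re < 0 := by simp; linarith
  have h2 : (z * I - c).re < 0 := by simp; linarith
  have i1 := (integrableOn_exp_mul_complex_Ioi h1 0).const_mul (I / 2)
  have i2 := (integrableOn_exp_mul_complex_Ioi h2 0).const_mul (I / 2)
  have n1 : -z * I - c ≠ 0 := fun h => by rw [h] at h1; simp at h1
  have n2 : z * I - c ≠ 0 := fun h => by rw [h] at h2; simp at h2
  rw [e]
  refine ⟨i1.sub i2, ?_⟩
  rw [integral_sub i1 i2, integral_const_mul, integral_const_mul, integral_exp_mul_complex_Ioi h1,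
    integral_exp_mul_complex_Ioi h2]
  have e2 : (c : ℂ) ^ 2 + z ^ 2 = (-z * I - c) * (z * I - c) := by
    linear_combination (z ^ 2) * Complex.I_sq
  rw [e2]
  rw [Complex.ofReal_zero, mul_zero, mul_zero, Complex.exp_zero]
  obtain ⟨A, hA⟩ : ∃ A, A = -z * I - c := ⟨_, rfl⟩
  obtain ⟨B, hB⟩ : ∃ B, B = z * I - c := ⟨_, rfl⟩
  rw [← hA] at n1 ⊢
  rw [← hB] at n2 ⊢
  field_simp
  rw [hA, hB]
  linear_combination (-2 * z) * Complex.I_sq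

/-- Geometric expansion of the weight and termwise Laplace transforms. The estimate |sin w| ≤
|w|e^{|Im w|} puts a factor t in each term, so the terms are O(1/k²) in L¹; the exchange is thus
legitimate even for σ = 1, where the weight is singular at t = 0. -/
theorem hasSum_integral_sin_mul_geometric {z : ℂ} {c d σ : ℝ} (hσ : |σ| = 1) (hd : 0 < d)
    (hc : |z.im| < c) :
    HasSum (fun k : ℕ => (σ : ℂ) ^ k * (z / ((c + d * k : ℝ) ^ 2 + z ^ 2)))
      (∫ t in Set.Ioi (0 : ℝ), Complex.sin (z * t) *
        ((Real.exp (-(c * t)) / (1 - σ * Real.exp (-(d * t))) : ℝ) : ℂ)) := by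
  have hck : ∀ k : ℕ, |z.im| < c + d * k := fun k => hc.trans_le (by nlinarith [k.cast_nonneg (α := ℝ)])
  set F : ℕ → ℝ → ℂ := fun k t =>
    (σ : ℂ) ^ k * (Complex.sin (z * t) * Complex.exp (-((c + d * k : ℝ) * t : ℝ)))
  have hF : ∀ k, IntegrableOn (F k) (Set.Ioi 0) := fun k =>
    (integral_sin_mul_exp (hck k)).1.const_mul _
  set b := c - |z.im|
  have hb : 0 < b := by simp only [b]; linarith
  have hn : ∀ k : ℕ, ∫ t in Set.Ioi (0 : ℝ), ‖F k t‖ ≤ ‖z‖ * (1 / (b + d * k)) ^ (2 : ℝ) := by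
    intro k
    have hbk : 0 < b + d * k := by positivity
    have hi : IntegrableOn (fun t : ℝ => ‖z‖ * (t ^ ((2 : ℝ) - 1) * Real.exp (-((b + d * k) * t))))
        (Set.Ioi 0) := by
      refine Integrable.const_mul ?_ _
      have := Real.integral_rpow_mul_exp_neg_mul_Ioi (a := 2) (by norm_num) hbk
      by_contra hh
      rw [integral_undef hh] at this
      have h3 : 0 < (1 / (b + d * k)) ^ (2 : ℝ) * Real.Gamma 2 :=
        mul_pos (Real.rpow_pos_of_pos (by positivity) _) (Real.Gamma_pos_of_pos (by norm_num))
      linarith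
    have h4 := setIntegral_mono_on (hF k).norm hi measurableSet_Ioi fun t ht => ?_
    · refine h4.trans (le_of_eq ?_)
      rw [integral_const_mul, Real.integral_rpow_mul_exp_neg_mul_Ioi (by norm_num) hbk,
        Real.Gamma_two, mul_one]
    · have ht' : (0 : ℝ) < t := ht
      have h5 : ‖(σ : ℂ) ^ k‖ = 1 := by simp [hσ]
      simp only [F]
      rw [norm_mul, h5, one_mul, norm_mul, Complex.norm_exp]
      have h6 := norm_sin_le_mul_exp_abs_im (z * t)
      rw [Complex.im_mul_ofReal, abs_mul, abs_of_pos ht', norm_mul, Complex.norm_real,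
        Real.norm_of_nonneg ht'.le] at h6
      have h7 : t ^ ((2 : ℝ) - 1) = t := by norm_num
      rw [h7]
      calc _ ≤ (‖z‖ * t * Real.exp (|z.im| * t)) * Real.exp (-((c + d * k) * t)) := by
            refine mul_le_mul h6 (Real.exp_le_exp.2 ?_) (Real.exp_pos _).le (by positivity)
            rw [Complex.neg_re, Complex.ofReal_re]
        _ = ‖z‖ * (t * (Real.exp (|z.im| * t) * Real.exp (-((c + d * k) * t)))) := by ring
        _ = _ := by
            rw [← Real.exp_add]
            congr 3
            simp only [b]; ring
  have hs : Summable fun k : ℕ => ‖z‖ * (1 / (b + d * k)) ^ (2 : ℝ) := by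
    refine Summable.mul_left _ ?_
    have h8 := (Real.summable_one_div_nat_add_rpow (b / d) 2).2 (by norm_num)
    refine (h8.mul_left ((1 / d) ^ (2 : ℝ))).congr fun k => ?_
    rw [abs_of_pos (by positivity), show b + d * k = d * (k + b / d) by field_simp; ring,
      one_div, one_div, one_div, mul_inv, Real.mul_rpow (by positivity) (by positivity),
      Real.inv_rpow (x := (k : ℝ) + b / d) (by positivity)]
  have key := hasSum_integral_of_summable_integral_norm hF
    (hs.of_nonneg_of_le (fun k => integral_nonneg fun _ => norm_nonneg _) hn)
  have e1 : (fun k => ∫ t in Set.Ioi (0 : ℝ), F k t) =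
      fun k : ℕ => (σ : ℂ) ^ k * (z / ((c + d * k : ℝ) ^ 2 + z ^ 2)) := by
    ext k
    rw [integral_const_mul, (integral_sin_mul_exp (hck k)).2]
  rw [e1] at key
  suffices e2 : ∫ t in Set.Ioi (0 : ℝ), Complex.sin (z * t) *
        ((Real.exp (-(c * t)) / (1 - σ * Real.exp (-(d * t))) : ℝ) : ℂ) =
      ∫ t in Set.Ioi (0 : ℝ), ∑' k, F k t by rw [e2]; exact key
  refine setIntegral_congr_fun measurableSet_Ioi fun t ht => ?_
  have ht' : (0 : ℝ) < t := ht
  have h9 : ‖(σ * Real.exp (-(d * t)) : ℝ)‖ < 1 := by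
    rw [norm_mul, Real.norm_eq_abs, hσ, one_mul, Real.norm_of_nonneg (Real.exp_pos _).le,
      Real.exp_lt_one_iff]
    nlinarith
  have h10 := (hasSum_geometric_of_norm_lt_one h9).mul_left (Real.exp (-(c * t)))
  have h11 := (Complex.hasSum_ofReal.2 h10).mul_left (Complex.sin (z * t))
  rw [← div_eq_mul_inv] at h11
  rw [← h11.tsum_eq]
  refine tsum_congr fun k => ?_
  simp only [F]
  rw [mul_pow, ← Real.exp_nat_mul]
  push_cast
  rw [show -((c + d * k) * t : ℂ) = -(c * t) + k * -(d * t) by ring, Complex.exp_add]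
  ring

/-- In the partial fractions of the cotangent at 2y, the terms over even integers are half the
expansion at y. Subtracting them leaves the odd integers. -/
theorem tsum_cotTerm_even {y : ℂ} (hy : y ∈ Complex.integerComplement)
    (hy2 : 2 * y ∈ Complex.integerComplement) :
    HasSum (fun k : ℕ => 1 / (2 * y - (2 * k + 1)) + 1 / (2 * y + (2 * k + 1)))
      (Real.pi * Complex.cot (Real.pi * (2 * y)) - Real.pi / 2 * Complex.cot (Real.pi * y)) := by
  have hy0 : y ≠ 0 := Complex.integerComplement.ne_zero hy
  have s2 := summable_cotTerm hy2
  have se : Summable fun k : ℕ => cotTerm (2 * y) (2 * k) :=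
    s2.comp_injective (mul_right_injective₀ two_ne_zero)
  have so : Summable fun k : ℕ => cotTerm (2 * y) (2 * k + 1) :=
    s2.comp_injective ((add_left_injective 1).comp (mul_right_injective₀ two_ne_zero))
  have h := tsum_even_add_odd se so
  have e1 : ∀ k : ℕ, cotTerm (2 * y) (2 * k + 1) = 1 / 2 * cotTerm y k := fun k => by
    have h1 : y - (k + 1) ≠ 0 := by
      have := Complex.integerComplement_add_ne_zero hy (-(k + 1))
      push_cast at this
      rwa [sub_eq_add_neg]
    have h2 : y + (k + 1) ≠ 0 := by
      have := Complex.integerComplement_add_ne_zero hy (k + 1)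
      push_cast at this
      exact this
    rw [cotTerm, cotTerm]
    push_cast
    rw [show 2 * y - (2 * (k : ℂ) + 1 + 1) = 2 * (y - (k + 1)) by ring,
      show 2 * y + (2 * (k : ℂ) + 1 + 1) = 2 * (y + (k + 1)) by ring]
    field_simp
  have e2 : ∀ k : ℕ, cotTerm (2 * y) (2 * k) = 1 / (2 * y - (2 * k + 1)) + 1 / (2 * y + (2 * k + 1)) :=
    fun k => by rw [cotTerm]; push_cast; rfl
  simp_rw [e1, tsum_mul_left] at h
  have c1 := cot_series_rep' hy
  have c2 := cot_series_rep' hy2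
  have key := se.hasSum
  simp_rw [e2] at key h
  convert key using 1
  have c1' : ∑' k : ℕ, cotTerm y k = Real.pi * Complex.cot (Real.pi * y) - 1 / y := c1.symm
  have c2' : ∑' k : ℕ, cotTerm (2 * y) k =
    Real.pi * Complex.cot (Real.pi * (2 * y)) - 1 / (2 * y) := c2.symm
  rw [c1', c2'] at h
  rw [eq_sub_of_add_eq h]
  field_simp
  ring

/-- With z = η - i/2, sin(zt) = sin(ηt)cosh(t/2) - i cos(ηt)sinh(t/2). Dividing by
sinh(t/2)cosh(t/2) yields both integrands at once, and this weight is a multiple of e^{-t}/(1 -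
e^{-2t}); the resulting series over odd integers is a difference of cotangents. -/
theorem integral_sin_sub_cos (η : ℝ) :
    ∫ t in Set.Ioi (0 : ℝ), (((Real.sin (η * t) / Real.sinh (t / 2) : ℝ) : ℂ) -
      ((Real.cos (η * t) / Real.cosh (t / 2) : ℝ) : ℂ) * I) =
      (Real.pi * Real.tanh (Real.pi * η) : ℝ) - (Real.pi / Real.cosh (Real.pi * η) : ℝ) * I := by
  set z : ℂ := η - I / 2
  have hz : z.im = -(1 / 2) := by simp [z]
  have h := hasSum_integral_sin_mul_geometric (z := z) (c := 1) (d := 2) (σ := 1) (by simp)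
    (by norm_num) (by rw [hz]; norm_num [abs_of_pos])
  set y : ℂ := I * z / 2
  have hre : (2 * y).re = 1 / 2 := by simp [y, z]; norm_num
  have hy2 : 2 * y ∈ Complex.integerComplement := by
    rintro ⟨n, hn⟩
    rw [← hn, Complex.intCast_re] at hre
    have : (2 * n : ℝ) = 1 := by linarith
    norm_cast at this
    omega
  have hy : y ∈ Complex.integerComplement := by
    rintro ⟨n, hn⟩
    exact hy2 ⟨2 * n, by rw [← hn]; push_cast; ring⟩
  have h2 := (tsum_cotTerm_even hy hy2).mul_left (I / 2)
  have e : ∀ k : ℕ, ((1 : ℝ) : ℂ) ^ k * (z / ((1 + 2 * k : ℝ) ^ 2 + z ^ 2)) =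
      I / 2 * (1 / (2 * y - (2 * k + 1)) + 1 / (2 * y + (2 * k + 1))) := fun k => by
    have n1 : 2 * y - (2 * k + 1) ≠ 0 := by
      have := Complex.integerComplement_add_ne_zero hy2 (-(2 * k + 1))
      push_cast at this
      rwa [sub_eq_add_neg]
    have n2 : 2 * y + (2 * k + 1) ≠ 0 := by
      have := Complex.integerComplement_add_ne_zero hy2 (2 * k + 1)
      push_cast at this
      exact this
    have e3 : ((1 + 2 * k : ℝ) : ℂ) ^ 2 + z ^ 2 = -((2 * y - (2 * k + 1)) * (2 * y + (2 * k + 1))) := by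
      simp only [y]
      push_cast
      linear_combination (z ^ 2) * Complex.I_sq
    rw [e3, Complex.ofReal_one, one_pow, one_mul]
    obtain ⟨A, hA⟩ : ∃ A, A = 2 * y - (2 * k + 1) := ⟨_, rfl⟩
    obtain ⟨B, hB⟩ : ∃ B, B = 2 * y + (2 * k + 1) := ⟨_, rfl⟩
    rw [← hA] at n1 ⊢
    rw [← hB] at n2 ⊢
    field_simp
    rw [hA, hB]
    simp only [y]
    linear_combination (-2 * z) * Complex.I_sq
  simp_rw [e] at h
  have h3 := h.unique h2
  have hch : Complex.cosh (Real.pi * η) ≠ 0 := by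
    have := (Real.cosh_pos (Real.pi * η)).ne'
    exact_mod_cast this
  have hcot : Real.pi * Complex.cot (Real.pi * (2 * y)) - Real.pi / 2 * Complex.cot (Real.pi * y) =
      -(Real.pi / 2) * (1 + Complex.sinh (Real.pi * η) * I) / Complex.cosh (Real.pi * η) := by
    set x : ℂ := (Real.pi * η : ℂ) * I / 2
    have a1 : Real.pi * (2 * y) = 2 * x + (Real.pi / 2 : ℂ) := by
      simp only [x, y, z]; linear_combination (-(Real.pi : ℂ) / 2) * Complex.I_sq
    have a2 : Real.pi * y = x + (Real.pi / 4 : ℂ) := by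
      simp only [x, y, z]; linear_combination (-(Real.pi : ℂ) / 4) * Complex.I_sq
    have a3 : Complex.cos (2 * x) = Complex.cosh (Real.pi * η) := by
      rw [← Complex.cos_mul_I]; simp only [x]; congr 1; ring
    have a4 : Complex.sin (2 * x) = Complex.sinh (Real.pi * η) * I := by
      rw [← Complex.sin_mul_I]; simp only [x]; congr 1; ring
    rw [← a3] at hch ⊢
    rw [← a4, a1, a2, Complex.cot_eq_cos_div_sin, Complex.cot_eq_cos_div_sin,
      Complex.cos_add_pi_div_two, Complex.sin_add_pi_div_two, Complex.cos_add, Complex.sin_add]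
    have b1 : Complex.cos (Real.pi / 4 : ℂ) = ((√2 / 2 : ℝ) : ℂ) := by
      rw [← Real.cos_pi_div_four]; push_cast; rfl
    have b2 : Complex.sin (Real.pi / 4 : ℂ) = ((√2 / 2 : ℝ) : ℂ) := by
      rw [← Real.sin_pi_div_four]; push_cast; rfl
    have b3 : ((√2 / 2 : ℝ) : ℂ) ≠ 0 := by
      exact_mod_cast (by positivity : (√2 / 2 : ℝ) ≠ 0)
    -- The equal values of sine and cosine at π/4 cancel, and cos 2x = (cos x - sin x)(cos x + sin
    -- x) supplies a common denominator.
    rw [b1, b2, ← sub_mul, ← add_mul, mul_div_mul_right _ _ b3]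
    have b4 : Complex.cos (2 * x) =
        (Complex.cos x - Complex.sin x) * (Complex.sin x + Complex.cos x) := by
      rw [Complex.cos_two_mul']; ring
    rw [b4] at hch ⊢
    have n1 := (mul_ne_zero_iff.1 hch).1
    have n2 := (mul_ne_zero_iff.1 hch).2
    rw [Complex.sin_two_mul]
    field_simp
    linear_combination (-1 : ℂ) * (Complex.sin_sq_add_cos_sq x)
  rw [hcot] at h3
  have e4 : ∫ t in Set.Ioi (0 : ℝ), (((Real.sin (η * t) / Real.sinh (t / 2) : ℝ) : ℂ) -
      ((Real.cos (η * t) / Real.cosh (t / 2) : ℝ) : ℂ) * I) =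
      4 * ∫ t in Set.Ioi (0 : ℝ), Complex.sin (z * t) *
        ((Real.exp (-(1 * t)) / (1 - 1 * Real.exp (-(2 * t))) : ℝ) : ℂ) := by
    rw [← integral_const_mul]
    refine setIntegral_congr_fun measurableSet_Ioi fun t ht => ?_
    have ht' : (0 : ℝ) < t / 2 := half_pos ht
    have c1 : Real.exp (-(1 * t)) / (1 - 1 * Real.exp (-(2 * t))) =
        1 / (4 * (Real.sinh (t / 2) * Real.cosh (t / 2))) := by
      have : Real.sinh t = 2 * Real.sinh (t / 2) * Real.cosh (t / 2) := by
        rw [← Real.sinh_two_mul]; congr 1; ring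
      have h5 : 4 * (Real.sinh (t / 2) * Real.cosh (t / 2)) = Real.exp t - Real.exp (-t) := by
        rw [Real.sinh_eq t] at this; linarith
      rw [h5, show -(2 * t) = -t + -t by ring, Real.exp_add, one_mul, one_mul]
      have h6 : Real.exp t * Real.exp (-t) = 1 := by rw [← Real.exp_add]; simp
      have h7 : Real.exp (-t) < 1 := Real.exp_lt_one_iff.2 (by linarith)
      have h8 : 1 < Real.exp t := Real.one_lt_exp_iff.2 (by linarith)
      have h9 := Real.exp_pos (-t)
      rw [div_eq_div_iff (by nlinarith) (by linarith)]
      linear_combination h6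
    have c2 : Complex.sin (z * t) = Complex.sin (η * t) * Complex.cosh (t / 2) -
        Complex.cos (η * t) * Complex.sinh (t / 2) * I := by
      rw [show z * t = η * t - (t / 2) * I by simp only [z]; ring, Complex.sin_sub,
        Complex.cos_mul_I, Complex.sin_mul_I]
      ring
    have n1 : Complex.sinh (t / 2) ≠ 0 := by
      exact_mod_cast (Real.sinh_pos_iff.2 ht').ne'
    have n2 : Complex.cosh (t / 2) ≠ 0 := by
      exact_mod_cast (Real.cosh_pos (t / 2)).ne'
    rw [c1, c2]
    push_cast
    field_simp
  rw [e4, h3, Real.tanh_eq_sinh_div_cosh]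
  push_cast
  field_simp
  linear_combination (-4 * Complex.sinh (Real.pi * η)) * Complex.I_sq

theorem inv_cosh_half_le (t : ℝ) : 1 / Real.cosh (t / 2) ≤ 2 * Real.exp (-(1 / 2 * t)) := by
  rw [div_le_iff₀ (Real.cosh_pos _), Real.cosh_eq]
  have h : Real.exp (-(1 / 2 * t)) * Real.exp (t / 2) = 1 := by
    rw [← Real.exp_add]; simp; ring
  nlinarith [Real.exp_pos (-(1 / 2 * t)), Real.exp_pos (-(t / 2))]

theorem div_sinh_half_le {t : ℝ} (ht : 0 < t) :
    t / Real.sinh (t / 2) ≤ 4 * Real.exp (-(1 / 4 * t)) := by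
  rw [div_le_iff₀ (Real.sinh_pos_iff.2 (by linarith)), show t / 2 = 2 * (t / 4) by ring,
    Real.sinh_two_mul]
  have h : Real.exp (-(1 / 4 * t)) * Real.exp (t / 4) = 1 := by
    rw [← Real.exp_add]; simp; ring
  have h1 : t / 4 ≤ Real.sinh (t / 4) := Real.self_le_sinh_iff.2 (by linarith)
  have h2 : Real.exp (t / 4) / 2 ≤ Real.cosh (t / 4) := by
    rw [Real.cosh_eq]; linarith [Real.exp_pos (-(t / 4))]
  have h3 : t / 4 * (Real.exp (t / 4) / 2) ≤ Real.sinh (t / 4) * Real.cosh (t / 4) :=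
    mul_le_mul h1 h2 (by positivity) (by linarith)
  nlinarith [Real.exp_pos (-(1 / 4 * t))]

theorem integrableOn_inv_cosh_half :
    IntegrableOn (fun t : ℝ => 1 / Real.cosh (t / 2)) (Set.Ioi 0) := by
  refine Integrable.mono' ((integrableOn_exp_mul_Ioi (a := -(1 / 2)) (by norm_num) 0).const_mul 2)
    (Continuous.aestronglyMeasurable ?_) (ae_of_all _ fun t => ?_)
  · exact continuous_const.div (by fun_prop) fun t => (Real.cosh_pos _).ne'
  · rw [Real.norm_of_nonneg (one_div_nonneg.2 (Real.cosh_pos _).le), neg_mul]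
    exact inv_cosh_half_le t

theorem integrableOn_div_sinh_half :
    IntegrableOn (fun t : ℝ => t / Real.sinh (t / 2)) (Set.Ioi 0) := by
  refine Integrable.mono' ((integrableOn_exp_mul_Ioi (a := -(1 / 4)) (by norm_num) 0).const_mul 4)
    (Measurable.aestronglyMeasurable (by fun_prop)) ?_
  filter_upwards [ae_restrict_mem measurableSet_Ioi] with t ht
  have ht' : (0 : ℝ) < t := ht
  rw [Real.norm_of_nonneg (div_nonneg ht'.le (Real.sinh_nonneg_iff.2 (by linarith))), neg_mul]
  exact div_sinh_half_le ht'

theorem integrableOn_cos_div_cosh (η : ℝ) :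
    IntegrableOn (fun t : ℝ => Real.cos (η * t) / Real.cosh (t / 2)) (Set.Ioi 0) := by
  refine Integrable.mono' integrableOn_inv_cosh_half (Measurable.aestronglyMeasurable (by fun_prop))
    (ae_of_all _ fun t => ?_)
  rw [norm_div, Real.norm_of_nonneg (Real.cosh_pos _).le]
  exact div_le_div_of_nonneg_right (Real.abs_cos_le_one _) (Real.cosh_pos _).le

theorem integrableOn_sin_div_cosh (η : ℝ) :
    IntegrableOn (fun t : ℝ => Real.sin (η * t) / Real.cosh (t / 2)) (Set.Ioi 0) := by
  refine Integrable.mono' integrableOn_inv_cosh_half (Measurable.aestronglyMeasurable (by fun_prop))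
    (ae_of_all _ fun t => ?_)
  rw [norm_div, Real.norm_of_nonneg (Real.cosh_pos _).le]
  exact div_le_div_of_nonneg_right (Real.abs_sin_le_one _) (Real.cosh_pos _).le

theorem integrableOn_sin_div_sinh (η : ℝ) :
    IntegrableOn (fun t : ℝ => Real.sin (η * t) / Real.sinh (t / 2)) (Set.Ioi 0) := by
  refine Integrable.mono' (integrableOn_div_sinh_half.const_mul |η|)
    (Measurable.aestronglyMeasurable (by fun_prop)) ?_
  filter_upwards [ae_restrict_mem measurableSet_Ioi] with t ht
  have ht' : (0 : ℝ) < t := ht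
  have h := Real.sinh_pos_iff.2 (half_pos ht')
  rw [norm_div, Real.norm_of_nonneg h.le, ← mul_div_assoc]
  refine div_le_div_of_nonneg_right ?_ h.le
  simpa [abs_mul, abs_of_pos ht'] using Real.abs_sin_le_abs (x := η * t)

theorem integral_sin_div_sinh (η : ℝ) :
    ∫ t in Set.Ioi (0 : ℝ), Real.sin (η * t) / Real.sinh (t / 2) =
      Real.pi * Real.tanh (Real.pi * η) := by
  have h := congrArg Complex.re (integral_sin_sub_cos η)
  have h1 : IntegrableOn (fun t : ℝ => ((Real.sin (η * t) / Real.sinh (t / 2) : ℝ) : ℂ))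
    (Set.Ioi 0) := (integrableOn_sin_div_sinh η).ofReal
  have h2 : IntegrableOn (fun t : ℝ => ((Real.cos (η * t) / Real.cosh (t / 2) : ℝ) : ℂ))
    (Set.Ioi 0) := (integrableOn_cos_div_cosh η).ofReal
  rw [integral_sub h1 (h2.mul_const I), integral_mul_const, integral_complex_ofReal,
    integral_complex_ofReal] at h
  simpa only [Complex.sub_re, Complex.ofReal_re, Complex.re_ofReal_mul, Complex.I_re, mul_zero,
    sub_zero] using h

theorem integral_cos_div_cosh (η : ℝ) :
    ∫ t in Set.Ioi (0 : ℝ), Real.cos (η * t) / Real.cosh (t / 2) =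
      Real.pi / Real.cosh (Real.pi * η) := by
  have h := congrArg Complex.im (integral_sin_sub_cos η)
  have h1 : IntegrableOn (fun t : ℝ => ((Real.sin (η * t) / Real.sinh (t / 2) : ℝ) : ℂ))
    (Set.Ioi 0) := (integrableOn_sin_div_sinh η).ofReal
  have h2 : IntegrableOn (fun t : ℝ => ((Real.cos (η * t) / Real.cosh (t / 2) : ℝ) : ℂ))
    (Set.Ioi 0) := (integrableOn_cos_div_cosh η).ofReal
  rw [integral_sub h1 (h2.mul_const I), integral_mul_const, integral_complex_ofReal,
    integral_complex_ofReal] at h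
  simpa only [Complex.sub_im, Complex.ofReal_im, Complex.im_ofReal_mul, Complex.I_im, mul_one,
    zero_sub, neg_inj] using h

/-- Here 1/cosh(t/2) = 2e^{-t/2}/(1 + e^{-t}). The alternating series is only used for bounds. -/
theorem hasSum_integral_sin_div_cosh (η : ℝ) :
    HasSum (fun k : ℕ => (-1 : ℝ) ^ k * (2 * η / ((1 / 2 + k) ^ 2 + η ^ 2)))
      (∫ t in Set.Ioi (0 : ℝ), Real.sin (η * t) / Real.cosh (t / 2)) := by
  have h := (hasSum_integral_sin_mul_geometric (z := η) (c := 1 / 2) (d := 1) (σ := -1) (by simp)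
    one_pos (by simp)).mul_left 2
  rw [← Complex.hasSum_ofReal]
  have e1 : (fun k : ℕ => (((-1 : ℝ) ^ k * (2 * η / ((1 / 2 + k) ^ 2 + η ^ 2)) : ℝ) : ℂ)) =
      fun k : ℕ => 2 * (((-1 : ℝ) : ℂ) ^ k * (η / ((1 / 2 + 1 * k : ℝ) ^ 2 + η ^ 2))) := by
    ext k
    push_cast
    ring
  rw [e1]
  suffices e2 : ((∫ t in Set.Ioi (0 : ℝ), Real.sin (η * t) / Real.cosh (t / 2) : ℝ) : ℂ) =
      2 * ∫ t in Set.Ioi (0 : ℝ), Complex.sin (η * t) *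
        ((Real.exp (-(1 / 2 * t)) / (1 - -1 * Real.exp (-(1 * t))) : ℝ) : ℂ) by
    rw [e2]; exact h
  · rw [← integral_const_mul, ← integral_complex_ofReal]
    refine integral_congr_ae (ae_of_all _ fun t => ?_)
    dsimp only
    have e : 2 * (Real.exp (-(1 / 2 * t)) / (1 - -1 * Real.exp (-(1 * t)))) =
        1 / Real.cosh (t / 2) := by
      have h1 := Real.exp_pos (-t)
      have h2 : Real.exp (-(1 / 2 * t)) * Real.exp (t / 2) = 1 := by
        rw [← Real.exp_add]; simp; ring
      have h3 : Real.exp (-(1 / 2 * t)) * Real.exp (-(t / 2)) = Real.exp (-t) := by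
        rw [← Real.exp_add]; ring_nf
      rw [one_mul, ← mul_div_assoc, div_eq_div_iff (by linarith) (Real.cosh_pos _).ne',
        Real.cosh_eq]
      linear_combination h2 + h3
    rw [div_eq_mul_one_div, ← e]
    push_cast
    ring

/-- The alternating series has decreasing terms, so its partial sums after one and two terms enclose
the value. -/
theorem integral_sin_div_cosh_bounds {η : ℝ} (hη : 0 ≤ η) :
    2 * η / (1 / 4 + η ^ 2) - 2 * η / (9 / 4 + η ^ 2) ≤
        ∫ t in Set.Ioi (0 : ℝ), Real.sin (η * t) / Real.cosh (t / 2) ∧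
      ∫ t in Set.Ioi (0 : ℝ), Real.sin (η * t) / Real.cosh (t / 2) ≤ 2 * η / (1 / 4 + η ^ 2) := by
  have h := (hasSum_integral_sin_div_cosh η).tendsto_sum_nat
  have ha : Antitone fun k : ℕ => 2 * η / ((1 / 2 + (k : ℝ)) ^ 2 + η ^ 2) := by
    intro j k hjk
    have : (j : ℝ) ≤ k := by exact_mod_cast hjk
    dsimp only
    gcongr
  have h1 := ha.alternating_series_le_tendsto h 1
  have h2 := ha.tendsto_le_alternating_series h 0
  norm_num [Finset.sum_range_succ] at h1 h2
  constructor
  · norm_num; linarith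
  · norm_num; linarith

/-! ### Eigenvalues of the quarter-plane matrix -/

/-- The upper left entry of the matrix `M₀(τ)`. -/
noncomputable def quarterDiag (τ : ℝ) : ℝ :=
  1 / 2 + 1 / (2 * Real.pi) *
    ∫ t in Set.Ioi (0 : ℝ), Real.sin (2 * Real.pi * t * τ) / Real.sinh (t / 2)

/-- The largest eigenvalue of the matrix `M₀(τ)`. -/
noncomputable def quarterTop (τ : ℝ) : ℝ :=
  (quarterDiag τ + √(quarterDiag τ ^ 2 + 4 * ‖quarterOffDiag τ‖ ^ 2)) / 2

theorem quarterDiag_eq (τ : ℝ) :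
    quarterDiag τ = (1 + Real.tanh (Real.pi * (2 * Real.pi * τ))) / 2 := by
  have h : ∀ t : ℝ, 2 * Real.pi * t * τ = 2 * Real.pi * τ * t := fun t => by ring
  rw [quarterDiag]
  simp_rw [h]
  rw [integral_sin_div_sinh]
  have := Real.pi_ne_zero
  field_simp

theorem quarterDiag_eq_one_sub (τ : ℝ) :
    quarterDiag τ = 1 - 1 / (1 + Real.exp (2 * Real.pi * (2 * Real.pi * τ))) := by
  rw [quarterDiag_eq, Real.tanh_eq]
  set x := Real.pi * (2 * Real.pi * τ)
  have h1 : 2 * Real.pi * (2 * Real.pi * τ) = x + x := by simp only [x]; ring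
  have h2 : Real.exp x * Real.exp (-x) = 1 := by rw [← Real.exp_add]; simp
  have h3 := Real.exp_pos x
  have h4 := Real.exp_pos (-x)
  rw [h1, Real.exp_add]
  field_simp
  linear_combination (-2 : ℝ) * Real.exp x * h2

theorem quarterOffDiag_eq (τ : ℝ) :
    quarterOffDiag τ = (((∫ t in Set.Ioi (0 : ℝ),
      Real.sin (2 * Real.pi * τ * t) / Real.cosh (t / 2) : ℝ) : ℂ) +
        (Real.pi / Real.cosh (Real.pi * (2 * Real.pi * τ)) : ℝ) * I) / (4 * Real.pi) := by
  have h1 : IntegrableOn (fun t : ℝ => ((Real.sin (2 * Real.pi * τ * t) / Real.cosh (t / 2) : ℝ) : ℂ))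
    (Set.Ioi 0) := (integrableOn_sin_div_cosh _).ofReal
  have h2 : IntegrableOn (fun t : ℝ => ((Real.cos (2 * Real.pi * τ * t) / Real.cosh (t / 2) : ℝ) : ℂ))
    (Set.Ioi 0) := (integrableOn_cos_div_cosh _).ofReal
  have e : ∀ t : ℝ, Complex.exp (-(2 * Real.pi * t * τ : ℝ) * I) / (Real.cosh (t / 2) : ℂ) =
      ((Real.cos (2 * Real.pi * τ * t) / Real.cosh (t / 2) : ℝ) : ℂ) -
      ((Real.sin (2 * Real.pi * τ * t) / Real.cosh (t / 2) : ℝ) : ℂ) * I := fun t => by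
    rw [Complex.exp_mul_I, Complex.cos_neg, Complex.sin_neg,
      show 2 * Real.pi * t * τ = 2 * Real.pi * τ * t by ring]
    push_cast
    ring
  rw [quarterOffDiag]
  simp_rw [e]
  rw [integral_sub h2 (h1.mul_const I), integral_mul_const, integral_complex_ofReal,
    integral_complex_ofReal, integral_cos_div_cosh]
  push_cast
  rw [div_mul_eq_mul_div]
  congr 1
  linear_combination (-((∫ t in Set.Ioi (0 : ℝ),
    Real.sin (2 * Real.pi * τ * t) / Real.cosh (t / 2) : ℝ) : ℂ)) * Complex.I_sq

theorem norm_quarterOffDiag_sq (τ : ℝ) :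
    ‖quarterOffDiag τ‖ ^ 2 = ((∫ t in Set.Ioi (0 : ℝ),
      Real.sin (2 * Real.pi * τ * t) / Real.cosh (t / 2)) ^ 2 +
        (Real.pi / Real.cosh (Real.pi * (2 * Real.pi * τ))) ^ 2) / (4 * Real.pi) ^ 2 := by
  rw [quarterOffDiag_eq, norm_div, div_pow, ← Complex.normSq_eq_norm_sq, Complex.normSq_add_mul_I]
  congr 2
  rw [show (4 * Real.pi : ℂ) = ((4 * Real.pi : ℝ) : ℂ) by push_cast; rfl, Complex.norm_real,
    Real.norm_of_nonneg (by positivity)]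

theorem abs_integral_sin_div_cosh_le {η b : ℝ} (hb : 2 * |η| ≤ b * (1 / 4 + η ^ 2)) :
    |∫ t in Set.Ioi (0 : ℝ), Real.sin (η * t) / Real.cosh (t / 2)| ≤ b := by
  have key : ∀ η : ℝ, 0 ≤ η → 2 * η ≤ b * (1 / 4 + η ^ 2) →
      |∫ t in Set.Ioi (0 : ℝ), Real.sin (η * t) / Real.cosh (t / 2)| ≤ b := by
    intro η h0 hη
    obtain ⟨h1, h2⟩ := integral_sin_div_cosh_bounds h0
    have h3 : 0 ≤ 2 * η / (1 / 4 + η ^ 2) - 2 * η / (9 / 4 + η ^ 2) := by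
      rw [sub_nonneg]
      gcongr
      norm_num
    rw [abs_of_nonneg (h3.trans h1)]
    exact h2.trans ((div_le_iff₀ (by positivity)).2 hη)
  rcases le_total 0 η with h | h
  · exact key η h (by rwa [abs_of_nonneg h] at hb)
  · have := key (-η) (by linarith) (by rwa [abs_of_nonpos h, ← neg_sq] at hb)
    simpa [neg_mul, Real.sin_neg, neg_div, integral_neg] using this

theorem abs_integral_sin_div_cosh_le_two (η : ℝ) :
    |∫ t in Set.Ioi (0 : ℝ), Real.sin (η * t) / Real.cosh (t / 2)| ≤ 2 :=
  abs_integral_sin_div_cosh_le (by nlinarith [sq_nonneg (|η| - 1 / 2), sq_abs η])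

theorem quarterDiag_pos (τ : ℝ) : 0 < quarterDiag τ := by
  rw [quarterDiag_eq_one_sub, sub_pos, div_lt_one (by positivity)]
  linarith [Real.exp_pos (2 * Real.pi * (2 * Real.pi * τ))]

theorem quarterDiag_lt_one (τ : ℝ) : quarterDiag τ < 1 := by
  rw [quarterDiag_eq_one_sub]
  have : 0 < 1 / (1 + Real.exp (2 * Real.pi * (2 * Real.pi * τ))) := by positivity
  linarith

/-- The crude bound 1/2 already gives the lower bound -1/2 for the form of the quarter plane,
keeping the negative part of the spectrum away from minus the norm. -/
theorem norm_quarterOffDiag_le (τ : ℝ) : ‖quarterOffDiag τ‖ ≤ 1 / 2 := by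
  refine abs_le_of_sq_le_sq' ?_ (by norm_num) |>.2
  rw [norm_quarterOffDiag_sq, div_le_iff₀ (by positivity)]
  have h1 := sq_le_sq' (abs_le.1 (abs_integral_sin_div_cosh_le_two (2 * Real.pi * τ))).1
    (abs_le.1 (abs_integral_sin_div_cosh_le_two (2 * Real.pi * τ))).2
  have h2 : Real.pi / Real.cosh (Real.pi * (2 * Real.pi * τ)) ≤ Real.pi :=
    div_le_self Real.pi_pos.le (Real.one_le_cosh _)
  have h3 : 0 ≤ Real.pi / Real.cosh (Real.pi * (2 * Real.pi * τ)) :=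
    div_nonneg Real.pi_pos.le (Real.cosh_pos _).le
  nlinarith [Real.pi_gt_three]

/-- This is the criterion `quarterTop_le_iff` at 1.0206. With r = 1/(1 + q) the right side is
1.0206·0.0206 + 1.0206 r, where the constant exceeds 0.02102; the cosh part of the left side takes
r/4, and at most 0.02102 + 0.77 r is left for the sine integral. -/
theorem norm_quarterOffDiag_sq_le (τ : ℝ) :
    ‖quarterOffDiag τ‖ ^ 2 ≤ 1.0206 * (1.0206 - quarterDiag τ) := by
  rw [norm_quarterOffDiag_sq, quarterDiag_eq_one_sub]
  set η := 2 * Real.pi * τ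
  set q := Real.exp (2 * Real.pi * η)
  set S := ∫ t in Set.Ioi (0 : ℝ), Real.sin (η * t) / Real.cosh (t / 2)
  have hq : 0 < q := Real.exp_pos _
  have hπ := Real.pi_gt_d4
  have hC : (Real.pi / Real.cosh (Real.pi * η)) ^ 2 / (4 * Real.pi) ^ 2 ≤ 1 / 4 * (1 / (1 + q)) := by
    have e : Real.cosh (Real.pi * η) ^ 2 * (4 * q) = (1 + q) ^ 2 := by
      have h1 : q = Real.exp (Real.pi * η) * Real.exp (Real.pi * η) := by
        rw [← Real.exp_add]; simp only [q]; congr 1; ring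
      have h2 : Real.exp (Real.pi * η) * Real.exp (-(Real.pi * η)) = 1 := by
        rw [← Real.exp_add]; simp
      rw [Real.cosh_eq, h1]
      linear_combination (1 + Real.exp (Real.pi * η) * Real.exp (-(Real.pi * η)) +
        2 * Real.exp (Real.pi * η) ^ 2) * h2
    have hc := Real.cosh_pos (Real.pi * η)
    have e2 : (Real.pi / Real.cosh (Real.pi * η)) ^ 2 / (4 * Real.pi) ^ 2 =
        q / (4 * (1 + q) ^ 2) := by
      rw [← e]
      field_simp
    rw [e2, ← sub_nonneg]
    have : 1 / 4 * (1 / (1 + q)) - q / (4 * (1 + q) ^ 2) = 1 / (4 * (1 + q) ^ 2) := by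
      field_simp
      ring
    rw [this]
    positivity
  have hS : S ^ 2 / (4 * Real.pi) ^ 2 ≤ 0.02102 + 0.77 * (1 / (1 + q)) := by
    have hp : (157.9 : ℝ) ≤ (4 * Real.pi) ^ 2 := by nlinarith
    rw [div_le_iff₀ (by positivity)]
    have hr : 0 < 1 / (1 + q) := by positivity
    -- For q ≤ 150 the bound |S| ≤ 2 suffices, because r is at least 1/151. For larger q, e⁵ < 150
    -- forces η ≥ 0.79, beyond the maximum at η = 1/2 of 2η/(1/4 + η²), which improves the bound on
    -- S.
    rcases le_total q 150 with h | h
    · have h2 : |S| ≤ 2 := abs_integral_sin_div_cosh_le_two η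
      have h3 : 1 / 151 ≤ 1 / (1 + q) := one_div_le_one_div_of_le (by linarith) (by linarith)
      have h4 : S ^ 2 ≤ 4 := by nlinarith [sq_abs S, abs_nonneg S]
      nlinarith
    · have h5 : 0.79 ≤ η := by
        by_contra hη
        have h6 : 2 * Real.pi * η < 5 := by nlinarith [Real.pi_lt_d4]
        have h7 : q < Real.exp 5 := Real.exp_lt_exp.2 h6
        have h8 : Real.exp 5 = Real.exp 1 ^ 5 := by rw [← Real.exp_nat_mul]; norm_num
        have h9 : Real.exp 1 ^ 5 ≤ 2.7182818286 ^ 5 :=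
          pow_le_pow_left₀ (Real.exp_pos _).le Real.exp_one_lt_d9.le 5
        norm_num at h9
        linarith
      have h2 : |S| ≤ 1.8076 := by
        refine abs_integral_sin_div_cosh_le ?_
        rw [abs_of_nonneg (by linarith)]
        nlinarith
      have h4 : S ^ 2 ≤ 1.8076 ^ 2 := by nlinarith [sq_abs S, abs_nonneg S]
      nlinarith
  rw [add_div]
  have hr : 0 < 1 / (1 + q) := by positivity
  nlinarith

theorem quarterTop_sq (τ : ℝ) :
    quarterTop τ ^ 2 = quarterDiag τ * quarterTop τ + ‖quarterOffDiag τ‖ ^ 2 := by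
  have := Real.sq_sqrt (by positivity : 0 ≤ quarterDiag τ ^ 2 + 4 * ‖quarterOffDiag τ‖ ^ 2)
  rw [quarterTop]
  nlinarith

theorem quarterDiag_le_quarterTop (τ : ℝ) : quarterDiag τ ≤ quarterTop τ := by
  have : quarterDiag τ ≤ √(quarterDiag τ ^ 2 + 4 * ‖quarterOffDiag τ‖ ^ 2) :=
    Real.le_sqrt_of_sq_le (by nlinarith [sq_nonneg ‖quarterOffDiag τ‖])
  rw [quarterTop]
  linarith

theorem quarterTop_le_iff {τ c : ℝ} (h : quarterDiag τ ≤ 2 * c) :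
    quarterTop τ ≤ c ↔ ‖quarterOffDiag τ‖ ^ 2 ≤ c * (c - quarterDiag τ) := by
  rw [quarterTop, div_le_iff₀ two_pos, ← le_sub_iff_add_le', Real.sqrt_le_left (by linarith)]
  constructor <;> intro h <;> nlinarith

theorem quarterTop_le (τ : ℝ) : quarterTop τ ≤ 1.0206 :=
  (quarterTop_le_iff (by linarith [quarterDiag_lt_one τ])).2
    (norm_quarterOffDiag_sq_le τ)

/-- The eigenvalue exceeds 1 exactly when |s|² > 1 - d, d being the diagonal entry. For large τ the
right side is exponentially small and the left side is not. -/
theorem exists_one_lt_quarterTop : ∃ τ, 1 < quarterTop τ := by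
  have hπ := Real.pi_gt_d4
  have hπ' := Real.pi_lt_d4
  -- At τ = 1/π, η = 2: the sine integral is at least 0.3, so |s|² ≥ 0.09/158, while 1 - d ≤ 1/2001.
  refine ⟨1 / Real.pi, lt_of_not_ge fun h => ?_⟩
  rw [quarterTop_le_iff (by linarith [quarterDiag_lt_one (1 / Real.pi)]),
    norm_quarterOffDiag_sq, quarterDiag_eq_one_sub,
    show 2 * Real.pi * (1 / Real.pi) = 2 by field_simp] at h
  obtain ⟨h1, -⟩ := integral_sin_div_cosh_bounds (η := 2) (by norm_num)
  have h2 : (0.3 : ℝ) ^ 2 ≤ (∫ t in Set.Ioi (0 : ℝ), Real.sin (2 * t) / Real.cosh (t / 2)) ^ 2 :=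
    pow_le_pow_left₀ (by norm_num) (by norm_num at h1 ⊢; linarith) 2
  rw [div_le_iff₀ (by positivity)] at h
  have h3 : (2000 : ℝ) ≤ Real.exp (2 * Real.pi * 2) := by
    have h4 : Real.exp 8 ≤ Real.exp (2 * Real.pi * 2) := Real.exp_le_exp.2 (by linarith)
    have h8 : Real.exp 8 = Real.exp 1 ^ 8 := by rw [← Real.exp_nat_mul]; norm_num
    have h9 : (2.7 : ℝ) ^ 8 ≤ Real.exp 1 ^ 8 :=
      pow_le_pow_left₀ (by norm_num) (by linarith [Real.exp_one_gt_d9]) 8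
    norm_num at h9
    linarith
  have h5 : 1 / (1 + Real.exp (2 * Real.pi * 2)) ≤ 1 / 2001 :=
    one_div_le_one_div_of_le (by norm_num) (by linarith)
  have h6 : (4 * Real.pi) ^ 2 ≤ 158 := by nlinarith
  have h7 := sq_nonneg (Real.pi / Real.cosh (Real.pi * 2))
  nlinarith [sq_nonneg (4 * Real.pi)]

theorem hasEigenvalue_quarterMatrix_iff (τ r : ℝ) :
    Module.End.HasEigenvalue (Matrix.toLin' (quarterMatrix τ)) (r : ℂ) ↔
      r ^ 2 = quarterDiag τ * r + ‖quarterOffDiag τ‖ ^ 2 := by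
  have hM : quarterMatrix τ = !![(quarterDiag τ : ℂ), quarterOffDiag τ;
      starRingEnd ℂ (quarterOffDiag τ), 0] := rfl
  rw [Module.End.hasEigenvalue_iff_isRoot_charpoly, Matrix.charpoly_toLin', hM,
    Matrix.charpoly_fin_two, Matrix.trace_fin_two_of, Matrix.det_fin_two_of, Complex.mul_conj,
    Complex.normSq_eq_norm_sq]
  simp only [Polynomial.IsRoot, Polynomial.eval_add, Polynomial.eval_sub, Polynomial.eval_pow,
    Polynomial.eval_X, Polynomial.eval_mul, Polynomial.eval_C]
  norm_cast
  constructor <;> intro h <;> linarith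

theorem quarterTop_mem_quarterEigenvalues (τ : ℝ) : quarterTop τ ∈ quarterEigenvalues :=
  ⟨τ, (hasEigenvalue_quarterMatrix_iff τ _).2 (quarterTop_sq τ)⟩

theorem exists_le_quarterTop {r : ℝ} (hr : r ∈ quarterEigenvalues) : ∃ τ, r ≤ quarterTop τ := by
  obtain ⟨τ, hτ⟩ := hr
  rw [hasEigenvalue_quarterMatrix_iff] at hτ
  refine ⟨τ, ?_⟩
  rw [quarterTop, le_div_iff₀ two_pos, ← sub_le_iff_le_add']
  exact Real.le_sqrt_of_sq_le (by linarith)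

theorem isLUB_quarterEigenvalues : IsLUB quarterEigenvalues (⨆ τ, quarterTop τ) := by
  have hb : BddAbove (Set.range quarterTop) := ⟨1.0206, by rintro _ ⟨τ, rfl⟩; exact quarterTop_le τ⟩
  refine ⟨fun r hr => ?_, fun c hc => ciSup_le fun τ => hc (quarterTop_mem_quarterEigenvalues τ)⟩
  obtain ⟨τ, h⟩ := exists_le_quarterTop hr
  exact h.trans (le_ciSup hb τ)

theorem continuous_quarterDiag : Continuous quarterDiag := by
  rw [show quarterDiag = _ from funext quarterDiag_eq_one_sub]
  exact continuous_const.sub (continuous_const.div (by fun_prop) fun τ => by positivity)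

theorem continuous_quarterOffDiag : Continuous quarterOffDiag := by
  refine continuous_const.mul (continuous_of_dominated (bound := fun t => 1 / Real.cosh (t / 2))
    (fun τ => ?_) (fun τ => ae_of_all _ fun t => ?_) integrableOn_inv_cosh_half
    (ae_of_all _ fun t => by fun_prop))
  · exact Measurable.aestronglyMeasurable (by fun_prop)
  · rw [norm_div, norm_exp_neg_mul_I, Complex.norm_real, Real.norm_of_nonneg (Real.cosh_pos _).le]

/-! ### The quarter plane as an integral operator -/

theorem measurePreserving_prod_right_comm :
    MeasurePreserving (fun q : (ℝ × ℝ) × ℝ => ((q.1.1, q.2), q.1.2)) volume volume := by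
  have h1 := volume_preserving_prodAssoc (α₁ := ℝ) (β₁ := ℝ) (γ₁ := ℝ)
  have h2 : MeasurePreserving (Prod.map id Prod.swap : ℝ × ℝ × ℝ → ℝ × ℝ × ℝ) volume volume :=
    (MeasurePreserving.id volume).prod Measure.measurePreserving_swap
  exact (h1.symm.comp h2).comp h1

theorem integral_exp_half_line {ε : ℝ} (hε : 0 < ε) (z : ℝ) :
    Integrable (fun ξ : ℝ => (Set.Ici (0 : ℝ)).indicator (fun ξ => Complex.exp (-(ε * ξ : ℝ))) ξ) ∧
    ∫ ξ : ℝ, (Set.Ici (0 : ℝ)).indicator (fun ξ => Complex.exp (-(ε * ξ : ℝ))) ξ *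
      Complex.exp (-(2 * Real.pi * z * ξ : ℝ) * I) = 1 / (ε + 2 * Real.pi * z * I) := by
  have hre : (-(ε + 2 * Real.pi * z * I) : ℂ).re < 0 := by
    simp [hε]
  have hre0 : (-(ε : ℂ)).re < 0 := by simpa
  constructor
  · rw [integrable_indicator_iff measurableSet_Ici, integrableOn_Ici_iff_integrableOn_Ioi]
    refine (integrableOn_exp_mul_complex_Ioi hre0 0).congr_fun (fun t _ => ?_) measurableSet_Ioi
    dsimp only
    congr 1
    push_cast
    ring
  · have e : ∀ ξ : ℝ, (Set.Ici (0 : ℝ)).indicator (fun ξ => Complex.exp (-(ε * ξ : ℝ))) ξ *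
        Complex.exp (-(2 * Real.pi * z * ξ : ℝ) * I) =
        (Set.Ici (0 : ℝ)).indicator
          (fun ξ : ℝ => Complex.exp ((-(ε + 2 * Real.pi * z * I) : ℂ) * ξ)) ξ := fun ξ => by
      by_cases h : ξ ∈ Set.Ici (0 : ℝ)
      · rw [Set.indicator_of_mem h, Set.indicator_of_mem h, ← Complex.exp_add]
        congr 1
        push_cast
        ring
      · rw [Set.indicator_of_notMem h, Set.indicator_of_notMem h, zero_mul]
    simp_rw [e]
    rw [integral_indicator measurableSet_Ici, integral_Ici_eq_integral_Ioi,
      integral_exp_mul_complex_Ioi hre]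
    rw [Complex.ofReal_zero, mul_zero, Complex.exp_zero, neg_div_neg_eq]

/-- The Weyl form of the quarter plane, regularised by `e^{-εξ}`, is an integral operator. -/
theorem weylForm_exp_quarterPlane {u v : ℝ → ℂ} (hum : StronglyMeasurable u) (hu : Integrable u)
    (hvm : StronglyMeasurable v) (hv : Integrable v) {ε : ℝ} (hε : 0 < ε) :
    weylForm (fun X => indicatorSymbol quarterPlane X * Complex.exp (-(ε * X.2 : ℝ))) u v =
      ∫ p : ℝ × ℝ, {p : ℝ × ℝ | 0 ≤ p.1 + p.2}.indicator
        (fun p => u p.1 * starRingEnd ℂ (v p.2) / (ε + 2 * Real.pi * (p.1 - p.2 : ℝ) * I)) p := by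
  set H : ℝ × ℝ → ℂ := {p : ℝ × ℝ | 0 ≤ p.1}.indicator
    fun p => u (p.1 + p.2 / 2) * starRingEnd ℂ (v (p.1 - p.2 / 2))
  have hS : MeasurableSet {p : ℝ × ℝ | 0 ≤ p.1} := measurableSet_le measurable_const measurable_fst
  have hHm : StronglyMeasurable H := by
    refine StronglyMeasurable.indicator ?_ hS
    exact (hum.comp_measurable (by fun_prop)).mul
      (Complex.continuous_conj.comp_stronglyMeasurable (hvm.comp_measurable (by fun_prop)))
  have hH : Integrable H := (integrable_wigner_kernel_prod hu hv).indicator hS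
  set e : ℝ → ℂ := (Set.Ici (0 : ℝ)).indicator (fun ξ => Complex.exp (-(ε * ξ : ℝ)))
  have hem : StronglyMeasurable e :=
    StronglyMeasurable.indicator (Continuous.stronglyMeasurable (by fun_prop)) measurableSet_Ici
  have he : Integrable e := (integral_exp_half_line hε 0).1
  -- A jointly integrable function of (x, z, ξ), thanks to e^{-εξ}. Integrating ξ first yields the
  -- kernel, z first the Wigner distribution.
  set G : (ℝ × ℝ) × ℝ → ℂ := fun q => H q.1 * (e q.2 *
    Complex.exp (-(2 * Real.pi * q.1.2 * q.2 : ℝ) * I))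
  have hGm : StronglyMeasurable G := (hHm.comp_measurable measurable_fst).mul
    ((hem.comp_measurable measurable_snd).mul (Continuous.stronglyMeasurable (by fun_prop)))
  have hG : Integrable G := by
    refine (hH.mul_prod he).mono hGm.aestronglyMeasurable (ae_of_all _ fun q => ?_)
    simp only [G]
    rw [norm_mul, norm_mul, norm_mul, norm_exp_neg_mul_I, mul_one]
  have hR : ∫ q, G q = ∫ p : ℝ × ℝ, {p : ℝ × ℝ | 0 ≤ p.1 + p.2}.indicator
        (fun p => u p.1 * starRingEnd ℂ (v p.2) / (ε + 2 * Real.pi * (p.1 - p.2 : ℝ) * I)) p := by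
    have hT : StronglyMeasurable ({p : ℝ × ℝ | 0 ≤ p.1 + p.2}.indicator
        (fun p => u p.1 * starRingEnd ℂ (v p.2) / (ε + 2 * Real.pi * (p.1 - p.2 : ℝ) * I))) := by
      refine StronglyMeasurable.indicator ?_
        (measurableSet_le measurable_const (measurable_fst.add measurable_snd))
      refine Measurable.stronglyMeasurable ?_
      refine ((hum.measurable.comp measurable_fst).mul (Complex.continuous_conj.measurable.comp
        (hvm.measurable.comp measurable_snd))).div (by fun_prop)
    rw [← measurePreserving_wigner.integral_comp_sm hT, Measure.volume_eq_prod (ℝ × ℝ) ℝ,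
      integral_prod _ hG]
    refine integral_congr_ae (ae_of_all _ fun p => ?_)
    simp only [G]
    rw [integral_const_mul, (integral_exp_half_line hε p.2).2]
    by_cases h : 0 ≤ p.1
    · have h' : (p.1 + p.2 / 2, p.1 - p.2 / 2) ∈ {p : ℝ × ℝ | 0 ≤ p.1 + p.2} := by
        simp only [Set.mem_ofPred_eq]; linarith
      have h'' : p ∈ {p : ℝ × ℝ | 0 ≤ p.1} := h
      simp only [H]
      rw [Set.indicator_of_mem h', Set.indicator_of_mem h'', mul_one_div]
      congr 3
      push_cast
      ring
    · have h' : (p.1 + p.2 / 2, p.1 - p.2 / 2) ∉ {p : ℝ × ℝ | 0 ≤ p.1 + p.2} := by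
        simp only [Set.mem_ofPred_eq]; intro; apply h; linarith
      have h'' : p ∉ {p : ℝ × ℝ | 0 ≤ p.1} := h
      simp only [H]
      rw [Set.indicator_of_notMem h', Set.indicator_of_notMem h'', zero_mul]
  rw [← hR]
  have hσ := measurePreserving_prod_right_comm
  have hGσ : Integrable (fun q : (ℝ × ℝ) × ℝ => G ((q.1.1, q.2), q.1.2)) :=
    hσ.integrable_comp_of_integrable hG
  have hint : ∫ q, G q = ∫ q : (ℝ × ℝ) × ℝ, G ((q.1.1, q.2), q.1.2) := by
    conv_lhs => rw [← hσ.map_eq]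
    exact integral_map hσ.measurable.aemeasurable hGm.aestronglyMeasurable
  rw [hint, Measure.volume_eq_prod (ℝ × ℝ) ℝ, integral_prod _ hGσ]
  refine integral_congr_ae (ae_of_all _ fun X => ?_)
  have hkey : ∀ z : ℝ, G ((X.1, z), X.2) = indicatorSymbol quarterPlane X *
      Complex.exp (-(ε * X.2 : ℝ)) * (Complex.exp (-(2 * Real.pi * z * X.2 : ℝ) * I) *
        u (X.1 + z / 2) * starRingEnd ℂ (v (X.1 - z / 2))) := by
    intro z
    simp only [G, H, e, indicatorSymbol]
    by_cases h1 : 0 ≤ X.1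
    · by_cases h2 : 0 ≤ X.2
      · have q1 : X ∈ quarterPlane := ⟨h1, h2⟩
        have q2 : (X.1, z) ∈ {p : ℝ × ℝ | 0 ≤ p.1} := h1
        have q3 : X.2 ∈ Set.Ici (0 : ℝ) := h2
        rw [Set.indicator_of_mem q1, Set.indicator_of_mem q2, Set.indicator_of_mem q3]
        ring
      · have q1 : X ∉ quarterPlane := fun h => h2 h.2
        have q3 : X.2 ∉ Set.Ici (0 : ℝ) := h2
        rw [Set.indicator_of_notMem q1, Set.indicator_of_notMem q3]
        ring
    · have q1 : X ∉ quarterPlane := fun h => h1 h.1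
      have q2 : (X.1, z) ∉ {p : ℝ × ℝ | 0 ≤ p.1} := h1
      rw [Set.indicator_of_notMem q1, Set.indicator_of_notMem q2]
      ring
  simp_rw [hkey, integral_const_mul]
  rfl

theorem tendsto_weylForm_exp_quarterPlane {u v : ℝ → ℂ} (h : Integrable (wigner u v)) :
    Tendsto (fun ε : ℝ => weylForm (fun X => indicatorSymbol quarterPlane X *
      Complex.exp (-(ε * X.2 : ℝ))) u v) (𝓝[>] 0) (𝓝 (weylForm (indicatorSymbol quarterPlane) u v)) := by
  have hq := unitSymbol_indicator measurableSet_quarterPlane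
  refine tendsto_integral_filter_of_dominated_convergence (fun X => ‖wigner u v X‖) ?_ ?_ h.norm ?_
  · refine Eventually.of_forall fun ε => ?_
    exact (hq.1.mul (Continuous.stronglyMeasurable (by fun_prop))).aestronglyMeasurable.mul
      h.aestronglyMeasurable
  · filter_upwards [self_mem_nhdsWithin] with ε hε
    refine ae_of_all _ fun X => ?_
    rw [norm_mul]
    refine mul_le_of_le_one_left (norm_nonneg _) ?_
    by_cases hX : X ∈ quarterPlane
    · rw [norm_mul, Complex.norm_exp, ← Complex.ofReal_neg, Complex.ofReal_re]
      have h1 : Real.exp (-(ε * X.2)) ≤ 1 :=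
        Real.exp_le_one_iff.2 (neg_nonpos.2 (mul_nonneg (le_of_lt hε) hX.2))
      exact mul_le_one₀ (hq.2 X) (Real.exp_pos _).le h1
    · rw [indicatorSymbol, Set.indicator_of_notMem hX]
      simp
  · refine ae_of_all _ fun X => ?_
    have : Continuous fun ε : ℝ => indicatorSymbol quarterPlane X *
      Complex.exp (-(ε * X.2 : ℝ)) * wigner u v X := by fun_prop
    have h2 := (this.tendsto 0).mono_left (nhdsWithin_le_nhds (s := Set.Ioi 0))
    simpa using h2

/-! ### Logarithmic coordinates on the half lines -/

/-- The function on the half line which is `φ` in the logarithmic coordinate, normalised to have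
the same `L²` norm. -/
noncomputable def halfLineLift (φ : ℝ → ℂ) : ℝ → ℂ :=
  (Set.Ioi (0 : ℝ)).indicator fun x => (Real.exp (-(Real.log x / 2)) : ℂ) * φ (Real.log x)

theorem halfLineLift_of_nonpos (φ : ℝ → ℂ) {x : ℝ} (hx : x ≤ 0) : halfLineLift φ x = 0 :=
  Set.indicator_of_notMem (by simpa using hx) _

theorem halfLineLift_exp (φ : ℝ → ℂ) (t : ℝ) :
    halfLineLift φ (Real.exp t) = Real.exp (-(t / 2)) * φ t := by
  rw [halfLineLift, Set.indicator_of_mem (Set.mem_Ioi.2 (Real.exp_pos t)), Real.log_exp]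

theorem integral_halfLine (h : ℝ → ℂ) (h0 : ∀ x ≤ 0, h x = 0) :
    ∫ x, h x = ∫ t, (Real.exp t : ℂ) * h (Real.exp t) := by
  have h1 : ∫ x, h x = ∫ x in Set.Ioi (0 : ℝ), h x :=
    (setIntegral_eq_integral_of_forall_compl_eq_zero fun x hx => h0 x (by simpa using hx)).symm
  rw [h1, ← Real.range_exp, ← Set.image_univ, integral_image_eq_integral_abs_deriv_smul
    MeasurableSet.univ (fun x _ => (Real.hasDerivAt_exp x).hasDerivWithinAt)
    Real.exp_injective.injOn, Measure.restrict_univ]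
  refine integral_congr_ae (ae_of_all _ fun t => ?_)
  dsimp only
  rw [abs_of_pos (Real.exp_pos t), Complex.real_smul]

/-- If φ is supported in [-R, R], the lift is supported in [e^{-R}, e^R], away from the origin, so
extending by zero stays smooth. -/
theorem exists_halfLineLift {φ : ℝ → ℂ} (hφ : ContDiff ℝ ∞ φ) (hc : HasCompactSupport φ) :
    ContDiff ℝ ∞ (halfLineLift φ) ∧ HasCompactSupport (halfLineLift φ) := by
  obtain ⟨R, hR⟩ := hc.isCompact.isBounded.subset_closedBall 0
  have h0 : ∀ t, R < |t| → φ t = 0 := fun t ht => by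
    by_contra h
    have := hR (subset_tsupport _ h)
    rw [mem_closedBall_zero_iff, Real.norm_eq_abs] at this
    linarith
  have hl : ∀ x, 0 < x → R < |Real.log x| → halfLineLift φ x = 0 := fun x hx h => by
    rw [halfLineLift, Set.indicator_of_mem (Set.mem_Ioi.2 hx), h0 _ h, mul_zero]
  constructor
  · rw [contDiff_iff_contDiffAt]
    intro x
    rcases lt_or_ge 0 x with hx | hx
    · have h1 : ContDiffAt ℝ ∞ (fun x : ℝ => (Real.exp (-(Real.log x / 2)) : ℂ) * φ (Real.log x)) x := by
        have hlog : ContDiffAt ℝ ∞ Real.log x := Real.contDiffAt_log.2 hx.ne'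
        refine ContDiffAt.mul ?_ (hφ.contDiffAt.comp x hlog)
        exact Complex.ofRealCLM.contDiff.contDiffAt.comp x
          (Real.contDiff_exp.contDiffAt.comp x (hlog.div_const 2).neg)
      refine h1.congr_of_eventuallyEq ?_
      filter_upwards [Ioi_mem_nhds hx] with y hy
      rw [halfLineLift, Set.indicator_of_mem hy]
    · refine (contDiffAt_const (c := (0 : ℂ))).congr_of_eventuallyEq ?_
      filter_upwards [Iio_mem_nhds (hx.trans_lt (Real.exp_pos (-(|R| + 1))))] with y hy
      rcases lt_or_ge 0 y with hy0 | hy0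
      · have := (Real.log_lt_iff_lt_exp hy0).2 hy
        refine hl y hy0 ?_
        rw [abs_of_neg (by linarith [abs_nonneg R])]
        linarith [le_abs_self R]
      · exact halfLineLift_of_nonpos φ hy0
  · refine HasCompactSupport.of_support_subset_isCompact (isCompact_Icc (a := 0) (b := Real.exp R))
      fun x hx => ?_
    have h1 : 0 < x := lt_of_not_ge fun h => hx (halfLineLift_of_nonpos φ h)
    have h2 : |Real.log x| ≤ R := le_of_not_gt fun h => hx (hl x h1 h)
    exact ⟨h1.le, (Real.log_le_iff_le_exp h1).1 ((le_abs_self _).trans h2)⟩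

theorem norm_halfLineLift_sq (φ : ℝ → ℂ) :
    ∫ x, halfLineLift φ x * starRingEnd ℂ (halfLineLift φ x) = ∫ t, φ t * starRingEnd ℂ (φ t) := by
  rw [integral_halfLine _ fun x hx => by rw [halfLineLift_of_nonpos φ hx, zero_mul]]
  refine integral_congr_ae (ae_of_all _ fun t => ?_)
  dsimp only
  have h : Real.exp t * (Real.exp (-(t / 2)) * Real.exp (-(t / 2))) = 1 := by
    rw [← Real.exp_add, ← Real.exp_add, Real.exp_eq_one_iff]; ring
  rw [halfLineLift_exp, map_mul, Complex.conj_ofReal]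
  have h' : (Real.exp t : ℂ) * (Real.exp (-(t / 2)) * Real.exp (-(t / 2))) = 1 := by exact_mod_cast h
  linear_combination (φ t * starRingEnd ℂ (φ t)) * h'

/-- Kernels homogeneous of degree -1 are turned into functions of the difference of the logarithmic
coordinates. The bound on K is only required on the open positive quadrant, where the lifts live. -/
theorem integral_halfLineLift_tensor {φ ψ : ℝ → ℂ} (hφ : Continuous φ) (hφc : HasCompactSupport φ)
    (hψ : Continuous ψ) (hψc : HasCompactSupport ψ) (hu : Integrable (halfLineLift φ))
    (hv : Integrable (halfLineLift ψ)) {K : ℝ × ℝ → ℂ}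
    (hK : Measurable K) {C : ℝ} (hC : ∀ p : ℝ × ℝ, 0 < p.1 → 0 < p.2 → ‖K p‖ ≤ C) :
    ∫ p : ℝ × ℝ, halfLineLift φ p.1 * starRingEnd ℂ (halfLineLift ψ p.2) * K p =
      ∫ p : ℝ × ℝ, φ p.1 * starRingEnd ℂ (ψ p.2) *
        ((Real.exp ((p.1 + p.2) / 2) : ℂ) * K (Real.exp p.1, Real.exp p.2)) := by
  have hi1 : Integrable fun p : ℝ × ℝ =>
      halfLineLift φ p.1 * starRingEnd ℂ (halfLineLift ψ p.2) * K p := by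
    refine ((integrable_tensor hu hv).norm.mul_const C).mono'
      ((integrable_tensor hu hv).aestronglyMeasurable.mul hK.aestronglyMeasurable)
      (ae_of_all _ fun p => ?_)
    rw [norm_mul]
    by_cases h1 : 0 < p.1
    · by_cases h2 : 0 < p.2
      · gcongr; exact hC p h1 h2
      · rw [halfLineLift_of_nonpos ψ (not_lt.1 h2)]; simp
    · rw [halfLineLift_of_nonpos φ (not_lt.1 h1)]; simp
  have hexp : ∀ {f : ℝ → ℂ}, Continuous f → HasCompactSupport f →
      Integrable fun x => (Real.exp (x / 2) : ℂ) * f x := fun hf hfc =>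
    Continuous.integrable_of_hasCompactSupport (by fun_prop) hfc.mul_left
  have hi2 : Integrable fun p : ℝ × ℝ => φ p.1 * starRingEnd ℂ (ψ p.2) *
        ((Real.exp ((p.1 + p.2) / 2) : ℂ) * K (Real.exp p.1, Real.exp p.2)) := by
    have h := integrable_tensor (hexp hφ hφc) (hexp hψ hψc)
    refine (h.mul_bdd (c := C) (g := fun p : ℝ × ℝ => K (Real.exp p.1, Real.exp p.2)) ?_ ?_).congr
      (ae_of_all _ fun p => ?_)
    · exact (hK.comp (by fun_prop)).aestronglyMeasurable
    · exact ae_of_all _ fun p => hC _ (Real.exp_pos _) (Real.exp_pos _)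
    · dsimp only
      rw [map_mul, Complex.conj_ofReal, add_div, Real.exp_add]
      push_cast
      ring
  rw [Measure.volume_eq_prod ℝ ℝ, integral_prod _ hi1, integral_prod _ hi2, integral_halfLine]
  · refine integral_congr_ae (ae_of_all _ fun x => ?_)
    dsimp only
    rw [integral_halfLine _ fun y hy => by rw [halfLineLift_of_nonpos ψ hy]; simp,
      ← integral_const_mul]
    refine integral_congr_ae (ae_of_all _ fun y => ?_)
    dsimp only
    rw [halfLineLift_exp, halfLineLift_exp, map_mul, Complex.conj_ofReal]
    have h : ∀ z : ℝ, (Real.exp z : ℂ) * Real.exp (-(z / 2)) = Real.exp (z / 2) := fun z => by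
      rw [← Complex.ofReal_mul, ← Real.exp_add]; congr 2; ring
    have h3 : (Real.exp ((x + y) / 2) : ℂ) = Real.exp (x / 2) * Real.exp (y / 2) := by
      rw [← Complex.ofReal_mul, ← Real.exp_add]; congr 2; ring
    rw [h3, ← h x, ← h y]
    ring
  · intro x hx
    simp [halfLineLift_of_nonpos φ hx]

theorem integral_mul_conj_eq_fourier (f g : 𝓢(ℝ, ℂ)) :
    ∫ x, f x * starRingEnd ℂ (g x) =
      ∫ τ, 𝓕 (f : ℝ → ℂ) τ * starRingEnd ℂ (𝓕 (g : ℝ → ℂ) τ) := by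
  have h := SchwartzMap.integral_inner_fourier_fourier g f
  simp only [RCLike.inner_apply, SchwartzMap.fourier_coe] at h
  exact h.symm

theorem integral_translate_mul_conj (f g : 𝓢(ℝ, ℂ)) (r : ℝ) :
    ∫ y, f (y + r) * starRingEnd ℂ (g y) =
      ∫ τ, 𝓕 (f : ℝ → ℂ) τ * starRingEnd ℂ (𝓕 (g : ℝ → ℂ) τ) *
        Complex.exp ((2 * Real.pi * r * τ : ℝ) * I) := by
  have h := integral_mul_conj_eq_fourier (f.compSubConstCLM ℂ (-r)) g
  have e1 : ∀ y, (f.compSubConstCLM ℂ (-r)) y = f (y + r) := fun y => by simp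
  have e2 : ∀ τ, 𝓕 ((f.compSubConstCLM ℂ (-r) : 𝓢(ℝ, ℂ)) : ℝ → ℂ) τ =
      Complex.exp ((2 * Real.pi * r * τ : ℝ) * I) * 𝓕 (f : ℝ → ℂ) τ := fun τ => by
    rw [Real.fourier_real_eq_integral_exp_smul, Real.fourier_real_eq_integral_exp_smul,
      ← integral_const_mul, ← integral_sub_right_eq_self _ r]
    refine integral_congr_ae (ae_of_all _ fun y => ?_)
    dsimp only
    rw [e1, sub_add_cancel, smul_eq_mul, smul_eq_mul, ← mul_assoc, ← Complex.exp_add]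
    congr 2
    push_cast
    ring
  simp_rw [e1, e2] at h
  rw [h]
  refine integral_congr_ae (ae_of_all _ fun τ => ?_)
  dsimp only
  ring

theorem norm_inv_add_mul_I_le {ε r : ℝ} (hr : r ≠ 0) :
    ‖(1 : ℂ) / (ε + 2 * Real.pi * r * I)‖ ≤ 1 / (2 * Real.pi * |r|) := by
  have h : 2 * Real.pi * |r| ≤ ‖(ε + 2 * Real.pi * r * I : ℂ)‖ := by
    have h1 := Complex.abs_im_le_norm (ε + 2 * Real.pi * r * I : ℂ)
    have h2 : (ε + 2 * Real.pi * r * I : ℂ).im = 2 * Real.pi * r := by simp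
    rwa [h2, abs_mul, abs_of_pos Real.two_pi_pos] at h1
  have := abs_pos.2 hr
  rw [norm_div, norm_one]
  exact one_div_le_one_div_of_le (by positivity) h

theorem norm_inv_add_mul_I_le_inv {ε : ℝ} (hε : 0 < ε) (r : ℝ) :
    ‖(1 : ℂ) / (ε + 2 * Real.pi * r * I)‖ ≤ 1 / ε := by
  have h : ε ≤ ‖(ε + 2 * Real.pi * r * I : ℂ)‖ := by
    have h1 := Complex.abs_re_le_norm (ε + 2 * Real.pi * r * I : ℂ)
    have h2 : (ε + 2 * Real.pi * r * I : ℂ).re = ε := by simp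
    rwa [h2, abs_of_pos hε] at h1
  rw [norm_div, norm_one]
  exact one_div_le_one_div_of_le hε h

theorem tendsto_inv_add_mul_I {r : ℝ} (hr : r ≠ 0) :
    Tendsto (fun ε : ℝ => (1 : ℂ) / (ε + 2 * Real.pi * r * I)) (𝓝[>] 0)
      (𝓝 (1 / (2 * Real.pi * r * I))) := by
  have h : (2 * Real.pi * r * I : ℂ) ≠ 0 := by
    simp [hr, Real.pi_ne_zero]
  have h1 : ContinuousAt (fun ε : ℝ => (1 : ℂ) / (ε + 2 * Real.pi * r * I)) 0 :=
    continuousAt_const.div (by fun_prop) (by simpa using h)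
  have h2 := h1.tendsto.mono_left (nhdsWithin_le_nhds (s := Set.Ioi 0))
  simpa using h2

theorem exp_add_exp_eq (x y : ℝ) :
    Real.exp x + Real.exp y = 2 * Real.exp ((x + y) / 2) * Real.cosh ((x - y) / 2) := by
  have h1 : Real.exp x = Real.exp ((x + y) / 2) * Real.exp ((x - y) / 2) := by
    rw [← Real.exp_add]; ring_nf
  have h2 : Real.exp y = Real.exp ((x + y) / 2) * Real.exp (-((x - y) / 2)) := by
    rw [← Real.exp_add]; ring_nf
  rw [h1, h2, Real.cosh_eq]
  ring

theorem exp_sub_exp_eq (x y : ℝ) :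
    Real.exp x - Real.exp y = 2 * Real.exp ((x + y) / 2) * Real.sinh ((x - y) / 2) := by
  have h1 : Real.exp x = Real.exp ((x + y) / 2) * Real.exp ((x - y) / 2) := by
    rw [← Real.exp_add]; ring_nf
  have h2 : Real.exp y = Real.exp ((x + y) / 2) * Real.exp (-((x - y) / 2)) := by
    rw [← Real.exp_add]; ring_nf
  rw [h1, h2, Real.sinh_eq]
  ring

/-- Convolution becomes multiplication: substitute p = (y + r, y), apply Plancherel to each
translate, and exchange the integrals. -/
theorem integral_mul_correlation {k : ℝ → ℂ} (hk : Integrable k) (hkm : Measurable k)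
    (f g : 𝓢(ℝ, ℂ)) :
    ∫ p : ℝ × ℝ, f p.1 * starRingEnd ℂ (g p.2) * k (p.1 - p.2) =
      ∫ τ, 𝓕 (f : ℝ → ℂ) τ * starRingEnd ℂ (𝓕 (g : ℝ → ℂ) τ) *
        ∫ r, k r * Complex.exp ((2 * Real.pi * r * τ : ℝ) * I) := by
  have hF : StronglyMeasurable fun p : ℝ × ℝ => f p.1 * starRingEnd ℂ (g p.2) * k (p.1 - p.2) :=
    Measurable.stronglyMeasurable (by
      have := f.continuous.measurable
      have := g.continuous.measurable
      have := Complex.continuous_conj.measurable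
      fun_prop)
  have hT : MeasurePreserving (fun p : ℝ × ℝ => (p.2 + p.1, p.2)) volume volume := by
    have h := measurePreserving_shear_fst (h := fun x => x) measurable_id
    convert h using 2 with p
    rw [add_comm]
  have hi1 : Integrable fun p : ℝ × ℝ => k p.1 * (f (p.2 + p.1) * starRingEnd ℂ (g p.2)) := by
    obtain ⟨C, hC0, hC⟩ := f.exists_norm_le_inv_one_add_sq_pow 0
    refine (hk.mul_prod (g.integrable (μ := volume))).norm.const_mul C |>.mono' ?_ (ae_of_all _ fun p => ?_)
    · refine Measurable.aestronglyMeasurable ?_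
      have := f.continuous.measurable
      have := g.continuous.measurable
      have := Complex.continuous_conj.measurable
      fun_prop
    · have := hC (p.2 + p.1)
      rw [pow_zero, one_mul] at this
      rw [norm_mul, norm_mul, norm_mul, RCLike.norm_conj]
      calc _ = ‖f (p.2 + p.1)‖ * (‖k p.1‖ * ‖g p.2‖) := by ring
        _ ≤ _ := by gcongr
  have hh : Integrable fun τ => 𝓕 (f : ℝ → ℂ) τ * starRingEnd ℂ (𝓕 (g : ℝ → ℂ) τ) := by
    have := integrable_mul_of_sqInt (sqInt_schwartz (𝓕 f)) (sqInt_schwartz (𝓕 g)).conj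
    simpa only [SchwartzMap.fourier_coe] using this
  have hi2 : Integrable fun p : ℝ × ℝ => k p.1 * (𝓕 (f : ℝ → ℂ) p.2 *
      starRingEnd ℂ (𝓕 (g : ℝ → ℂ) p.2) * Complex.exp ((2 * Real.pi * p.1 * p.2 : ℝ) * I)) := by
    refine (hk.mul_prod hh).mono ?_ (ae_of_all _ fun p => ?_)
    · refine hkm.aestronglyMeasurable.comp_fst.mul ((hh.aestronglyMeasurable.comp_snd).mul
        (Continuous.aestronglyMeasurable (by fun_prop)))
    · rw [norm_mul, norm_mul, norm_mul (k p.1), Complex.norm_exp_ofReal_mul_I, mul_one]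
  rw [← (hT.integral_comp_sm hF)]
  have e1 : ∀ p : ℝ × ℝ, f (p.2 + p.1) * starRingEnd ℂ (g p.2) * k (p.2 + p.1 - p.2) =
      k p.1 * (f (p.2 + p.1) * starRingEnd ℂ (g p.2)) := fun p => by
    rw [add_sub_cancel_left]; ring
  simp_rw [e1]
  rw [Measure.volume_eq_prod ℝ ℝ, integral_prod _ hi1]
  simp_rw [integral_const_mul, integral_translate_mul_conj f g]
  have e2 := integral_integral_swap (f := fun r τ => k r * (𝓕 (f : ℝ → ℂ) τ *
    starRingEnd ℂ (𝓕 (g : ℝ → ℂ) τ) * Complex.exp ((2 * Real.pi * r * τ : ℝ) * I))) hi2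
  simp_rw [integral_const_mul] at e2
  rw [e2]
  refine integral_congr_ae (ae_of_all _ fun τ => ?_)
  dsimp only
  rw [← integral_const_mul]
  refine integral_congr_ae (ae_of_all _ fun r => ?_)
  dsimp only
  ring

/-- The off-diagonal part of the form of the quarter plane, in logarithmic coordinates. -/
theorem weylForm_quarterPlane_offDiag (f g u v : 𝓢(ℝ, ℂ)) (hf : HasCompactSupport f)
    (hg : HasCompactSupport g) (hu : ∀ x, u x = halfLineLift f x)
    (hv : ∀ x, v x = halfLineLift g (-x)) :
    weylForm (indicatorSymbol quarterPlane) u v =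
      ∫ τ, 𝓕 (f : ℝ → ℂ) τ * starRingEnd ℂ (𝓕 (g : ℝ → ℂ) τ) *
        starRingEnd ℂ (quarterOffDiag τ) := by
  have hu' : (u : ℝ → ℂ) = halfLineLift f := funext hu
  have hg' : Integrable (halfLineLift g) := by
    have h := (v.integrable (μ := volume)).comp_neg
    refine h.congr (ae_of_all _ fun x => ?_)
    dsimp only
    rw [hv, neg_neg]
  have hgm : Measurable (halfLineLift g) := by
    have : halfLineLift g = fun x => v (-x) := funext fun x => by rw [hv, neg_neg]
    rw [this]
    exact (v.continuous.comp continuous_neg).measurable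
  have hf' : Integrable (halfLineLift f) := hu' ▸ u.integrable
  have hfm : Measurable (halfLineLift f) := hu' ▸ u.continuous.measurable
  -- After reflecting the negative half line the kernel is 1_{s>t}/(2πi(s+t)), and e^{(x+y)/2}/(e^x
  -- + e^y) = 1/(2cosh((x-y)/2)).
  set k : ℝ → ℂ := (Set.Ioi (0 : ℝ)).indicator
    fun r => 1 / (4 * Real.pi * I) * ((1 / Real.cosh (r / 2) : ℝ) : ℂ)
  have hkm : Measurable k := Measurable.indicator (by fun_prop) measurableSet_Ioi
  have hki : Integrable k := by
    rw [integrable_indicator_iff measurableSet_Ioi]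
    exact (integrableOn_inv_cosh_half.ofReal (𝕜 := ℂ)).const_mul _
  have hε : ∀ ε : ℝ, 0 < ε → weylForm (fun X => indicatorSymbol quarterPlane X *
      Complex.exp (-(ε * X.2 : ℝ))) u v = ∫ p : ℝ × ℝ, f p.1 * starRingEnd ℂ (g p.2) *
        ((Real.exp ((p.1 + p.2) / 2) : ℂ) * ({p : ℝ × ℝ | p.2 < p.1}.indicator
          (fun p => 1 / (ε + 2 * Real.pi * (p.1 + p.2 : ℝ) * I)) (Real.exp p.1, Real.exp p.2))) := by
    intro ε hε
    have hS : MeasurableSet {p : ℝ × ℝ | p.2 < p.1} := measurableSet_lt measurable_snd measurable_fst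
    rw [weylForm_exp_quarterPlane u.continuous.stronglyMeasurable u.integrable
      v.continuous.stronglyMeasurable v.integrable hε,
      ← integral_halfLineLift_tensor f.continuous hf g.continuous hg hf' hg'
        (Measurable.indicator (by fun_prop) hS) (C := 1 / ε)]
    · have hm : StronglyMeasurable fun p : ℝ × ℝ => {p : ℝ × ℝ | 0 ≤ p.1 + p.2}.indicator (fun p =>
          u p.1 * starRingEnd ℂ (v p.2) / (ε + 2 * Real.pi * (p.1 - p.2 : ℝ) * I)) p := by
        refine StronglyMeasurable.indicator (Measurable.stronglyMeasurable ?_)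
          (measurableSet_le measurable_const (measurable_fst.add measurable_snd))
        have := u.continuous.measurable
        have := v.continuous.measurable
        have := Complex.continuous_conj.measurable
        fun_prop
      rw [← measurePreserving_neg_snd.integral_comp_sm hm]
      -- The two indicators differ by a strict versus a weak inequality, hence only on the diagonal.
      have hdiag : ∀ᵐ p : ℝ × ℝ, p.1 - p.2 ≠ 0 := by
        have h := (measurePreserving_shear_fst (h := fun x => -x) measurable_neg).quasiMeasurePreserving
        have h2 : Measure.QuasiMeasurePreserving (Prod.fst : ℝ × ℝ → ℝ) volume volume :=
          Measure.quasiMeasurePreserving_fst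
        have h3 := (h2.comp h).ae (p := fun x => x ≠ 0) (by simp [ae_iff])
        filter_upwards [h3] with p hp
        simpa [sub_eq_add_neg] using hp
      refine integral_congr_ae (hdiag.mono fun p hp => ?_)
      dsimp only
      by_cases h : p.2 < p.1
      · have m1 : p ∈ {p : ℝ × ℝ | p.2 < p.1} := h
        have m2 : (p.1, -p.2) ∈ {p : ℝ × ℝ | 0 ≤ p.1 + p.2} := by
          simp only [Set.mem_ofPred_eq]; linarith
        rw [Set.indicator_of_mem m1, Set.indicator_of_mem m2, hu, hv, neg_neg, sub_neg_eq_add,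
          mul_one_div]
      · have m1 : p ∉ {p : ℝ × ℝ | p.2 < p.1} := h
        have m2 : (p.1, -p.2) ∉ {p : ℝ × ℝ | 0 ≤ p.1 + p.2} := by
          simp only [Set.mem_ofPred_eq]; intro h'; exact hp (by linarith)
        rw [Set.indicator_of_notMem m1, Set.indicator_of_notMem m2, mul_zero]
    · intro p _ _
      refine (norm_indicator_le_norm_self _ _).trans ?_
      exact norm_inv_add_mul_I_le_inv hε _
  have hlim1 := tendsto_weylForm_exp_quarterPlane (integrable_wigner u v)
  have hlim2 : Tendsto (fun ε : ℝ => weylForm (fun X => indicatorSymbol quarterPlane X *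
      Complex.exp (-(ε * X.2 : ℝ))) u v) (𝓝[>] 0)
      (𝓝 (∫ p : ℝ × ℝ, f p.1 * starRingEnd ℂ (g p.2) * k (p.1 - p.2))) := by
    have hcosh : ∀ p : ℝ × ℝ, Real.exp p.1 + Real.exp p.2 ≠ 0 := fun p => by positivity
    refine Tendsto.congr' (f₁ := fun ε : ℝ => ∫ p : ℝ × ℝ, f p.1 * starRingEnd ℂ (g p.2) *
        ((Real.exp ((p.1 + p.2) / 2) : ℂ) * ({p : ℝ × ℝ | p.2 < p.1}.indicator
          (fun p => 1 / (ε + 2 * Real.pi * (p.1 + p.2 : ℝ) * I)) (Real.exp p.1, Real.exp p.2))))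
      (eventually_mem_nhdsWithin.mono fun ε h => (hε ε h).symm) ?_
    refine tendsto_integral_filter_of_dominated_convergence
      (fun p => ‖f p.1 * starRingEnd ℂ (g p.2)‖) ?_ ?_ (integrable_tensor f.integrable g.integrable).norm ?_
    · refine Eventually.of_forall fun ε => Measurable.aestronglyMeasurable ?_
      have := f.continuous.measurable
      have := g.continuous.measurable
      have := Complex.continuous_conj.measurable
      have hS : MeasurableSet {p : ℝ × ℝ | p.2 < p.1} :=
        measurableSet_lt measurable_snd measurable_fst
      have hI : Measurable ({p : ℝ × ℝ | p.2 < p.1}.indicator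
          (fun p => 1 / (ε + 2 * Real.pi * (p.1 + p.2 : ℝ) * I : ℂ))) :=
        Measurable.indicator (by fun_prop) hS
      have hI2 := hI.comp (f := fun p : ℝ × ℝ => (Real.exp p.1, Real.exp p.2)) (by fun_prop)
      simp only [Function.comp_def] at hI2
      fun_prop
    · refine Eventually.of_forall fun ε => ae_of_all _ fun p => ?_
      rw [norm_mul]
      refine mul_le_of_le_one_right (norm_nonneg _) ?_
      rw [norm_mul, Complex.norm_real, Real.norm_of_nonneg (Real.exp_pos _).le]
      have hb : ‖{p : ℝ × ℝ | p.2 < p.1}.indicator (fun p => 1 / (ε + 2 * Real.pi * (p.1 + p.2 : ℝ) * I))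
          (Real.exp p.1, Real.exp p.2)‖ ≤ 1 / (2 * Real.pi * |Real.exp p.1 + Real.exp p.2|) :=
        (norm_indicator_le_norm_self _ _).trans (norm_inv_add_mul_I_le (hcosh p))
      refine (mul_le_mul_of_nonneg_left hb (Real.exp_pos _).le).trans ?_
      rw [abs_of_pos (by positivity), exp_add_exp_eq, mul_one_div]
      have h1 := Real.one_le_cosh ((p.1 - p.2) / 2)
      have h2 := Real.exp_pos ((p.1 + p.2) / 2)
      rw [div_le_one (by positivity)]
      have h3 : 1 ≤ 2 * Real.pi * (2 * Real.cosh ((p.1 - p.2) / 2)) := by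
        nlinarith [Real.pi_gt_three]
      nlinarith
    · refine ae_of_all _ fun p => Tendsto.const_mul _ ?_
      by_cases h : p.2 < p.1
      · have m1 : (Real.exp p.1, Real.exp p.2) ∈ {p : ℝ × ℝ | p.2 < p.1} := Real.exp_lt_exp.2 h
        have m2 : p.1 - p.2 ∈ Set.Ioi (0 : ℝ) := sub_pos.2 h
        simp_rw [Set.indicator_of_mem m1]
        simp only [k]
        rw [Set.indicator_of_mem m2]
        convert (tendsto_inv_add_mul_I (hcosh p)).const_mul (Real.exp ((p.1 + p.2) / 2) : ℂ) using 2
        rw [exp_add_exp_eq]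
        have h1 := (Real.cosh_pos ((p.1 - p.2) / 2)).ne'
        have h2 := (Real.exp_pos ((p.1 + p.2) / 2)).ne'
        have h1' : (Real.cosh ((p.1 - p.2) / 2) : ℂ) ≠ 0 := by exact_mod_cast h1
        have h2' : (Real.exp ((p.1 + p.2) / 2) : ℂ) ≠ 0 := by exact_mod_cast h2
        have h3' : (Real.pi : ℂ) ≠ 0 := by exact_mod_cast Real.pi_ne_zero
        rw [Complex.ofReal_mul, Complex.ofReal_mul, Complex.ofReal_div]
        field_simp
        push_cast
        norm_num
      · have m1 : (Real.exp p.1, Real.exp p.2) ∉ {p : ℝ × ℝ | p.2 < p.1} := fun h' =>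
          h (Real.exp_lt_exp.1 h')
        have m2 : p.1 - p.2 ∉ Set.Ioi (0 : ℝ) := fun h' => h (sub_pos.1 h')
        simp_rw [Set.indicator_of_notMem m1]
        simp only [k]
        rw [Set.indicator_of_notMem m2]
        simp
  rw [tendsto_nhds_unique hlim1 hlim2, integral_mul_correlation hki hkm]
  refine integral_congr_ae (ae_of_all _ fun τ => ?_)
  dsimp only
  congr 1
  have e : ∀ r : ℝ, k r * Complex.exp ((2 * Real.pi * r * τ : ℝ) * I) =
      (Set.Ioi (0 : ℝ)).indicator (fun r => 1 / (4 * Real.pi * I) *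
        (Complex.exp ((2 * Real.pi * r * τ : ℝ) * I) / (Real.cosh (r / 2) : ℂ))) r := fun r => by
    by_cases h : r ∈ Set.Ioi (0 : ℝ)
    · simp only [k]
      rw [Set.indicator_of_mem h, Set.indicator_of_mem h]
      push_cast
      ring
    · simp only [k]
      rw [Set.indicator_of_notMem h, Set.indicator_of_notMem h, zero_mul]
  simp_rw [e]
  rw [integral_indicator measurableSet_Ioi, integral_const_mul, quarterOffDiag, map_mul, ← integral_conj]
  congr 1
  · rw [map_div₀, Complex.conj_I, Complex.conj_ofReal]
    have h3' : (Real.pi : ℂ) ≠ 0 := by exact_mod_cast Real.pi_ne_zero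
    field_simp
    push_cast
    linear_combination (4 * Real.pi : ℂ) * Complex.I_sq
  · refine integral_congr_ae (ae_of_all _ fun r => ?_)
    dsimp only
    rw [map_div₀, ← Complex.exp_conj, map_mul, Complex.conj_I, Complex.conj_ofReal]
    congr 2
    rw [map_neg, Complex.conj_ofReal]
    ring

/-! ### The diagonal block: avoiding the principal value -/

theorem wigner_conj_conj (f g : ℝ → ℂ) (X : ℝ × ℝ) :
    wigner (fun x => starRingEnd ℂ (f x)) (fun x => starRingEnd ℂ (g x)) X =
      starRingEnd ℂ (wigner f g (X.1, -X.2)) := by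
  rw [wigner, wigner, ← integral_conj]
  refine integral_congr_ae (ae_of_all _ fun z => ?_)
  dsimp only
  rw [map_mul, map_mul, ← Complex.exp_conj, map_mul, Complex.conj_I]
  congr 3
  rw [map_neg, Complex.conj_ofReal]
  push_cast
  ring

theorem wigner_self_conj (f : ℝ → ℂ) (X : ℝ × ℝ) :
    wigner (fun x => starRingEnd ℂ (f x)) (fun x => starRingEnd ℂ (f x)) X =
      wigner f f (X.1, -X.2) := by
  rw [wigner_conj_conj, ← wigner_conj]

theorem integrable_wigner_conj (u : 𝓢(ℝ, ℂ)) :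
    Integrable (wigner (fun x => starRingEnd ℂ (u x)) (fun x => starRingEnd ℂ (u x))) :=
  (measurePreserving_neg_snd.integrable_comp_of_integrable (integrable_wigner u u)).congr
    (ae_of_all _ fun X => (wigner_self_conj u X).symm)

/-- Conjugating u reflects its Wigner distribution in ξ, and the quarter plane with its mirror image
fills the half plane x ≥ 0, which carries all of the Wigner distribution of u. -/
theorem weylForm_quarterPlane_add_conj (u : 𝓢(ℝ, ℂ)) (hu : ∀ x < 0, u x = 0) :
    weylForm (indicatorSymbol quarterPlane) u u +
      weylForm (indicatorSymbol quarterPlane) (fun x => starRingEnd ℂ (u x))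
        (fun x => starRingEnd ℂ (u x)) = ∫ x, u x * starRingEnd ℂ (u x) := by
  have hq := unitSymbol_indicator measurableSet_quarterPlane
  have hq' : UnitSymbol (indicatorSymbol quarterPlane ∘ fun X : ℝ × ℝ => (X.1, -X.2)) :=
    hq.comp (by fun_prop)
  have h1 := weylForm_fst (S := Set.univ) MeasurableSet.univ u u
  rw [Set.indicator_univ] at h1
  rw [← h1]
  have h2 : weylForm (indicatorSymbol quarterPlane) (fun x => starRingEnd ℂ (u x))
        (fun x => starRingEnd ℂ (u x)) =
      weylForm (indicatorSymbol quarterPlane ∘ fun X : ℝ × ℝ => (X.1, -X.2)) u u := by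
    rw [weylForm, weylForm]
    have hm : StronglyMeasurable fun X : ℝ × ℝ =>
        (indicatorSymbol quarterPlane ∘ fun X : ℝ × ℝ => (X.1, -X.2)) X * wigner u u X :=
      hq'.1.mul (continuous_wigner u u).stronglyMeasurable
    rw [← measurePreserving_neg_snd.integral_comp_sm hm]
    refine integral_congr_ae (ae_of_all _ fun X => ?_)
    dsimp only
    rw [wigner_self_conj, Function.comp_apply, neg_neg]
  rw [h2, weylForm, weylForm, weylForm, ← integral_add (hq.integrable_mul (integrable_wigner u u))
    (hq'.integrable_mul (integrable_wigner u u))]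
  have h0 : ∀ᵐ X : ℝ × ℝ, X.2 ≠ 0 := by
    have h2 : Measure.QuasiMeasurePreserving (Prod.snd : ℝ × ℝ → ℝ) volume volume :=
      Measure.quasiMeasurePreserving_snd
    exact h2.ae (p := fun x => x ≠ 0) (by simp [ae_iff])
  refine integral_congr_ae (h0.mono fun X hX => ?_)
  dsimp only
  rw [← add_mul]
  rcases lt_or_ge X.1 0 with h | h
  · rw [wigner_eq_zero_of_neg hu hu h, mul_zero, mul_zero]
  · congr 1
    simp only [indicatorSymbol, Function.comp_apply, Set.preimage_univ, Set.indicator_univ]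
    rcases lt_or_gt_of_ne hX with h' | h'
    · have m1 : X ∉ quarterPlane := fun hh => absurd hh.2 (not_le.2 h')
      have m2 : (X.1, -X.2) ∈ quarterPlane := ⟨h, by simp only; linarith⟩
      rw [Set.indicator_of_notMem m1, Set.indicator_of_mem m2, zero_add]
    · have m1 : X ∈ quarterPlane := ⟨h, h'.le⟩
      have m2 : (X.1, -X.2) ∉ quarterPlane := fun hh => by have := hh.2; simp only at this; linarith
      rw [Set.indicator_of_mem m1, Set.indicator_of_notMem m2, add_zero]

theorem half_abs_le_abs_sinh_half (r : ℝ) : |r| / 2 ≤ |Real.sinh (r / 2)| := by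
  rw [Real.abs_sinh, abs_div, abs_two]
  exact Real.self_le_sinh_iff.2 (by positivity)

theorem weylForm_exp_quarterPlane_halfLineLift {f : ℝ → ℂ} (hf : ContDiff ℝ ∞ f)
    (hc : HasCompactSupport f) {ε : ℝ} (hε : 0 < ε) :
    weylForm (fun X => indicatorSymbol quarterPlane X * Complex.exp (-(ε * X.2 : ℝ)))
      (halfLineLift f) (halfLineLift f) =
      ∫ p : ℝ × ℝ, f p.1 * starRingEnd ℂ (f p.2) * ((Real.exp ((p.1 + p.2) / 2) : ℂ) *
        (1 / (ε + 2 * Real.pi * (Real.exp p.1 - Real.exp p.2 : ℝ) * I))) := by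
  obtain ⟨h1, h2⟩ := exists_halfLineLift hf hc
  have hi : Integrable (halfLineLift f) := h1.continuous.integrable_of_hasCompactSupport h2
  have hm := h1.continuous.stronglyMeasurable
  have key := integral_halfLineLift_tensor hf.continuous hc hf.continuous hc hi hi
    (K := fun p => 1 / (ε + 2 * Real.pi * (p.1 - p.2 : ℝ) * I)) (by fun_prop) (C := 1 / ε)
    (fun p _ _ => norm_inv_add_mul_I_le_inv hε _)
  rw [weylForm_exp_quarterPlane hm hi hm hi hε, ← key]
  refine integral_congr_ae (ae_of_all _ fun p => ?_)
  dsimp only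
  by_cases h : p ∈ {p : ℝ × ℝ | 0 ≤ p.1 + p.2}
  · rw [Set.indicator_of_mem h, mul_one_div]
  · rw [Set.indicator_of_notMem h]
    have h' : p.1 + p.2 < 0 := not_le.1 h
    rcases lt_or_ge p.1 0 with h3 | h3
    · rw [halfLineLift_of_nonpos f h3.le]; simp
    · rw [halfLineLift_of_nonpos f (x := p.2) (by linarith)]; simp

/-- The imaginary part of `f(x) conj(f(y))`, times `2i`. -/
noncomputable def antisymTensor (f : ℝ → ℂ) (p : ℝ × ℝ) : ℂ :=
  f p.1 * starRingEnd ℂ (f p.2) - starRingEnd ℂ (f p.1) * f p.2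

/-- Antisymmetrisation makes the tensor vanish on the diagonal at a Lipschitz rate, which
compensates the singularity 1/(x-y) of the kernel. -/
theorem norm_antisymTensor_le {f : ℝ → ℂ} (hf : ContDiff ℝ ∞ f) (hc : HasCompactSupport f) :
    ∃ G : ℝ × ℝ → ℝ, Integrable G ∧ Measurable G ∧ (∀ p, 0 ≤ G p) ∧
      ∀ p, ‖antisymTensor f p‖ ≤ |p.1 - p.2| * G p := by
  obtain ⟨L, hL⟩ := ContDiff.lipschitzWith_of_hasCompactSupport hc hf (by simp)
  have hK : MeasurableSet (tsupport f) := (isClosed_tsupport f).measurableSet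
  have hi : Integrable ((tsupport f).indicator fun _ : ℝ => (1 : ℝ)) := by
    rw [integrable_indicator_iff hK]
    exact integrableOn_const hc.isCompact.measure_lt_top.ne
  refine ⟨fun p => (tsupport f).indicator (fun _ => (1 : ℝ)) p.1 * (2 * L * ‖f p.2‖), ?_, ?_, ?_, ?_⟩
  · exact hi.mul_prod ((hf.continuous.integrable_of_hasCompactSupport hc).norm.const_mul _)
  · have h1 : Measurable ((tsupport f).indicator fun _ : ℝ => (1 : ℝ)) :=
      measurable_const.indicator hK
    have := hf.continuous.measurable
    fun_prop
  · intro p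
    have := Set.indicator_nonneg (s := tsupport f) (f := fun _ : ℝ => (1 : ℝ)) (fun _ _ => zero_le_one) p.1
    positivity
  · intro p
    by_cases h : p.1 ∈ tsupport f
    · dsimp only
      rw [Set.indicator_of_mem h, one_mul]
      have e : antisymTensor f p = (f p.1 - f p.2) * starRingEnd ℂ (f p.2) -
          starRingEnd ℂ (f p.1 - f p.2) * f p.2 := by
        rw [antisymTensor, map_sub]; ring
      have h2 := hL.dist_le_mul p.1 p.2
      rw [dist_eq_norm, Real.dist_eq] at h2
      rw [e]
      refine (norm_sub_le _ _).trans ?_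
      rw [norm_mul, norm_mul, RCLike.norm_conj, RCLike.norm_conj]
      nlinarith [norm_nonneg (f p.2)]
    · have h0 : f p.1 = 0 := image_eq_zero_of_notMem_tsupport h
      dsimp only
      rw [antisymTensor, h0, Set.indicator_of_notMem h]
      simp

theorem continuous_antisymTensor {f : ℝ → ℂ} (hf : Continuous f) : Continuous (antisymTensor f) := by
  have := Complex.continuous_conj
  unfold antisymTensor
  fun_prop

/-- The kernel of the imaginary part of the diagonal block, in logarithmic coordinates. -/
noncomputable def sinhKernel (r : ℝ) : ℂ := 1 / (4 * Real.pi * (Real.sinh (r / 2) : ℝ) * I)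

theorem measurable_sinhKernel : Measurable sinhKernel := by unfold sinhKernel; fun_prop

theorem norm_sinhKernel (r : ℝ) : ‖sinhKernel r‖ = 1 / (4 * Real.pi * |Real.sinh (r / 2)|) := by
  rw [sinhKernel, norm_div, norm_mul, norm_mul, norm_mul, Complex.norm_I, Complex.norm_real,
    Complex.norm_real, Real.norm_of_nonneg Real.pi_pos.le, Real.norm_eq_abs]
  simp

theorem abs_mul_norm_sinhKernel_le (r : ℝ) : |r| * ‖sinhKernel r‖ ≤ 1 := by
  rw [norm_sinhKernel, mul_one_div]
  refine div_le_one_of_le₀ ?_ (by positivity)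
  have := half_abs_le_abs_sinh_half r
  nlinarith [Real.pi_gt_three, abs_nonneg (Real.sinh (r / 2))]

/-- Write 2B(u) as the sum of B(u) + B(ū), which is the mass, and B(u) - B(ū), whose tensor is
antisymmetric. The limit ε → 0 is then absolutely convergent although the kernel 1/(s-t) is not
locally integrable. -/
theorem two_mul_weylForm_quarterPlane_diag (f u : 𝓢(ℝ, ℂ)) (hf : HasCompactSupport f)
    (hu : ∀ x, u x = halfLineLift f x) :
    2 * weylForm (indicatorSymbol quarterPlane) u u = (∫ t, f t * starRingEnd ℂ (f t)) +
      ∫ p : ℝ × ℝ, antisymTensor f p * sinhKernel (p.1 - p.2) := by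
  have hu' : (u : ℝ → ℂ) = halfLineLift f := funext hu
  set fc : ℝ → ℂ := fun x => starRingEnd ℂ (f x)
  have hfd : ContDiff ℝ ∞ f := f.smooth'
  have hfcd : ContDiff ℝ ∞ fc := Complex.conjCLE.contDiff.comp hfd
  have hfcc : HasCompactSupport fc := hf.comp_left (map_zero _)
  have huc : (fun x => starRingEnd ℂ (u x)) = halfLineLift fc := by
    ext x
    rw [hu]
    by_cases h : x ∈ Set.Ioi (0 : ℝ)
    · rw [halfLineLift, halfLineLift, Set.indicator_of_mem h, Set.indicator_of_mem h, map_mul,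
        Complex.conj_ofReal]
    · rw [halfLineLift, halfLineLift, Set.indicator_of_notMem h, Set.indicator_of_notMem h, map_zero]
  have h0 := weylForm_quarterPlane_add_conj u fun x hx => by
    rw [hu, halfLineLift_of_nonpos _ hx.le]
  have hmass : ∫ x, u x * starRingEnd ℂ (u x) = ∫ t, f t * starRingEnd ℂ (f t) := by
    rw [← norm_halfLineLift_sq f]
    simp_rw [hu]
  rw [hmass] at h0
  have l1 := tendsto_weylForm_exp_quarterPlane (integrable_wigner u u)
  have l2 := tendsto_weylForm_exp_quarterPlane (integrable_wigner_conj u)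
  obtain ⟨G, hGi, hGm, hG0, hG⟩ := norm_antisymTensor_le hfd hf
  have hker : ∀ {ε : ℝ} (p : ℝ × ℝ), p.1 ≠ p.2 → ‖(Real.exp ((p.1 + p.2) / 2) : ℂ) *
        (1 / (ε + 2 * Real.pi * (Real.exp p.1 - Real.exp p.2 : ℝ) * I))‖ ≤
      ‖sinhKernel (p.1 - p.2)‖ := by
    intro ε p hp
    have hne : Real.exp p.1 - Real.exp p.2 ≠ 0 := sub_ne_zero.2 fun h => hp (Real.exp_injective h)
    have hs : 0 < |Real.sinh ((p.1 - p.2) / 2)| := by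
      have := half_abs_le_abs_sinh_half (p.1 - p.2)
      have := abs_pos.2 (sub_ne_zero.2 hp)
      linarith
    have h2 := Real.exp_pos ((p.1 + p.2) / 2)
    rw [norm_mul, Complex.norm_real, Real.norm_of_nonneg h2.le, norm_sinhKernel]
    refine (mul_le_mul_of_nonneg_left (norm_inv_add_mul_I_le hne) h2.le).trans (le_of_eq ?_)
    rw [exp_sub_exp_eq, abs_mul, abs_mul, abs_two, abs_of_pos h2]
    field_simp
    norm_num
  have l3 : Tendsto (fun ε : ℝ => weylForm (fun X => indicatorSymbol quarterPlane X *
      Complex.exp (-(ε * X.2 : ℝ))) u u - weylForm (fun X => indicatorSymbol quarterPlane X *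
      Complex.exp (-(ε * X.2 : ℝ))) (fun x => starRingEnd ℂ (u x)) (fun x => starRingEnd ℂ (u x)))
      (𝓝[>] 0) (𝓝 (∫ p : ℝ × ℝ, antisymTensor f p * sinhKernel (p.1 - p.2))) := by
    refine Tendsto.congr' (f₁ := fun ε : ℝ => ∫ p : ℝ × ℝ, antisymTensor f p *
      ((Real.exp ((p.1 + p.2) / 2) : ℂ) *
        (1 / (ε + 2 * Real.pi * (Real.exp p.1 - Real.exp p.2 : ℝ) * I)))) ?_ ?_
    · filter_upwards [self_mem_nhdsWithin] with ε hε
      have hε' : 0 < ε := hε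
      have hi : ∀ {g : ℝ → ℂ}, ContDiff ℝ ∞ g → HasCompactSupport g → Integrable fun p : ℝ × ℝ =>
          g p.1 * starRingEnd ℂ (g p.2) * ((Real.exp ((p.1 + p.2) / 2) : ℂ) *
          (1 / (ε + 2 * Real.pi * (Real.exp p.1 - Real.exp p.2 : ℝ) * I))) := by
        intro g hg hgc
        have hE : Integrable fun x : ℝ => (Real.exp (x / 2) : ℂ) * g x :=
          Continuous.integrable_of_hasCompactSupport
            (by have := hg.continuous; fun_prop) hgc.mul_left
        refine ((integrable_tensor hE hE).mul_bdd (c := 1 / ε) (g := fun p : ℝ × ℝ =>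
          1 / (ε + 2 * Real.pi * (Real.exp p.1 - Real.exp p.2 : ℝ) * I))
          (Measurable.aestronglyMeasurable (by fun_prop))
          (ae_of_all _ fun p => norm_inv_add_mul_I_le_inv hε' _)).congr (ae_of_all _ fun p => ?_)
        dsimp only
        rw [map_mul, Complex.conj_ofReal, add_div, Real.exp_add]
        push_cast
        ring
      rw [huc, hu', weylForm_exp_quarterPlane_halfLineLift hfd hf hε',
        weylForm_exp_quarterPlane_halfLineLift hfcd hfcc hε', ← integral_sub (hi hfd hf) (hi hfcd hfcc)]
      refine integral_congr_ae (ae_of_all _ fun p => ?_)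
      simp only [fc, antisymTensor, Complex.conj_conj]
      ring
    · refine tendsto_integral_filter_of_dominated_convergence G ?_ ?_ hGi ?_
      · refine Eventually.of_forall fun ε => (Measurable.aestronglyMeasurable ?_)
        have := (continuous_antisymTensor f.continuous).measurable
        fun_prop
      · refine Eventually.of_forall fun ε => ae_of_all _ fun p => ?_
        by_cases hp : p.1 = p.2
        · have := hG p
          rw [hp, sub_self, abs_zero, zero_mul, norm_le_zero_iff] at this
          rw [this, zero_mul, norm_zero]
          exact hG0 p
        · rw [norm_mul]
          calc _ ≤ (|p.1 - p.2| * G p) * ‖sinhKernel (p.1 - p.2)‖ :=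
                mul_le_mul (hG p) (hker p hp) (norm_nonneg _)
                  (mul_nonneg (abs_nonneg _) (hG0 p))
            _ = (|p.1 - p.2| * ‖sinhKernel (p.1 - p.2)‖) * G p := by ring
            _ ≤ 1 * G p := mul_le_mul_of_nonneg_right (abs_mul_norm_sinhKernel_le _) (hG0 p)
            _ = G p := one_mul _
      · refine ae_of_all _ fun p => ?_
        by_cases hp : p.1 = p.2
        · have := hG p
          rw [hp, sub_self, abs_zero, zero_mul, norm_le_zero_iff] at this
          simp only [this, zero_mul]
          exact tendsto_const_nhds
        · refine Tendsto.const_mul _ ?_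
          have hne : Real.exp p.1 - Real.exp p.2 ≠ 0 :=
            sub_ne_zero.2 fun h => hp (Real.exp_injective h)
          convert (tendsto_inv_add_mul_I hne).const_mul (Real.exp ((p.1 + p.2) / 2) : ℂ) using 2
          have h1 : Real.sinh ((p.1 - p.2) / 2) ≠ 0 := by
            rw [Ne, Real.sinh_eq_zero]
            intro h
            exact hp (by linarith)
          have h1' : (Real.sinh ((p.1 - p.2) / 2) : ℂ) ≠ 0 := by exact_mod_cast h1
          have h2' : (Real.exp ((p.1 + p.2) / 2) : ℂ) ≠ 0 := by
            exact_mod_cast (Real.exp_pos ((p.1 + p.2) / 2)).ne'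
          have h3' : (Real.pi : ℂ) ≠ 0 := by exact_mod_cast Real.pi_ne_zero
          rw [exp_sub_exp_eq, sinhKernel, Complex.ofReal_mul, Complex.ofReal_mul]
          field_simp
          push_cast
          norm_num
  have l4 := tendsto_nhds_unique (l1.sub l2) l3
  rw [← l4, ← h0]
  ring

theorem integrable_div_sinh_half : Integrable fun r : ℝ => r / Real.sinh (r / 2) := by
  have h := integrableOn_div_sinh_half
  have h2 : IntegrableOn (fun r : ℝ => r / Real.sinh (r / 2)) (Set.Iic 0) := by
    rw [integrableOn_Iic_iff_integrableOn_Iio]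
    refine (IntegrableOn.comp_neg_Iio (f := fun r : ℝ => r / Real.sinh (r / 2)) (c := 0)
      (by rw [neg_zero]; exact h)).congr_fun (fun r _ => ?_) measurableSet_Iio
    dsimp only
    rw [neg_div 2 r, Real.sinh_neg, neg_div_neg_eq]
  rw [← integrableOn_univ, ← Set.Iic_union_Ioi (a := (0 : ℝ))]
  exact h2.union h

theorem integral_sin_div_sinh_univ (τ : ℝ) :
    ∫ r, Real.sin (2 * Real.pi * r * τ) / Real.sinh (r / 2) =
      2 * ∫ r in Set.Ioi (0 : ℝ), Real.sin (2 * Real.pi * r * τ) / Real.sinh (r / 2) := by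
  rw [← integral_comp_abs (f := fun r => Real.sin (2 * Real.pi * r * τ) / Real.sinh (r / 2))]
  refine integral_congr_ae (ae_of_all _ fun r => ?_)
  dsimp only
  rcases abs_choice r with h | h <;> rw [h]
  rw [show 2 * Real.pi * -r * τ = -(2 * Real.pi * r * τ) by ring, Real.sin_neg,
    neg_div 2 r, Real.sinh_neg, neg_div_neg_eq]

/-- The correlation of f minus its conjugate has Fourier density 2i sin(2πrτ)|f̂(τ)|²; against
1/(4πi sinh(r/2)) and over both signs of r this gives 2d(τ) - 1. -/
theorem integral_antisymTensor_sinhKernel (f : 𝓢(ℝ, ℂ)) (hf : HasCompactSupport f) :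
    ∫ p : ℝ × ℝ, antisymTensor f p * sinhKernel (p.1 - p.2) =
      ∫ τ, 𝓕 (f : ℝ → ℂ) τ * starRingEnd ℂ (𝓕 (f : ℝ → ℂ) τ) * ((2 * quarterDiag τ - 1 : ℝ) : ℂ) := by
  obtain ⟨G, hGi, hGm, hG0, hG⟩ := norm_antisymTensor_le f.smooth' hf
  have hF : Measurable fun p : ℝ × ℝ => antisymTensor f p * sinhKernel (p.1 - p.2) := by
    have := (continuous_antisymTensor f.continuous).measurable
    have := measurable_sinhKernel
    fun_prop
  have hFi : Integrable fun p : ℝ × ℝ => antisymTensor f p * sinhKernel (p.1 - p.2) := by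
    refine hGi.mono' hF.aestronglyMeasurable (ae_of_all _ fun p => ?_)
    rw [norm_mul]
    calc _ ≤ (|p.1 - p.2| * G p) * ‖sinhKernel (p.1 - p.2)‖ :=
          mul_le_mul_of_nonneg_right (hG p) (norm_nonneg _)
      _ = (|p.1 - p.2| * ‖sinhKernel (p.1 - p.2)‖) * G p := by ring
      _ ≤ 1 * G p := mul_le_mul_of_nonneg_right (abs_mul_norm_sinhKernel_le _) (hG0 p)
      _ = G p := one_mul _
  have hT : MeasurePreserving (fun p : ℝ × ℝ => (p.2 + p.1, p.2)) volume volume := by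
    have h := measurePreserving_shear_fst (h := fun x => x) measurable_id
    convert h using 2 with p
    rw [add_comm]
  have hFT := hT.integrable_comp_of_integrable hFi
  set h : ℝ → ℂ := fun τ => 𝓕 (f : ℝ → ℂ) τ * starRingEnd ℂ (𝓕 (f : ℝ → ℂ) τ)
  have hreal : ∀ τ, starRingEnd ℂ (h τ) = h τ := fun τ => by
    simp only [h]; rw [map_mul, Complex.conj_conj, mul_comm]
  have hhi : Integrable h := by
    have := integrable_mul_of_sqInt (sqInt_schwartz (𝓕 f)) (sqInt_schwartz (𝓕 f)).conj
    simpa only [SchwartzMap.fourier_coe] using this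
  have hhm : Continuous h := by
    have h1 := (𝓕 f : 𝓢(ℝ, ℂ)).continuous
    rw [SchwartzMap.fourier_coe] at h1
    have := Complex.continuous_conj
    simp only [h]
    fun_prop
  have hh1 : Integrable fun τ : ℝ => (τ : ℂ) * h τ := by
    obtain ⟨C, hC0, hC⟩ := (𝓕 f : 𝓢(ℝ, ℂ)).exists_norm_le_inv_one_add_sq_pow 1
    have hi := ((𝓕 f : 𝓢(ℝ, ℂ)).integrable (μ := volume)).norm.const_mul C
    rw [SchwartzMap.fourier_coe] at hi hC
    refine hi.mono' (Continuous.aestronglyMeasurable (by fun_prop)) (ae_of_all _ fun τ => ?_)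
    have := hC τ
    rw [pow_one] at this
    simp only [h]
    rw [norm_mul, norm_mul, RCLike.norm_conj, Complex.norm_real, Real.norm_eq_abs, ← mul_assoc]
    refine mul_le_mul_of_nonneg_right (le_trans ?_ this) (norm_nonneg _)
    refine mul_le_mul_of_nonneg_right ?_ (norm_nonneg _)
    nlinarith [sq_abs τ, sq_nonneg (|τ| - 1)]
  set S : ℝ → ℝ → ℂ := fun r τ => h τ * ((1 / (2 * Real.pi) *
    (Real.sin (2 * Real.pi * r * τ) / Real.sinh (r / 2)) : ℝ) : ℂ)
  -- From |sin(2πrτ)| ≤ 2π|r||τ| the integrand is dominated by the product of r/sinh(r/2) and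
  -- |τ||f̂(τ)|², both integrable.
  have hS : Integrable (Function.uncurry S) (volume.prod volume) := by
    refine (integrable_div_sinh_half.mul_prod hh1.norm).mono ?_ (ae_of_all _ fun p => ?_)
    · refine Measurable.aestronglyMeasurable ?_
      have := hhm.measurable
      simp only [S, Function.uncurry_def]
      fun_prop
    · change ‖h p.2 * ((1 / (2 * Real.pi) *
        (Real.sin (2 * Real.pi * p.1 * p.2) / Real.sinh (p.1 / 2)) : ℝ) : ℂ)‖ ≤
        ‖p.1 / Real.sinh (p.1 / 2) * ‖(p.2 : ℂ) * h p.2‖‖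
      generalize h p.2 = w
      rw [norm_mul, norm_mul, norm_norm, norm_mul, Complex.norm_real, Complex.norm_real, norm_mul,
        norm_div (Real.sin _), norm_div p.1]
      have h1 : ‖Real.sin (2 * Real.pi * p.1 * p.2)‖ ≤ 2 * Real.pi * (‖p.1‖ * ‖p.2‖) := by
        have := Real.abs_sin_le_abs (x := 2 * Real.pi * p.1 * p.2)
        rw [abs_mul, abs_mul, abs_of_pos Real.two_pi_pos] at this
        rw [Real.norm_eq_abs, Real.norm_eq_abs, Real.norm_eq_abs]
        linarith
      have h2 : ‖1 / (2 * Real.pi)‖ = 1 / (2 * Real.pi) := Real.norm_of_nonneg (by positivity)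
      rw [h2]
      calc ‖w‖ * (1 / (2 * Real.pi) * (‖Real.sin (2 * Real.pi * p.1 * p.2)‖ / ‖Real.sinh (p.1 / 2)‖))
          ≤ ‖w‖ * (1 / (2 * Real.pi) * (2 * Real.pi * (‖p.1‖ * ‖p.2‖) / ‖Real.sinh (p.1 / 2)‖)) := by
            gcongr
        _ = _ := by
            have := Real.pi_ne_zero
            field_simp
  rw [← hT.integral_comp_sm hF.stronglyMeasurable, Measure.volume_eq_prod ℝ ℝ,
    integral_prod (fun p : ℝ × ℝ => antisymTensor f (p.2 + p.1, p.2) *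
      sinhKernel (p.2 + p.1 - p.2)) hFT]
  have e1 : ∀ r : ℝ, ∫ y, antisymTensor f (y + r, y) * sinhKernel (y + r - y) = ∫ τ, S r τ := by
    intro r
    have hci : Integrable fun y : ℝ => f (y + r) * starRingEnd ℂ (f y) :=
      integrable_mul_of_sqInt (sqInt_schwartz (f.compSubConstCLM ℂ (-r))) (sqInt_schwartz f).conj
        |>.congr (ae_of_all _ fun y => by simp)
    have hci' : Integrable fun y : ℝ => starRingEnd ℂ (f (y + r)) * f y :=
      (Complex.conjCLE.toContinuousLinearMap.integrable_comp hci).congr (ae_of_all _ fun y => by simp)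
    have hconj : ∫ y, starRingEnd ℂ (f (y + r)) * f y =
        starRingEnd ℂ (∫ y, f (y + r) * starRingEnd ℂ (f y)) := by
      rw [← integral_conj]
      refine integral_congr_ae (ae_of_all _ fun y => by simp)
    simp_rw [add_sub_cancel_left, integral_mul_const, antisymTensor]
    rw [integral_sub hci hci', hconj, integral_translate_mul_conj, ← integral_conj]
    have hei : Integrable fun τ : ℝ => h τ * Complex.exp ((2 * Real.pi * r * τ : ℝ) * I) :=
      hhi.mul_bdd (c := 1) (Continuous.aestronglyMeasurable (by fun_prop))
        (ae_of_all _ fun τ => (Complex.norm_exp_ofReal_mul_I _).le)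
    have hei' : Integrable fun τ : ℝ => starRingEnd ℂ (h τ * Complex.exp ((2 * Real.pi * r * τ : ℝ) * I)) :=
      Complex.conjCLE.toContinuousLinearMap.integrable_comp hei
    rw [← integral_sub hei hei', ← integral_mul_const]
    refine integral_congr_ae (ae_of_all _ fun τ => ?_)
    simp only [S]
    rw [map_mul, hreal, ← Complex.exp_conj, map_mul, Complex.conj_I, Complex.conj_ofReal, mul_neg,
      ← neg_mul, Complex.exp_mul_I, Complex.exp_mul_I, Complex.cos_neg, Complex.sin_neg, sinhKernel]
    have h3' : (Real.pi : ℂ) ≠ 0 := by exact_mod_cast Real.pi_ne_zero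
    push_cast
    by_cases h0 : Complex.sinh (r / 2) = 0
    · rw [h0]; simp
    · field_simp
      ring
  simp_rw [e1]
  rw [integral_integral_swap hS]
  refine integral_congr_ae (ae_of_all _ fun τ => ?_)
  simp only [S]
  rw [integral_const_mul, integral_complex_ofReal, integral_const_mul, integral_sin_div_sinh_univ,
    quarterDiag]
  congr 2
  ring

/-- The diagonal part of the form of the quarter plane, in logarithmic coordinates. -/
theorem weylForm_quarterPlane_diag (f u : 𝓢(ℝ, ℂ)) (hf : HasCompactSupport f)
    (hu : ∀ x, u x = halfLineLift f x) :
    weylForm (indicatorSymbol quarterPlane) u u =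
      ∫ τ, 𝓕 (f : ℝ → ℂ) τ * starRingEnd ℂ (𝓕 (f : ℝ → ℂ) τ) * (quarterDiag τ : ℂ) := by
  have h := two_mul_weylForm_quarterPlane_diag f u hf hu
  have hhi : Integrable fun τ => 𝓕 (f : ℝ → ℂ) τ * starRingEnd ℂ (𝓕 (f : ℝ → ℂ) τ) := by
    have := integrable_mul_of_sqInt (sqInt_schwartz (𝓕 f)) (sqInt_schwartz (𝓕 f)).conj
    simpa only [SchwartzMap.fourier_coe] using this
  have hhi' : Integrable fun τ => 𝓕 (f : ℝ → ℂ) τ * starRingEnd ℂ (𝓕 (f : ℝ → ℂ) τ) *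
      ((2 * quarterDiag τ - 1 : ℝ) : ℂ) := by
    refine hhi.mul_bdd (c := 1) (Continuous.aestronglyMeasurable ?_) (ae_of_all _ fun τ => ?_)
    · have := continuous_quarterDiag
      fun_prop
    · rw [Complex.norm_real, Real.norm_eq_abs, abs_le]
      constructor <;> linarith [quarterDiag_pos τ, quarterDiag_lt_one τ]
  rw [integral_antisymTensor_sinhKernel f hf, integral_mul_conj_eq_fourier,
    ← integral_add hhi hhi'] at h
  have e : ∀ τ, 𝓕 (f : ℝ → ℂ) τ * starRingEnd ℂ (𝓕 (f : ℝ → ℂ) τ) +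
      𝓕 (f : ℝ → ℂ) τ * starRingEnd ℂ (𝓕 (f : ℝ → ℂ) τ) * ((2 * quarterDiag τ - 1 : ℝ) : ℂ) =
      2 * (𝓕 (f : ℝ → ℂ) τ * starRingEnd ℂ (𝓕 (f : ℝ → ℂ) τ) * (quarterDiag τ : ℂ)) := fun τ => by
    push_cast
    ring
  simp_rw [e, integral_const_mul] at h
  exact mul_left_cancel₀ two_ne_zero h

/-! ### The form as a matrix multiplier, and density of its domain -/

/-- The function on the line which is given on each half line by its logarithmic coordinate. -/
noncomputable def lineLift (f g : ℝ → ℂ) (x : ℝ) : ℂ := halfLineLift f x + halfLineLift g (-x)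

theorem lineLift_exp (f g : ℝ → ℂ) (t : ℝ) :
    lineLift f g (Real.exp t) = Real.exp (-(t / 2)) * f t := by
  rw [lineLift, halfLineLift_exp, halfLineLift_of_nonpos g (neg_nonpos.2 (Real.exp_pos t).le), add_zero]

theorem lineLift_neg_exp (f g : ℝ → ℂ) (t : ℝ) :
    lineLift f g (-Real.exp t) = Real.exp (-(t / 2)) * g t := by
  rw [lineLift, neg_neg, halfLineLift_exp, halfLineLift_of_nonpos f (neg_nonpos.2 (Real.exp_pos t).le),
    zero_add]

/-- The Hermitian form of the matrix `M₀(τ)`. -/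
noncomputable def quarterMatrixForm (τ : ℝ) (z w : ℂ) : ℝ :=
  quarterDiag τ * ‖z‖ ^ 2 + 2 * (z * starRingEnd ℂ w * starRingEnd ℂ (quarterOffDiag τ)).re

theorem neg_half_le_quarterMatrixForm (τ : ℝ) (z w : ℂ) :
    -(1 / 2) * (‖z‖ ^ 2 + ‖w‖ ^ 2) ≤ quarterMatrixForm τ z w := by
  have h1 := Complex.abs_re_le_norm (z * starRingEnd ℂ w * starRingEnd ℂ (quarterOffDiag τ))
  rw [norm_mul, norm_mul, RCLike.norm_conj, RCLike.norm_conj] at h1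
  have h2 := (abs_le.1 h1).1
  have h3 : ‖z‖ * ‖w‖ * ‖quarterOffDiag τ‖ ≤ ‖z‖ * ‖w‖ * (1 / 2) :=
    mul_le_mul_of_nonneg_left (norm_quarterOffDiag_le τ) (by positivity)
  have h4 := mul_nonneg (quarterDiag_pos τ).le (sq_nonneg ‖z‖)
  rw [quarterMatrixForm]
  nlinarith [sq_nonneg (‖z‖ - ‖w‖)]

theorem quarterTop_pos (τ : ℝ) : 0 < quarterTop τ :=
  (quarterDiag_pos τ).trans_le (quarterDiag_le_quarterTop τ)

theorem quarterMatrixForm_le (τ : ℝ) (z w : ℂ) :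
    quarterMatrixForm τ z w ≤ quarterTop τ * (‖z‖ ^ 2 + ‖w‖ ^ 2) := by
  have h1 := Complex.re_le_norm (z * starRingEnd ℂ w * starRingEnd ℂ (quarterOffDiag τ))
  rw [norm_mul, norm_mul, RCLike.norm_conj, RCLike.norm_conj] at h1
  have h2 := quarterTop_sq τ
  have h3 := quarterTop_pos τ
  set l := quarterTop τ
  set s := ‖quarterOffDiag τ‖
  rw [quarterMatrixForm]
  -- Multiply by l and complete the square, using l(l - d) = s².
  have h4 : 2 * (‖z‖ * ‖w‖ * s) ≤ (l - quarterDiag τ) * ‖z‖ ^ 2 + l * ‖w‖ ^ 2 := by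
    refine le_of_mul_le_mul_left ?_ h3
    have : l * (l - quarterDiag τ) = s ^ 2 := by linarith
    nlinarith [sq_nonneg (s * ‖z‖ - l * ‖w‖)]
  linarith

theorem quarterMatrixForm_eigenvector (τ : ℝ) :
    quarterMatrixForm τ (quarterTop τ) (starRingEnd ℂ (quarterOffDiag τ)) =
      quarterTop τ * (quarterTop τ ^ 2 + ‖quarterOffDiag τ‖ ^ 2) := by
  have h2 := quarterTop_sq τ
  rw [quarterMatrixForm, Complex.conj_conj, mul_assoc, Complex.mul_conj, ← Complex.ofReal_mul,
    Complex.ofReal_re, Complex.normSq_eq_norm_sq, Complex.norm_real, Real.norm_eq_abs, sq_abs]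
  linear_combination (-quarterTop τ) * h2

theorem quarterMatrixForm_smul (τ : ℝ) (c z w : ℂ) :
    quarterMatrixForm τ (z * c) (w * c) = quarterMatrixForm τ z w * ‖c‖ ^ 2 := by
  rw [quarterMatrixForm, quarterMatrixForm, map_mul, norm_mul,
    show z * c * (starRingEnd ℂ w * starRingEnd ℂ c) * starRingEnd ℂ (quarterOffDiag τ) =
      z * starRingEnd ℂ w * starRingEnd ℂ (quarterOffDiag τ) * (c * starRingEnd ℂ c) by ring,
    Complex.mul_conj, Complex.re_mul_ofReal, Complex.normSq_eq_norm_sq]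
  ring

theorem integrable_norm_sq_fourier (f : 𝓢(ℝ, ℂ)) : Integrable fun τ => ‖𝓕 (f : ℝ → ℂ) τ‖ ^ 2 := by
  have := (sqInt_schwartz (𝓕 f : 𝓢(ℝ, ℂ))).integrable_sq
  simpa only [SchwartzMap.fourier_coe] using this

theorem integrable_fourier_mul_conj (f g : 𝓢(ℝ, ℂ)) :
    Integrable fun τ => 𝓕 (f : ℝ → ℂ) τ * starRingEnd ℂ (𝓕 (g : ℝ → ℂ) τ) := by
  have := integrable_mul_of_sqInt (sqInt_schwartz (𝓕 f)) (sqInt_schwartz (𝓕 g)).conj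
  simpa only [SchwartzMap.fourier_coe] using this

theorem integrable_fourier_mul_conj_offDiag (f g : 𝓢(ℝ, ℂ)) :
    Integrable fun τ => 𝓕 (f : ℝ → ℂ) τ * starRingEnd ℂ (𝓕 (g : ℝ → ℂ) τ) *
      starRingEnd ℂ (quarterOffDiag τ) :=
  (integrable_fourier_mul_conj f g).mul_bdd (c := 1 / 2)
    ((Complex.continuous_conj.comp continuous_quarterOffDiag).aestronglyMeasurable)
    (ae_of_all _ fun τ => by rw [RCLike.norm_conj]; exact norm_quarterOffDiag_le τ)

theorem integrable_fourier_diag (f : 𝓢(ℝ, ℂ)) :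
    Integrable fun τ => quarterDiag τ * ‖𝓕 (f : ℝ → ℂ) τ‖ ^ 2 :=
  (integrable_norm_sq_fourier f).bdd_mul (c := 1) continuous_quarterDiag.aestronglyMeasurable
    (ae_of_all _ fun τ => by
      rw [Real.norm_of_nonneg (quarterDiag_pos τ).le]; exact (quarterDiag_lt_one τ).le)

theorem integrable_quarterMatrixForm (f g : 𝓢(ℝ, ℂ)) :
    Integrable fun τ => quarterMatrixForm τ (𝓕 (f : ℝ → ℂ) τ) (𝓕 (g : ℝ → ℂ) τ) :=
  (integrable_fourier_diag f).add ((integrable_fourier_mul_conj_offDiag f g).re.const_mul 2)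

theorem exists_lineLift {f g : ℝ → ℂ} (hf : ContDiff ℝ ∞ f) (hfc : HasCompactSupport f)
    (hg : ContDiff ℝ ∞ g) (hgc : HasCompactSupport g) : ∃ u : 𝓢(ℝ, ℂ), (u : ℝ → ℂ) = lineLift f g := by
  obtain ⟨h1, h2⟩ := exists_halfLineLift hf hfc
  obtain ⟨h3, h4⟩ := exists_halfLineLift hg hgc
  have h5 : HasCompactSupport fun x => halfLineLift g (-x) :=
    h4.comp_homeomorph (Homeomorph.neg ℝ)
  exact ⟨(h2.add h5).toSchwartzMap (h1.add (h3.comp contDiff_neg)), rfl⟩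

/-- Split u into its parts on the two half lines. The negative part does not interact with itself,
since its Wigner distribution lives in x < 0; this accounts for the zero entry of the matrix. -/
theorem weylForm_quarterPlane_lineLift (f g u : 𝓢(ℝ, ℂ)) (hf : HasCompactSupport f)
    (hg : HasCompactSupport g) (hu : (u : ℝ → ℂ) = lineLift f g) :
    weylForm (indicatorSymbol quarterPlane) u u =
      ((∫ τ, quarterMatrixForm τ (𝓕 (f : ℝ → ℂ) τ) (𝓕 (g : ℝ → ℂ) τ) : ℝ) : ℂ) ∧
    ∫ x, u x * starRingEnd ℂ (u x) =
      ((∫ τ, (‖𝓕 (f : ℝ → ℂ) τ‖ ^ 2 + ‖𝓕 (g : ℝ → ℂ) τ‖ ^ 2) : ℝ) : ℂ) := by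
  have hz : ContDiff ℝ ∞ (fun _ : ℝ => (0 : ℂ)) := contDiff_const
  have hzc : HasCompactSupport (fun _ : ℝ => (0 : ℂ)) := HasCompactSupport.zero
  have hl0 : ∀ x, halfLineLift (fun _ => 0) x = 0 := fun x => by
    rw [halfLineLift]; simp
  obtain ⟨v, hv⟩ := exists_lineLift f.smooth' hf hz hzc
  obtain ⟨w, hw⟩ := exists_lineLift hz hzc g.smooth' hg
  have hv' : ∀ x, v x = halfLineLift f x := fun x => by
    rw [hv, lineLift, hl0, add_zero]; rfl
  have hw' : ∀ x, w x = halfLineLift g (-x) := fun x => by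
    rw [hw, lineLift, hl0, zero_add]; rfl
  have huvw : u = v + w := by
    ext x
    rw [add_apply, hu, hv', hw', lineLift]
  have hq := unitSymbol_indicator measurableSet_quarterPlane
  have hvw := weylForm_quarterPlane_offDiag f g v w hf hg hv' hw'
  have hvv := weylForm_quarterPlane_diag f v hf hv'
  have hwv : weylForm (indicatorSymbol quarterPlane) w v =
      starRingEnd ℂ (weylForm (indicatorSymbol quarterPlane) v w) := by
    rw [weylForm_conj]
    simp_rw [indicatorSymbol_conj]
  have hw0 : ∀ x, 0 ≤ x → w x = 0 := fun x hx => by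
    rw [hw', halfLineLift_of_nonpos _ (by linarith)]
  have hww : weylForm (indicatorSymbol quarterPlane) w w = 0 := by
    rw [weylForm]
    refine integral_eq_zero_of_ae (ae_of_all _ fun X => ?_)
    by_cases hX : X ∈ quarterPlane
    · simp only [Pi.zero_apply]
      rw [wigner_eq_zero_of_nonneg hw0 hw0 hX.1, mul_zero]
    · simp only [Pi.zero_apply, indicatorSymbol]
      rw [Set.indicator_of_notMem hX, zero_mul]
  constructor
  · rw [huvw, weylForm_add_left hq, weylForm_add_right hq, weylForm_add_right hq, hww, add_zero, hwv,
      add_assoc, Complex.add_conj, hvv, hvw]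
    have e1 : ∀ τ, 𝓕 (f : ℝ → ℂ) τ * starRingEnd ℂ (𝓕 (f : ℝ → ℂ) τ) * (quarterDiag τ : ℂ) =
        ((quarterDiag τ * ‖𝓕 (f : ℝ → ℂ) τ‖ ^ 2 : ℝ) : ℂ) := fun τ => by
      rw [Complex.mul_conj, Complex.normSq_eq_norm_sq]; push_cast; ring
    simp_rw [e1]
    rw [integral_complex_ofReal, ← Complex.ofReal_add]
    congr 1
    simp only [quarterMatrixForm]
    have hre : Integrable fun τ => 2 * (𝓕 (f : ℝ → ℂ) τ * starRingEnd ℂ (𝓕 (g : ℝ → ℂ) τ) *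
        starRingEnd ℂ (quarterOffDiag τ)).re :=
      (integrable_fourier_mul_conj_offDiag f g).re.const_mul 2
    rw [integral_add (integrable_fourier_diag f) hre, integral_const_mul]
    congr 2
    exact (integral_re (integrable_fourier_mul_conj_offDiag f g)).symm
  · have hs : ∀ x, u x * starRingEnd ℂ (u x) = v x * starRingEnd ℂ (v x) + w x * starRingEnd ℂ (w x) := by
      intro x
      rw [huvw, add_apply]
      rcases le_total 0 x with hx | hx
      · rw [hw0 x hx]; simp
      · rw [hv', halfLineLift_of_nonpos _ hx]; simp
    have hi : ∀ a : 𝓢(ℝ, ℂ), Integrable fun x => a x * starRingEnd ℂ (a x) := fun a =>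
      integrable_mul_of_sqInt (sqInt_schwartz a) (sqInt_schwartz a).conj
    have hn : ∀ a : 𝓢(ℝ, ℂ), ∫ t, a t * starRingEnd ℂ (a t) =
        ((∫ τ, ‖𝓕 (a : ℝ → ℂ) τ‖ ^ 2 : ℝ) : ℂ) := fun a => by
      rw [integral_mul_conj_eq_fourier, ← integral_complex_ofReal]
      refine integral_congr_ae (ae_of_all _ fun τ => ?_)
      dsimp only
      rw [Complex.mul_conj, Complex.normSq_eq_norm_sq]
    simp_rw [hs]
    rw [integral_add (hi v) (hi w), integral_add (integrable_norm_sq_fourier f)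
      (integrable_norm_sq_fourier g), Complex.ofReal_add, ← hn f, ← hn g]
    congr 1
    · simp_rw [hv']
      exact norm_halfLineLift_sq f
    · simp_rw [hw']
      rw [integral_neg_eq_self (fun x => halfLineLift g x * starRingEnd ℂ (halfLineLift g x))]
      exact norm_halfLineLift_sq g

/-- The smooth functions with compact support off the origin, in logarithmic coordinates. -/
noncomputable def lineLiftSubmodule : Submodule ℂ L2R where
  carrier := {x | ∃ f g u : 𝓢(ℝ, ℂ), HasCompactSupport f ∧ HasCompactSupport g ∧
    (u : ℝ → ℂ) = lineLift f g ∧ x = u.toLp 2 volume}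
  add_mem' := by
    rintro _ _ ⟨f, g, u, hf, hg, hu, rfl⟩ ⟨f', g', u', hf', hg', hu', rfl⟩
    refine ⟨f + f', g + g', u + u', hf.add hf', hg.add hg', ?_, ?_⟩
    · ext x
      rw [add_apply, hu, hu']
      simp only [lineLift, halfLineLift, Set.indicator]
      split_ifs <;> simp <;> ring
    · exact ((SchwartzMap.toLpCLM ℂ ℂ 2 (volume : Measure ℝ)).map_add u u').symm
  zero_mem' := by
    refine ⟨0, 0, 0, HasCompactSupport.zero, HasCompactSupport.zero, ?_, ?_⟩
    · ext x
      simp [lineLift, halfLineLift, Set.indicator]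
    · exact ((SchwartzMap.toLpCLM ℂ ℂ 2 (volume : Measure ℝ)).map_zero).symm
  smul_mem' := by
    rintro c _ ⟨f, g, u, hf, hg, hu, rfl⟩
    refine ⟨c • f, c • g, c • u, hf.smul_left (f := fun _ => c), hg.smul_left (f := fun _ => c), ?_, ?_⟩
    · ext x
      rw [smul_apply, hu]
      simp only [lineLift, halfLineLift, Set.indicator]
      split_ifs <;> simp <;> ring
    · exact ((SchwartzMap.toLpCLM ℂ ℂ 2 (volume : Measure ℝ)).map_smul c u).symm

/-- The logarithmic coordinate of a smooth function with compact support off the origin. -/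
theorem exists_log_coordinate {h : ℝ → ℂ} (hh : ContDiff ℝ ∞ h) (hc : HasCompactSupport h)
    (h0 : (0 : ℝ) ∉ tsupport h) : ∃ f : 𝓢(ℝ, ℂ), HasCompactSupport f ∧
      ∀ t, f t = Real.exp (t / 2) * h (Real.exp t) := by
  have hd : ContDiff ℝ ∞ fun t : ℝ => (Real.exp (t / 2) : ℂ) * h (Real.exp t) :=
    (Complex.ofRealCLM.contDiff.comp (Real.contDiff_exp.comp (contDiff_id.div_const 2))).mul
      (hh.comp Real.contDiff_exp)
  have hs : HasCompactSupport fun t : ℝ => (Real.exp (t / 2) : ℂ) * h (Real.exp t) := by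
    have hK : IsCompact (Real.log '' (tsupport h ∩ Set.Ici 0)) := by
      refine (hc.isCompact.inter_right isClosed_Ici).image_of_continuousOn ?_
      refine Real.continuousOn_log.mono fun x hx => ?_
      rintro rfl
      exact h0 hx.1
    refine HasCompactSupport.of_support_subset_isCompact hK fun t ht => ?_
    have : Real.exp t ∈ tsupport h := subset_tsupport _ fun h' => ht (by simp [h'])
    exact ⟨Real.exp t, ⟨this, (Real.exp_pos t).le⟩, Real.log_exp t⟩
  exact ⟨hs.toSchwartzMap hd, hs, fun t => rfl⟩

/-- Every smooth function with compact support off the origin is such a lift, so an orthogonal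
vector integrates to zero against all of them and vanishes almost everywhere. -/
theorem topologicalClosure_lineLiftSubmodule : lineLiftSubmodule.topologicalClosure = ⊤ := by
  rw [Submodule.topologicalClosure_eq_top_iff, Submodule.eq_bot_iff]
  intro y hy
  have hloc : LocallyIntegrableOn (fun x => starRingEnd ℂ (y x)) {0}ᶜ :=
    ((sqInt_coe y).conj.2.locallyIntegrable (by norm_num)).locallyIntegrableOn _
  have key := IsOpen.ae_eq_zero_of_integral_contDiff_smul_eq_zero
    (isOpen_compl_singleton (x := (0 : ℝ))) hloc fun k hk hkc hks => ?_
  · rw [Lp.eq_zero_iff_ae_eq_zero]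
    have h0 : ∀ᵐ x : ℝ, x ≠ 0 := by simp [ae_iff]
    filter_upwards [key, h0] with x hx hx0
    simpa using hx hx0
  · set h : ℝ → ℂ := fun x => (k x : ℂ)
    have hh : ContDiff ℝ ∞ h := Complex.ofRealCLM.contDiff.comp hk
    have hc : HasCompactSupport h := hkc.comp_left (g := fun x : ℝ => (x : ℂ)) Complex.ofReal_zero
    have hts : tsupport h ⊆ tsupport k := closure_mono fun x hx => by
      simpa [h] using hx
    have h0 : (0 : ℝ) ∉ tsupport h := fun hm => hks (hts hm) rfl
    have hh' : ContDiff ℝ ∞ fun x => h (-x) := hh.comp contDiff_neg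
    have hc' : HasCompactSupport fun x => h (-x) := hc.comp_homeomorph (Homeomorph.neg ℝ)
    have h0' : (0 : ℝ) ∉ tsupport fun x => h (-x) := by
      rw [notMem_tsupport_iff_eventuallyEq] at h0 ⊢
      have ht : Tendsto (fun x : ℝ => -x) (𝓝 0) (𝓝 0) := by
        simpa using (continuous_neg (G := ℝ)).tendsto 0
      exact ht.eventually h0
    obtain ⟨f, hf, hfe⟩ := exists_log_coordinate hh hc h0
    obtain ⟨g, hg, hge⟩ := exists_log_coordinate hh' hc' h0'
    have hz : h 0 = 0 := image_eq_zero_of_notMem_tsupport h0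
    have e : h = lineLift f g := by
      ext x
      have hcancel : ∀ t : ℝ, (Real.exp (-(t / 2)) : ℂ) * Real.exp (t / 2) = 1 := fun t => by
        rw [← Complex.ofReal_mul, ← Real.exp_add]; simp
      rcases lt_trichotomy x 0 with hx | hx | hx
      · obtain ⟨t, ht⟩ : ∃ t, x = -Real.exp t :=
          ⟨Real.log (-x), by rw [Real.exp_log (by linarith), neg_neg]⟩
        rw [ht, lineLift_neg_exp, hge, ← mul_assoc, hcancel, one_mul]
      · rw [hx, hz, lineLift, halfLineLift_of_nonpos _ le_rfl, halfLineLift_of_nonpos _ (by simp),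
          add_zero]
      · obtain ⟨t, ht⟩ : ∃ t, x = Real.exp t := ⟨Real.log x, by rw [Real.exp_log hx]⟩
        rw [ht, lineLift_exp, hfe, ← mul_assoc, hcancel, one_mul]
    set u : 𝓢(ℝ, ℂ) := hc.toSchwartzMap hh
    have hu : (u : ℝ → ℂ) = lineLift f g := e
    have hm : (u.toLp 2 volume : L2R) ∈ lineLiftSubmodule := ⟨f, g, u, hf, hg, hu, rfl⟩
    have ho := (Submodule.mem_orthogonal' _ _).1 hy _ hm
    rw [inner_L2R] at ho
    rw [← ho]
    refine integral_congr_ae ?_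
    filter_upwards [u.coeFn_toLp 2 volume] with x hx
    rw [hx, Complex.real_smul]
    rfl

/-! ### Norm and spectrum of the quarter-plane operator -/

theorem norm_toLp_lineLift_sq (f g u : 𝓢(ℝ, ℂ)) (hf : HasCompactSupport f)
    (hg : HasCompactSupport g) (hu : (u : ℝ → ℂ) = lineLift f g) :
    ‖(u.toLp 2 volume : L2R)‖ ^ 2 =
      ∫ τ, (‖𝓕 (f : ℝ → ℂ) τ‖ ^ 2 + ‖𝓕 (g : ℝ → ℂ) τ‖ ^ 2) := by
  have h3 := inner_toLp u u
  rw [(weylForm_quarterPlane_lineLift f g u hf hg hu).2, inner_self_eq_norm_sq_to_K] at h3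
  apply Complex.ofReal_injective
  rw [Complex.ofReal_pow]
  exact h3

theorem re_inner_lineLift {A : L2R →L[ℂ] L2R}
    (hA : IsWeylQuantization (indicatorSymbol quarterPlane) A) (f g u : 𝓢(ℝ, ℂ))
    (hf : HasCompactSupport f) (hg : HasCompactSupport g) (hu : (u : ℝ → ℂ) = lineLift f g) :
    (inner ℂ (u.toLp 2 volume : L2R) (A (u.toLp 2 volume))).re =
      ∫ τ, quarterMatrixForm τ (𝓕 (f : ℝ → ℂ) τ) (𝓕 (g : ℝ → ℂ) τ) := by
  rw [hA u u]
  change (weylForm (indicatorSymbol quarterPlane) u u).re = _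
  rw [(weylForm_quarterPlane_lineLift f g u hf hg hu).1, Complex.ofReal_re]

/-- Pointwise matrix inequalities integrated in τ, then extended by density. -/
theorem quarterForm_bounds {A : L2R →L[ℂ] L2R} (hA : IsWeylQuantization (indicatorSymbol quarterPlane) A)
    {c : ℝ} (hc : ∀ τ, quarterTop τ ≤ c) (x : L2R) :
    -(1 / 2) * ‖x‖ ^ 2 ≤ (inner ℂ x (A x)).re ∧ (inner ℂ x (A x)).re ≤ c * ‖x‖ ^ 2 := by
  have hclosed : IsClosed {x : L2R | -(1 / 2) * ‖x‖ ^ 2 ≤ (inner ℂ x (A x)).re ∧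
      (inner ℂ x (A x)).re ≤ c * ‖x‖ ^ 2} := by
    have h1 : Continuous fun x : L2R => (inner ℂ x (A x)).re :=
      Complex.continuous_re.comp (continuous_id.inner A.continuous)
    have h2 : ∀ k : ℝ, Continuous fun x : L2R => k * ‖x‖ ^ 2 := fun k => by fun_prop
    exact (isClosed_le (h2 _) h1).inter (isClosed_le h1 (h2 c))
  have hsub : (lineLiftSubmodule : Set L2R) ⊆ {x : L2R | -(1 / 2) * ‖x‖ ^ 2 ≤ (inner ℂ x (A x)).re ∧
      (inner ℂ x (A x)).re ≤ c * ‖x‖ ^ 2} := by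
    rintro _ ⟨f, g, u, hf, hg, hu, rfl⟩
    have hi := (integrable_norm_sq_fourier f).add (integrable_norm_sq_fourier g)
    rw [Set.mem_ofPred_eq, norm_toLp_lineLift_sq f g u hf hg hu, re_inner_lineLift hA f g u hf hg hu,
      ← integral_const_mul, ← integral_const_mul]
    constructor
    · exact integral_mono (hi.const_mul _) (integrable_quarterMatrixForm f g)
        fun τ => neg_half_le_quarterMatrixForm τ _ _
    · exact integral_mono (integrable_quarterMatrixForm f g) (hi.const_mul _) fun τ =>
        (quarterMatrixForm_le τ _ _).trans (mul_le_mul_of_nonneg_right (hc τ) (by positivity))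
  have hd := closure_minimal hsub hclosed
  have ht : x ∈ lineLiftSubmodule.topologicalClosure := by
    rw [topologicalClosure_lineLiftSubmodule]; trivial
  exact hd ht

/-- Supplies wave packets: Fourier transforms concentrating at τ₀ as n grows, with compact support
kept in the logarithmic variable. -/
theorem exists_modulated_dilation (φ : 𝓢(ℝ, ℂ)) (hφ : HasCompactSupport φ) {n : ℝ} (hn : 0 < n)
    (τ₀ : ℝ) : ∃ f : 𝓢(ℝ, ℂ), HasCompactSupport f ∧
      ∀ τ, 𝓕 (f : ℝ → ℂ) τ = n * 𝓕 (φ : ℝ → ℂ) (n * (τ - τ₀)) := by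
  set h : ℝ → ℂ := fun t => Complex.exp ((2 * Real.pi * τ₀ * t : ℝ) * I) * φ (n⁻¹ * t)
  have hd : ContDiff ℝ ∞ h := by
    have h1 : ContDiff ℝ ∞ φ := φ.smooth'
    have h2 : ContDiff ℝ ∞ fun t : ℝ => (((2 * Real.pi * τ₀ * t : ℝ) : ℂ)) * I :=
      (Complex.ofRealCLM.contDiff.comp (contDiff_const.mul contDiff_id)).mul contDiff_const
    exact h2.cexp.mul (h1.comp (contDiff_const.mul contDiff_id))
  have hc : HasCompactSupport h := by
    have : HasCompactSupport fun t => φ (n⁻¹ * t) :=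
      hφ.comp_homeomorph (Homeomorph.mulLeft₀ n⁻¹ (inv_ne_zero hn.ne'))
    exact this.mul_left
  refine ⟨hc.toSchwartzMap hd, hc, fun τ => ?_⟩
  change 𝓕 h τ = _
  rw [Real.fourier_real_eq_integral_exp_smul, Real.fourier_real_eq_integral_exp_smul]
  have e := Measure.integral_comp_mul_left (fun x : ℝ => Complex.exp
    (((-2 * Real.pi * x * (n * (τ - τ₀)) : ℝ) : ℂ) * I) • φ x) n⁻¹
  rw [inv_inv, abs_of_pos hn, Complex.real_smul] at e
  rw [← e]
  refine integral_congr_ae (ae_of_all _ fun t => ?_)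
  simp only [h, smul_eq_mul]
  rw [← mul_assoc, ← Complex.exp_add]
  congr 2
  have hn' : (n : ℂ) ≠ 0 := by exact_mod_cast hn.ne'
  push_cast
  field_simp
  ring

theorem exists_compactSupport_fourier_pos : ∃ φ : 𝓢(ℝ, ℂ), HasCompactSupport φ ∧
    0 < ∫ τ, ‖𝓕 (φ : ℝ → ℂ) τ‖ ^ 2 := by
  let b : ContDiffBump (0 : ℝ) := ⟨1, 2, one_pos, one_lt_two⟩
  have hd : ContDiff ℝ ∞ fun x => (b x : ℂ) := Complex.ofRealCLM.contDiff.comp b.contDiff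
  have hc : HasCompactSupport fun x => (b x : ℂ) :=
    b.hasCompactSupport.comp_left (g := fun x : ℝ => (x : ℂ)) Complex.ofReal_zero
  refine ⟨hc.toSchwartzMap hd, hc, ?_⟩
  have h := SchwartzMap.integral_norm_sq_fourier (hc.toSchwartzMap hd)
  rw [SchwartzMap.fourier_coe] at h
  rw [h]
  have hcont : Continuous fun x => ‖(hc.toSchwartzMap hd) x‖ ^ 2 := by fun_prop
  refine hcont.integral_pos_of_hasCompactSupport_nonneg_nonzero (x := 0) ?_ (fun x => by positivity) ?_
  · exact hc.norm.comp_left (g := fun x : ℝ => x ^ 2) (by norm_num)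
  · change ‖(b 0 : ℂ)‖ ^ 2 ≠ 0
    rw [b.one_of_mem_closedBall (by simp [b.rIn_pos.le])]
    simp

/-- Test the form on wave packets concentrating at τ₀ and polarised along the top eigenvector of the
matrix at τ₀; continuity of the entries yields the eigenvalue in the limit. -/
theorem quarterTop_le_of_re_inner_le {A : L2R →L[ℂ] L2R}
    (hA : IsWeylQuantization (indicatorSymbol quarterPlane) A) {c : ℝ}
    (hc : ∀ x : L2R, (inner ℂ x (A x)).re ≤ c * ‖x‖ ^ 2) (τ₀ : ℝ) : quarterTop τ₀ ≤ c := by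
  obtain ⟨φ, hφ, hpos⟩ := exists_compactSupport_fourier_pos
  set α : ℂ := (quarterTop τ₀ : ℂ)
  set β : ℂ := starRingEnd ℂ (quarterOffDiag τ₀)
  -- The eigenvector is frozen at τ₀ while the matrix varies with τ; p is the excess of its form
  -- over c.
  set p : ℝ → ℝ := fun τ => quarterMatrixForm τ α β - c * (‖α‖ ^ 2 + ‖β‖ ^ 2)
  have hpc : Continuous p := by
    have h1 := continuous_quarterDiag
    have h2 := Complex.continuous_conj.comp continuous_quarterOffDiag
    have h3 : Continuous fun τ => (α * starRingEnd ℂ β * starRingEnd ℂ (quarterOffDiag τ)).re :=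
      Complex.continuous_re.comp (continuous_const.mul h2)
    exact ((h1.mul continuous_const).add (continuous_const.mul h3)).sub continuous_const
  obtain ⟨C, hC⟩ : ∃ C, ∀ τ, ‖p τ‖ ≤ C := by
    refine ⟨1.0206 * (‖α‖ ^ 2 + ‖β‖ ^ 2) + 1 / 2 * (‖α‖ ^ 2 + ‖β‖ ^ 2) +
      |c * (‖α‖ ^ 2 + ‖β‖ ^ 2)|, fun τ => ?_⟩
    have h1 := quarterMatrixForm_le τ α β
    have h2 := neg_half_le_quarterMatrixForm τ α β
    have h3 : quarterTop τ * (‖α‖ ^ 2 + ‖β‖ ^ 2) ≤ 1.0206 * (‖α‖ ^ 2 + ‖β‖ ^ 2) :=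
      mul_le_mul_of_nonneg_right (quarterTop_le τ) (by positivity)
    have h4 : 0 ≤ ‖α‖ ^ 2 + ‖β‖ ^ 2 := by positivity
    rw [Real.norm_eq_abs]
    refine (abs_sub _ _).trans (add_le_add_left ?_ _)
    rw [abs_le]
    constructor <;> linarith
  have hJ : ∀ n : ℕ, ∫ σ, p (τ₀ + σ / (n + 1)) * ‖𝓕 (φ : ℝ → ℂ) σ‖ ^ 2 ≤ 0 := by
    intro n
    have hn : (0 : ℝ) < n + 1 := by positivity
    obtain ⟨f, hf, hfe⟩ := exists_modulated_dilation φ hφ hn τ₀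
    have hfα : ∀ (a : ℂ) τ, 𝓕 ((a • f : 𝓢(ℝ, ℂ)) : ℝ → ℂ) τ = a * 𝓕 (f : ℝ → ℂ) τ := fun a τ => by
      rw [← SchwartzMap.fourier_coe, ← SchwartzMap.fourier_coe, FourierTransform.fourier_smul]
      rfl
    have hcα : ∀ a : ℂ, HasCompactSupport (a • f : 𝓢(ℝ, ℂ)) := fun a =>
      hf.smul_left (f := fun _ => a)
    obtain ⟨u, hu⟩ := exists_lineLift (α • f).smooth' (hcα α) (β • f).smooth' (hcα β)
    have h1 := hc (u.toLp 2 volume)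
    have hsum : Integrable fun τ => c * (‖𝓕 ((α • f : 𝓢(ℝ, ℂ)) : ℝ → ℂ) τ‖ ^ 2 +
        ‖𝓕 ((β • f : 𝓢(ℝ, ℂ)) : ℝ → ℂ) τ‖ ^ 2) :=
      ((integrable_norm_sq_fourier (α • f)).add (integrable_norm_sq_fourier (β • f))).const_mul c
    rw [norm_toLp_lineLift_sq (α • f) (β • f) u (hcα α) (hcα β) hu,
      re_inner_lineLift hA (α • f) (β • f) u (hcα α) (hcα β) hu, ← integral_const_mul, ← sub_nonpos,
      ← integral_sub (integrable_quarterMatrixForm _ _) hsum] at h1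
    have e1 : ∀ τ, quarterMatrixForm τ (𝓕 ((α • f : 𝓢(ℝ, ℂ)) : ℝ → ℂ) τ)
        (𝓕 ((β • f : 𝓢(ℝ, ℂ)) : ℝ → ℂ) τ) - c * (‖𝓕 ((α • f : 𝓢(ℝ, ℂ)) : ℝ → ℂ) τ‖ ^ 2 +
          ‖𝓕 ((β • f : 𝓢(ℝ, ℂ)) : ℝ → ℂ) τ‖ ^ 2) =
        (n + 1 : ℝ) ^ 2 * (p (τ₀ + (n + 1 : ℝ) * (τ - τ₀) / (n + 1)) *
          ‖𝓕 (φ : ℝ → ℂ) ((n + 1 : ℝ) * (τ - τ₀))‖ ^ 2) := fun τ => by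
      rw [hfα, hfα, quarterMatrixForm_smul, norm_mul α, norm_mul β, hfe, norm_mul, Complex.norm_real,
        Real.norm_of_nonneg hn.le, mul_div_cancel_left₀ _ hn.ne', add_sub_cancel]
      simp only [p]
      ring
    have e2 : ∫ τ, (n + 1 : ℝ) ^ 2 * (p (τ₀ + (n + 1 : ℝ) * (τ - τ₀) / (n + 1)) *
          ‖𝓕 (φ : ℝ → ℂ) ((n + 1 : ℝ) * (τ - τ₀))‖ ^ 2) =
        (n + 1 : ℝ) * ∫ σ, p (τ₀ + σ / (n + 1)) * ‖𝓕 (φ : ℝ → ℂ) σ‖ ^ 2 := by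
      rw [integral_const_mul, integral_sub_right_eq_self (fun τ => p (τ₀ + (n + 1 : ℝ) * τ / (n + 1)) *
          ‖𝓕 (φ : ℝ → ℂ) ((n + 1 : ℝ) * τ)‖ ^ 2),
        Measure.integral_comp_mul_left (fun σ => p (τ₀ + σ / (n + 1)) * ‖𝓕 (φ : ℝ → ℂ) σ‖ ^ 2),
        smul_eq_mul, abs_of_pos (inv_pos.2 hn)]
      field_simp
    simp_rw [e1] at h1
    rw [e2] at h1
    exact nonpos_of_mul_nonpos_right h1 hn
  have hlim : Tendsto (fun n : ℕ => ∫ σ, p (τ₀ + σ / (n + 1)) * ‖𝓕 (φ : ℝ → ℂ) σ‖ ^ 2) atTop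
      (𝓝 (∫ σ, p τ₀ * ‖𝓕 (φ : ℝ → ℂ) σ‖ ^ 2)) := by
    refine tendsto_integral_of_dominated_convergence (fun σ => C * ‖𝓕 (φ : ℝ → ℂ) σ‖ ^ 2)
      (fun n => ?_) ((integrable_norm_sq_fourier φ).const_mul C) (fun n => ae_of_all _ fun σ => ?_)
      (ae_of_all _ fun σ => Tendsto.mul_const _ ?_)
    · exact (Continuous.aestronglyMeasurable (hpc.comp (by fun_prop))).mul
        (integrable_norm_sq_fourier φ).aestronglyMeasurable
    · rw [norm_mul, Real.norm_of_nonneg (sq_nonneg ‖𝓕 (φ : ℝ → ℂ) σ‖)]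
      exact mul_le_mul_of_nonneg_right (hC _) (sq_nonneg _)
    · have h1 : Tendsto (fun n : ℕ => τ₀ + σ * (1 / ((n : ℝ) + 1))) atTop (𝓝 (τ₀ + σ * 0)) :=
        (tendsto_one_div_add_atTop_nhds_zero_nat.const_mul σ).const_add τ₀
      rw [mul_zero, add_zero] at h1
      simpa only [mul_one_div, Function.comp_def] using (hpc.tendsto τ₀).comp h1
  have h0 := le_of_tendsto' hlim hJ
  rw [integral_const_mul] at h0
  have h1 : p τ₀ ≤ 0 := nonpos_of_mul_nonpos_left h0 hpos
  -- At τ₀ itself the frozen vector is an eigenvector, and its norm is nonzero.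
  have h2 : p τ₀ = (quarterTop τ₀ - c) * (quarterTop τ₀ ^ 2 + ‖quarterOffDiag τ₀‖ ^ 2) := by
    simp only [p, α, β]
    rw [quarterMatrixForm_eigenvector, RCLike.norm_conj, Complex.norm_real, Real.norm_eq_abs, sq_abs]
    ring
  have h3 : 0 < quarterTop τ₀ ^ 2 + ‖quarterOffDiag τ₀‖ ^ 2 := by
    have := quarterTop_pos τ₀
    positivity
  rw [h2] at h1
  linarith [nonpos_of_mul_nonpos_left h1 h3]

theorem quarterTop_le_iSup (τ : ℝ) : quarterTop τ ≤ ⨆ τ, quarterTop τ :=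
  le_ciSup ⟨1.0206, by rintro _ ⟨τ, rfl⟩; exact quarterTop_le τ⟩ τ

theorem one_lt_iSup_quarterTop : 1 < ⨆ τ, quarterTop τ := by
  obtain ⟨τ, h⟩ := exists_one_lt_quarterTop
  exact h.trans_le (quarterTop_le_iSup τ)

/-- The norm of a self-adjoint operator is the supremum of its absolute Rayleigh quotients. Negative
quotients are at least -1/2 and cannot compete with a supremum above 1. -/
theorem norm_quarterPlane {A : L2R →L[ℂ] L2R}
    (hA : IsWeylQuantization (indicatorSymbol quarterPlane) A) : ‖A‖ = ⨆ τ, quarterTop τ := by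
  have h1 := one_lt_iSup_quarterTop
  refine le_antisymm ?_ (ciSup_le (quarterTop_le_of_re_inner_le hA fun x => ?_))
  · rw [A.norm_eq_iSup_rayleighQuotient hA.isSelfAdjoint.isSymmetric]
    refine ciSup_le fun x => ?_
    obtain ⟨h2, h3⟩ := quarterForm_bounds hA quarterTop_le_iSup x
    rw [ContinuousLinearMap.rayleighQuotient, ContinuousLinearMap.reApplyInnerSelf_apply,
      inner_re_symm, abs_div, abs_of_nonneg (sq_nonneg ‖x‖)]
    refine div_le_of_le_mul₀ (sq_nonneg _) (by linarith) (abs_le.2 ⟨?_, h3⟩)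
    refine le_trans ?_ h2
    nlinarith [sq_nonneg ‖x‖]
  · refine (Complex.re_le_norm _).trans ((norm_inner_le_norm _ _).trans ?_)
    nlinarith [A.le_opNorm x, norm_nonneg x]

theorem muPlus_two : muPlus 2 = ⨆ τ, quarterTop τ := by
  obtain ⟨A, hA⟩ := exists_weyl_polygon quarterPlane_mem_polygons
  have h1 := one_lt_iSup_quarterTop
  refine le_antisymm ?_ ((norm_quarterPlane hA).symm.le.trans
    (norm_le_muPlus quarterPlane_mem_polygons hA))
  have hF : FormBound (indicatorSymbol quarterPlane) (⨆ τ, quarterTop τ) :=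
    hA.formBound.mono (norm_quarterPlane hA).le
  exact csSup_le (polygonNorms_nonempty 2) fun r hr =>
    le_of_mem_polygonNorms (by linarith) (fun P hP => formBound_polygons_two h1.le hF hP) hr

theorem isGreatest_spectrum_quarterPlane {A : L2R →L[ℂ] L2R}
    (hA : IsWeylQuantization (indicatorSymbol quarterPlane) A) :
    IsGreatest (spectrum ℝ A) (muPlus 2) := by
  have hn : ‖A‖ = muPlus 2 := (norm_quarterPlane hA).trans muPlus_two.symm
  have h1 : 1 < ‖A‖ := (norm_quarterPlane hA).symm ▸ one_lt_iSup_quarterTop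
  have : Nontrivial (L2R →L[ℂ] L2R) := ⟨A, 0, fun h => by rw [h, norm_zero] at h1; linarith⟩
  have hsa := hA.isSelfAdjoint
  rw [← hn]
  refine ⟨(CStarAlgebra.norm_or_neg_norm_mem_spectrum hsa).resolve_right fun h => ?_, fun r hr =>
    (le_abs_self r).trans (spectrum.norm_le_norm_of_mem hr)⟩
  refine h ?_
  rw [spectrum.mem_resolventSet_iff, ← IsUnit.neg_iff]
  -- Either ‖A‖ or -‖A‖ is in the spectrum. Since ‖A‖ > 1 and the form is at least -1/2, A + ‖A‖ is
  -- bounded below by 1/2 and invertible, which excludes the second case.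
  refine ContinuousLinearMap.isUnit_of_forall_le_norm_inner_map _ (c := 1 / 2)
    one_half_pos fun x => ?_
  have h2 := (quarterForm_bounds hA quarterTop_le_iSup x).1
  have e : (-(algebraMap ℝ (L2R →L[ℂ] L2R) (-‖A‖) - A)) x = A x + ((‖A‖ : ℝ) : ℂ) • x := by
    rw [Algebra.algebraMap_eq_smul_one]
    simp [add_comm]
    rfl
  have e2 : (inner ℂ x (A x + ((‖A‖ : ℝ) : ℂ) • x)).re = (inner ℂ x (A x)).re + ‖A‖ * ‖x‖ ^ 2 := by
    rw [inner_add_right, inner_smul_right, inner_self_eq_norm_sq_to_K, Complex.add_re,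
      Complex.re_ofReal_mul]
    norm_cast
  rw [norm_inner_symm]
  refine le_trans ?_ (Complex.re_le_norm _)
  refine le_trans ?_ (e2.symm.trans (congrArg (fun y => (inner ℂ x y).re) e.symm)).le
  push_cast
  nlinarith [sq_nonneg ‖x‖]

/-- The sequence √(N/2) is stable under the recursion. It cannot start at N = 2, where it equals 1
and lies below the supremum. -/
theorem muPlus_le_sqrt (N : ℕ) : muPlus (N + 3) ≤ √(((N + 3 : ℕ) : ℝ) / 2) := by
  induction N with
  | zero =>
    -- The largest M with `nextBound M` ≤ √(3/2) is 5/(2√6) ≈ 1.02062, which dictates the constant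
    -- 1.0206; likewise 1.22474 is just below √(3/2).
    have h2 : muPlus 2 ≤ 1.0206 := muPlus_two.le.trans (ciSup_le quarterTop_le)
    have h0 := muPlus_nonneg 2
    refine (muPlus_succ_le 2).trans (Real.le_sqrt_of_sq_le ?_)
    have h3 : nextBound (muPlus 2) ≤ 1.22474 := by
      rw [nextBound, div_le_iff₀ two_pos, ← le_sub_iff_add_le']
      refine Real.sqrt_le_iff.2 ⟨by linarith, by nlinarith⟩
    have := nextBound_nonneg (muPlus 2)
    norm_num
    nlinarith
  | succ N ih =>
    refine (muPlus_succ_le (N + 3)).trans ?_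
    set m := muPlus (N + 3)
    have hm : 0 ≤ m := muPlus_nonneg _
    set a : ℝ := ((N + 3 : ℕ) : ℝ) / 2
    have ha : 3 / 2 ≤ a := by simp only [a]; push_cast; linarith [N.cast_nonneg (α := ℝ)]
    have e : ((N + 1 + 3 : ℕ) : ℝ) / 2 = a + 1 / 2 := by simp only [a]; push_cast; ring
    rw [e]
    set S := √(a + 1 / 2)
    have hS : S ^ 2 = a + 1 / 2 := Real.sq_sqrt (by linarith)
    have hS0 : 0 < S := Real.sqrt_pos.2 (by linarith)
    have hm2 : m ^ 2 ≤ a := (Real.le_sqrt hm (by linarith)).1 ih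
    rw [nextBound, div_le_iff₀ two_pos, ← le_sub_iff_add_le']
    -- `nextBound m` ≤ S amounts to mS ≤ S² - 1/4 = a + 1/4, and (mS)² ≤ a(a + 1/2) ≤ (a + 1/4)².
    have hmS : m * S ≤ S ^ 2 - 1 / 4 := by
      refine abs_le_of_sq_le_sq' ?_ (by nlinarith) |>.2
      rw [mul_pow, hS]
      nlinarith
    refine Real.sqrt_le_iff.2 ⟨?_, ?_⟩
    · have : m * S ≤ (S * 2) * S := by nlinarith
      linarith [le_of_mul_le_mul_right this hS0]
    · nlinarith

theorem mainTheorem10 :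
    -- the Weyl quantization of the indicator of any convex polygon is a well-defined bounded
    -- operator, and the supremum defining `μ_N⁺` is finite
    (∀ N : ℕ, 1 ≤ N →
      (∀ P ∈ polygons N, ∃! A : L2R →L[ℂ] L2R, IsWeylQuantization (indicatorSymbol P) A) ∧
      BddAbove (polygonNorms N)) ∧
    -- the value of `μ₂⁺`
    (∃ A₀ : L2R →L[ℂ] L2R, IsWeylQuantization (indicatorSymbol quarterPlane) A₀ ∧
      IsSelfAdjoint A₀ ∧ IsGreatest (spectrum ℝ A₀) (muPlus 2)) ∧
    IsLUB quarterEigenvalues (muPlus 2) ∧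
    1 < muPlus 2 ∧
    -- the recursion
    (∀ N : ℕ, 2 ≤ N → muPlus N ≤ (muPlus (N - 1) + √(muPlus (N - 1) ^ 2 + 1)) / 2) ∧
    -- the bound
    (∀ N : ℕ, 3 ≤ N → muPlus N ≤ √((N : ℝ) / 2)) := by
  refine ⟨fun N _ => ⟨fun P hP => ?_, bddAbove_polygonNorms N⟩, ?_, ?_, ?_, fun N hN => ?_,
    fun N hN => ?_⟩
  · obtain ⟨A, hA⟩ := exists_weyl_polygon hP
    exact ⟨A, hA, fun B hB => hB.unique hA⟩
  · obtain ⟨A, hA⟩ := exists_weyl_polygon quarterPlane_mem_polygons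
    exact ⟨A, hA, hA.isSelfAdjoint, isGreatest_spectrum_quarterPlane hA⟩
  · rw [muPlus_two]
    exact isLUB_quarterEigenvalues
  · rw [muPlus_two]
    exact one_lt_iSup_quarterTop
  · obtain ⟨M, rfl⟩ : ∃ M, N = M + 1 := ⟨N - 1, by omega⟩
    exact muPlus_succ_le M
  · obtain ⟨M, rfl⟩ : ∃ M, N = M + 3 := ⟨N - 3, by omega⟩
    exact muPlus_le_sqrt M
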